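/- Let $\Bbbk$ be an algebraically closed field. A \emph{finite category} is a $\Bbbk$-linear abelian category with finite-dimensional Hom spaces, all objects of finite length, enough projectives and finitely many simple objects up to isomorphism. A \emph{tensor category} is a finite category with a rigid monoidal structure whose tensor product is $\Bbbk$-bilinear and whose unit object $\mathbf 1$ is simple. For $V$ in a tensor category, $V^*$ is the dual with evaluation $V^*\otimes V\to\mathbf 1$. Let $\mathcal V$ be a braided tensor category and $\mathcal C$ a tensor category which is \emph{$\mathcal V$-central}: it comes with a faithful, right exact, braided (strong) monoidal functor $G:\mathcal V\to\mathcal Z(\mathcal C)$ to the Drinfeld center. Objects of $\mathcal Z(\mathcal C)$ are pairs $(A,\sigma)$ with natural isomorphisms $\sigma_X=\sigma_{A,X}:A\otimes X\to X\otimes A$ satisfying $\sigma_{X\otimes Y}=(\mathrm{id}_X\otimes\sigma_Y)(\sigma_X\otimes \mathrm{id}_Y)$, and the braiding of $(A,\sigma)$ with $(B,\tau)$ is $\sigma_B$. The \emph{relative center} $\mathcal Z^{\mathcal V}(\mathcal C)$ is the full (braided monoidal) subcategory of $\mathcal Z(\mathcal C)$ of the objects $A$ with $\sigma_{G(V),A}\,\sigma_{A,G(V)}=\mathrm{id}_{A\otimes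 G(V)}$ for all $V\in\mathcal V$. A \emph{$\mathcal C$-module category} is a finite category $\mathcal M$ with an action $\triangleright:\mathcal C\times\mathcal M\to\mathcal M$, $\Bbbk$-bilinear and exact in each variable, with the usual coherent associativity and unit isomorphisms. It is \emph{exact} if $P\triangleright M$ is projective for every projective $P\in\mathcal C$ and every $M\in\mathcal M$, and \emph{indecomposable} if it is non-zero and not equivalent, as a $\mathcal C$-module category, to a direct sum of two non-zero $\mathcal C$-module categories. Let $\mathcal M$ be an exact indecomposable $\mathcal C$-module category. \emph{The functor $\rho$.} The category $\mathcal V$ acts on $\mathcal M$ by $V\blacktriangleright M=G(V)\triangleright M$. Let $\operatorname{End}_{\mathcal V}(\mathcal M)$ be the category of $\mathcal V$-module endofunctors $(F,d)$, $d_{V,M}:F(V\blacktriangleright M)\xrightarrow{\sim}V\blacktriangleright F(M)$, of $\mathcal M$ and module natural transformations, monoidal under composition. For $X\in\mathcal C$ the functor $\rho(X)=X\triangleright-$ lies in $\operatorname{End}_{\mathcal V}(\mathcal M)$ through $\sigma_{G(V),X}^{-1}\triangleright \mathrm{id}_M:X\triangleright (V\blacktriangleright M)\to V\blacktriangleright (X\triangleright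 M)$, and $\rho:\mathcal C\to\operatorname{End}_{\mathcal V}(\mathcal M)$ is strong monoidal. (Associativity and unit constraints are suppressed in formulas.) \emph{Internal Homs.} $\underline{\operatorname{Hom}}(M,N)\in\mathcal C$ is defined by isomorphisms $\psi:\operatorname{Hom}_{\mathcal M}(X\triangleright M,N)\cong\operatorname{Hom}_{\mathcal C}(X,\underline{\operatorname{Hom}}(M,N))$ natural in $X,M,N$, with evaluation $\mathrm{ev}_{M,N}=\psi^{-1}(\mathrm{id}):\underline{\operatorname{Hom}}(M,N)\triangleright M\to N$. Put $$\mathfrak a^{-1}_{X,M,N}=\psi(\mathrm{id}_X\triangleright\mathrm{ev}_{M,N}):X\otimes\underline{\operatorname{Hom}}(M,N)\to\underline{\operatorname{Hom}}(M,X\triangleright N),$$ $$\mathfrak b_{X,M,N}=\psi(\mathrm{ev}_{X\triangleright M,N}):\underline{\operatorname{Hom}}(X\triangleright M,N)\otimes X\to\underline{\operatorname{Hom}}(M,N).$$ \emph{Relative ends and $\bar\rho$.} For $(F,d)\in\operatorname{End}_{\mathcal V}(\mathcal M)$ let $$\beta^V_{M,N}:\underline{\operatorname{Hom}}(M,F(V\blacktriangleright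 N))\to\underline{\operatorname{Hom}}(V^*\blacktriangleright M,F(N))$$ be $\psi$ of the following composite, with $H=\underline{\operatorname{Hom}}(M,F(V\blacktriangleright N))$: $$H\triangleright(V^*\blacktriangleright M)\xrightarrow{\sigma^{-1}_{G(V^*),H}\triangleright \mathrm{id}}V^*\blacktriangleright(H\triangleright M)\xrightarrow{V^*\blacktriangleright(d_{V,N}\,\mathrm{ev})}V^*\blacktriangleright (V\blacktriangleright F(N))\xrightarrow{\ \mathrm{ev}_V\ }F(N).$$ The relative end $\bar\rho(F)=\oint_{M}(\underline{\operatorname{Hom}}(M,F(M)),\beta)$ is an object of $\mathcal C$ with morphisms $\lambda^F_M:\bar\rho(F)\to\underline{\operatorname{Hom}}(M,F(M))$, universal among families that are dinatural in $M$ and satisfy, for all $V\in\mathcal V$ and $M\in\mathcal M$, $$\underline{\operatorname{Hom}}(\mathrm{ev}_V\blacktriangleright M,F(M))\,\lambda_M=\underline{\operatorname{Hom}}(m_{V^*,V,M},F(M))\,\beta^V_{V\blacktriangleright M,M}\,\lambda_{V\blacktriangleright M},$$ where $m_{V^*,V,M}:(V^*\otimes V)\blacktriangleright M\to V^*\blacktriangleright(V\blacktriangleright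 M)$ is the associativity isomorphism. When internal Homs and these relative ends have been chosen, $\bar\rho:\operatorname{End}_{\mathcal V}(\mathcal M)\to\mathcal C$ is a functor right adjoint to $\rho$, where $z:\rho(X)\to F$ corresponds to the $h:X\to\bar\rho(F)$ with $\lambda^F_M h=\psi(z_M)$ for all $M$. Let $e:\rho\bar\rho\to\mathrm{Id}$ be the counit. As right adjoint of a strong monoidal functor, $\bar\rho$ is lax monoidal with structure maps $\mu_{F,F'}:\bar\rho(F)\otimes\bar\rho(F')\to\bar\rho(FF')$ and $\varepsilon:\mathbf 1\to\bar\rho(\mathrm{Id}_{\mathcal M})$. Let $$l^{-1}_{X,F}:X\otimes\bar\rho(F)\to\bar\rho(\rho(X)F),\qquad r^{-1}_{F,X}:\bar\rho(F)\otimes X\to\bar\rho(F\rho(X))$$ be the morphisms adjoint to $\rho(X\otimes\bar\rho(F))\cong\rho(X)\rho\bar\rho(F)\xrightarrow{\rho(X)e_F}\rho(X)F$ and $\rho(\bar\rho(F)\otimes X)\cong\rho\bar\rho(F)\rho(X)\xrightarrow{e_F\rho(X)}F\rho(X)$. \textbf{Statement.} Internal Homs for $\mathcal M$ exist; for every choice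 of them the relative ends $\bar\rho(F)$ exist for all $F\in\operatorname{End}_{\mathcal V}(\mathcal M)$; and for every choice of these, all $l^{-1}_{X,F}$ and $r^{-1}_{F,X}$ are isomorphisms. Let $A=A_{\mathcal V,\mathcal M}=\bar\rho(\mathrm{Id}_{\mathcal M})$, $\pi_M=\lambda_M^{\mathrm{Id}}$, and $$\sigma_X=l_{X,\mathrm{Id}}\;\bar\rho(c_X)\;r^{-1}_{\mathrm{Id},X}:A\otimes X\to X\otimes A,\qquad c_X=\mathrm{id}:\mathrm{Id}_{\mathcal M}\,\rho(X)\to\rho(X)\,\mathrm{Id}_{\mathcal M},$$ so that $(A,\sigma)$ is the object $\mathcal Z_{\mathcal C}(\bar\rho)(\mathrm{Id}_{\mathcal M})$. Then: \begin{enumerate} \item $\sigma$ is a half-braiding on $A$, and it is the only half-braiding such that for all $X\in\mathcal C$, $M\in\mathcal M$ $$\mathfrak b_{X,M,X\triangleright M}\,(\pi_{X\triangleright M}\otimes\mathrm{id}_X)=\mathfrak a^{-1}_{X,M,M}\,(\mathrm{id}_X\otimes\pi_M)\,\sigma_X .$$ Moreover $(A,\sigma)\in\mathcal Z^{\mathcal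 V}(\mathcal C)$, and it is an algebra in $\mathcal Z^{\mathcal V}(\mathcal C)$ with multiplication $\mu_{\mathrm{Id},\mathrm{Id}}:A\otimes A\to A$ and unit $\varepsilon:\mathbf 1\to A$. \item This algebra is commutative in $\mathcal Z^{\mathcal V}(\mathcal C)$: $\mu_{\mathrm{Id},\mathrm{Id}}\,\sigma_A=\mu_{\mathrm{Id},\mathrm{Id}}$. \item It is connected: $\dim_{\Bbbk}\operatorname{Hom}_{\mathcal Z(\mathcal C)}(\mathbf 1,(A,\sigma))=1$. \end{enumerate} -/

import Mathlib

open CategoryTheory MonoidalCategory Limits Opposite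
open scoped MonoidalLeftAction

universe w v₁ v₂ v₃ v₄ u₁ u₂ u₃ u₄

noncomputable section

namespace RelativeCenter

section ModuleEndofunctors

variable {W : Type u₁} [Category.{v₁} W] [MonoidalCategory W]
  {M : Type u₂} [Category.{v₂} M] [MonoidalLeftAction W M]
  {N : Type u₃} [Category.{v₃} N] [MonoidalLeftAction W N]

open Functor.OplaxLeftLinear

/-- A module functor structure given by natural isomorphisms `F (X ⊙ₗ d) ≅ X ⊙ₗ F d`. -/
@[reducible]
def leftLinearOfIso (F : M ⥤ N) (c : ∀ (X : W) (d : M), F.obj (X ⊙ₗ d) ≅ X ⊙ₗ F.obj d)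
    (nat_left : ∀ {X Y : W} (f : X ⟶ Y) (d : M),
      F.map (f ⊵ₗ d) ≫ (c Y d).hom = (c X d).hom ≫ f ⊵ₗ F.obj d)
    (nat_right : ∀ (X : W) {d d' : M} (f : d ⟶ d'),
      F.map (X ⊴ₗ f) ≫ (c X d').hom = (c X d).hom ≫ X ⊴ₗ F.map f)
    (assoc : ∀ (X Y : W) (d : M), (c (X ⊗ Y) d).hom ≫ (αₗ _ _ _).hom =
      F.map (αₗ _ _ _).hom ≫ (c X (Y ⊙ₗ d)).hom ≫ X ⊴ₗ (c Y d).hom)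
    (unit : ∀ d : M, (c (𝟙_ W) d).hom ≫ (λₗ (F.obj d)).hom = F.map (λₗ d).hom) :
    F.LeftLinear W where
  μₗ X d := (c X d).inv
  δₗ X d := (c X d).hom
  δₗ_naturality_left := nat_left
  δₗ_naturality_right := nat_right
  δₗ_associativity := assoc
  δₗ_unitality_inv d := by
    rw [← cancel_mono (λₗ (F.obj d)).hom, Category.assoc, unit]
    simp [← Functor.map_comp]
  μₗ_naturality_left f d := by
    rw [← cancel_mono (c _ d).hom, ← cancel_epi (c _ d).hom]
    simp [nat_left]
  μₗ_naturality_right X d d' f := by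
    rw [← cancel_mono (c _ _).hom, ← cancel_epi (c _ _).hom]
    simp [nat_right]
  μₗ_associativity X Y d := by
    rw [← cancel_epi (c _ _).hom, Iso.hom_inv_id_assoc, reassoc_of% assoc]
    simp
  μₗ_unitality d := by
    rw [← cancel_epi (c _ _).hom, Iso.hom_inv_id_assoc, unit]
  μₗ_comp_δₗ := by simp
  δₗ_comp_μₗ := by simp

instance leftLinearId : (𝟭 M).LeftLinear W :=
  leftLinearOfIso (𝟭 M) (fun _ _ => Iso.refl _)
    (by simp) (by simp) (by simp) (by simp)

instance leftLinearComp (F G : M ⥤ M) [F.LeftLinear W] [G.LeftLinear W] :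
    (F ⋙ G).LeftLinear W :=
  leftLinearOfIso (F ⋙ G)
    (fun X d => G.mapIso (Functor.LeftLinear.μₗIso F X d).symm ≪≫
      (Functor.LeftLinear.μₗIso G X (F.obj d)).symm)
    (fun f d => by
      simp [← Functor.map_comp_assoc])
    (fun X d d' f => by
      simp [← Functor.map_comp_assoc])
    (fun X Y d => by
      have h1 := δₗ_associativity G X Y (F.obj d)
      have h2 := G.congr_map (δₗ_associativity F X Y d)
      have h3 := δₗ_naturality_right G X (δₗ F Y d)
      simp only [Functor.map_comp] at h2
      simp only [Functor.comp_obj, Functor.comp_map, Iso.trans_hom, Functor.mapIso_hom,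
        Iso.symm_hom, Category.assoc]
      rw [h1, reassoc_of% h2, MonoidalLeftAction.actionHomRight_comp, reassoc_of% h3])
    (fun d => by
      have h1 := δₗ_unitality_hom (C := W) G (F.obj d)
      have h2 := G.congr_map (δₗ_unitality_hom (C := W) F d)
      simp only [Functor.map_comp] at h2
      simp only [Functor.comp_obj, Functor.comp_map, Iso.trans_hom, Functor.mapIso_hom,
        Iso.symm_hom, Category.assoc]
      rw [h1, h2])

@[simp]
lemma δₗ_id (X : W) (d : M) : δₗ (𝟭 M) X d = 𝟙 (X ⊙ₗ d) := rfl

@[simp]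
lemma δₗ_comp (F G : M ⥤ M) [F.LeftLinear W] [G.LeftLinear W] (X : W) (d : M) :
    δₗ (F ⋙ G) X d = G.map (δₗ F X d) ≫ δₗ G X (F.obj d) := rfl

variable (W M)

/-- The `W`-module endofunctors of a `W`-module category `M`. -/
structure ModEnd where
  functor : M ⥤ M
  [linear : functor.LeftLinear W]

attribute [instance] ModEnd.linear

variable {W M}

namespace ModEnd

/-- Natural module transformations. -/
@[ext]
structure Hom (F G : ModEnd W M) where
  nat : F.functor ⟶ G.functor
  comm : ∀ (X : W) (d : M),
    nat.app (X ⊙ₗ d) ≫ δₗ G.functor X d = δₗ F.functor X d ≫ X ⊴ₗ nat.app d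

lemma Hom.comm_assoc {F G : ModEnd W M} (f : Hom F G) (X : W) (d : M) {e : M}
    (h : X ⊙ₗ G.functor.obj d ⟶ e) :
    f.nat.app (X ⊙ₗ d) ≫ δₗ G.functor X d ≫ h =
      δₗ F.functor X d ≫ X ⊴ₗ f.nat.app d ≫ h := by
  rw [← Category.assoc, f.comm, Category.assoc]

instance : Category (ModEnd W M) where
  Hom F G := Hom F G
  id F := ⟨𝟙 _, by simp⟩
  comp f g := ⟨f.nat ≫ g.nat, fun X d => by
    simp [g.comm, f.comm_assoc]⟩

@[ext]
lemma hom_ext {F G : ModEnd W M} (f g : F ⟶ G) (h : ∀ d, f.nat.app d = g.nat.app d) : f = g :=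
  Hom.ext (NatTrans.ext (funext h))

@[simp] lemma id_nat (F : ModEnd W M) : Hom.nat (𝟙 F) = 𝟙 F.functor := rfl
@[simp] lemma comp_nat {F G K : ModEnd W M} (f : F ⟶ G) (g : G ⟶ K) :
    (f ≫ g).nat = f.nat ≫ g.nat := rfl

/-- A module transformation with invertible components is an isomorphism. -/
@[simps]
def isoMk {F G : ModEnd W M} (e : F.functor ≅ G.functor)
    (comm : ∀ (X : W) (d : M),
      e.hom.app (X ⊙ₗ d) ≫ δₗ G.functor X d = δₗ F.functor X d ≫ X ⊴ₗ e.hom.app d) : F ≅ G where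
  hom := ⟨e.hom, comm⟩
  inv := ⟨e.inv, fun X d => by
    rw [← cancel_epi (e.hom.app _), e.hom_inv_id_app_assoc, reassoc_of% comm,
      ← MonoidalLeftAction.actionHomRight_comp, e.hom_inv_id_app]
    simp⟩
  hom_inv_id := by ext; simp
  inv_hom_id := by ext; simp

/-- Composition `F ∘ G` of module endofunctors. -/
abbrev comp (F G : ModEnd W M) : ModEnd W M := ⟨G.functor ⋙ F.functor⟩

/-- Left whiskering of a module transformation. -/
def whiskerL (F : ModEnd W M) {G₁ G₂ : ModEnd W M} (f : G₁ ⟶ G₂) : comp F G₁ ⟶ comp F G₂ :=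
  ⟨Functor.whiskerRight f.nat F.functor, fun X d => by
    have h := F.functor.congr_map (f.comm X d)
    simp only [Functor.map_comp] at h
    simp [reassoc_of% h]⟩

/-- Right whiskering of a module transformation. -/
def whiskerR {F₁ F₂ : ModEnd W M} (f : F₁ ⟶ F₂) (G : ModEnd W M) : comp F₁ G ⟶ comp F₂ G :=
  ⟨Functor.whiskerLeft G.functor f.nat, fun X d => by
    have h := f.comm X (G.functor.obj d)
    simp [← h]⟩

/-- The tensor product of module endofunctors is their composition, `F ⊗ G = F ∘ G`. -/
instance : MonoidalCategoryStruct (ModEnd W M) where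
  tensorObj F G := comp F G
  tensorUnit := ⟨𝟭 M⟩
  whiskerLeft F _ _ f := whiskerL F f
  whiskerRight f G := whiskerR f G
  tensorHom {F₁ F₂ G₁ G₂} f g := whiskerR f G₁ ≫ whiskerL F₂ g
  associator F G K := isoMk (Functor.associator _ _ _).symm (fun X d => by simp)
  leftUnitor F := isoMk (Functor.rightUnitor _) (fun X d => by simp)
  rightUnitor F := isoMk (Functor.leftUnitor _) (fun X d => by simp)

lemma tensorObj_functor (F G : ModEnd W M) : (F ⊗ G).functor = G.functor ⋙ F.functor := rfl

@[simp] lemma tensorObj_obj (F G : ModEnd W M) (d : M) :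
    (F ⊗ G).functor.obj d = F.functor.obj (G.functor.obj d) := rfl

@[simp] lemma tensorObj_map (F G : ModEnd W M) {d d' : M} (f : d ⟶ d') :
    (F ⊗ G).functor.map f = F.functor.map (G.functor.map f) := rfl

@[simp] lemma tensorUnit_obj (d : M) : (𝟙_ (ModEnd W M)).functor.obj d = d := rfl

@[simp] lemma tensorUnit_map {d d' : M} (f : d ⟶ d') :
    (𝟙_ (ModEnd W M)).functor.map f = f := rfl

@[simp] lemma whiskerLeft_app (F : ModEnd W M) {G₁ G₂ : ModEnd W M} (f : G₁ ⟶ G₂) (d : M) :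
    (F ◁ f).nat.app d = F.functor.map (f.nat.app d) := rfl

@[simp] lemma whiskerRight_app {F₁ F₂ : ModEnd W M} (f : F₁ ⟶ F₂) (G : ModEnd W M) (d : M) :
    (f ▷ G).nat.app d = f.nat.app (G.functor.obj d) := rfl

@[simp] lemma tensorHom_app {F₁ F₂ G₁ G₂ : ModEnd W M} (f : F₁ ⟶ F₂) (g : G₁ ⟶ G₂) (d : M) :
    (f ⊗ₘ g).nat.app d =
      f.nat.app (G₁.functor.obj d) ≫ F₂.functor.map (g.nat.app d) := rfl

@[simp] lemma associator_hom_app (F G K : ModEnd W M) (d : M) :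
    (α_ F G K).hom.nat.app d = 𝟙 (F.functor.obj (G.functor.obj (K.functor.obj d))) := rfl

@[simp] lemma associator_inv_app (F G K : ModEnd W M) (d : M) :
    (α_ F G K).inv.nat.app d = 𝟙 (F.functor.obj (G.functor.obj (K.functor.obj d))) := rfl

@[simp] lemma leftUnitor_hom_app (F : ModEnd W M) (d : M) :
    (λ_ F).hom.nat.app d = 𝟙 (F.functor.obj d) := rfl

@[simp] lemma leftUnitor_inv_app (F : ModEnd W M) (d : M) :
    (λ_ F).inv.nat.app d = 𝟙 (F.functor.obj d) := rfl

@[simp] lemma rightUnitor_hom_app (F : ModEnd W M) (d : M) :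
    (ρ_ F).hom.nat.app d = 𝟙 (F.functor.obj d) := rfl

@[simp] lemma rightUnitor_inv_app (F : ModEnd W M) (d : M) :
    (ρ_ F).inv.nat.app d = 𝟙 (F.functor.obj d) := rfl

instance : MonoidalCategory (ModEnd W M) where
  tensorHom_def _ _ := rfl

@[simp] lemma δₗ_tensorUnit (X : W) (d : M) :
    δₗ (𝟙_ (ModEnd W M)).functor X d = 𝟙 (X ⊙ₗ d) := rfl

@[simp] lemma δₗ_tensorObj (F G : ModEnd W M) (X : W) (d : M) :
    δₗ (F ⊗ G).functor X d =
      F.functor.map (δₗ G.functor X d) ≫ δₗ F.functor X (G.functor.obj d) := rfl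

end ModEnd
end ModuleEndofunctors

section Restriction

variable {W : Type u₁} [Category.{v₁} W] [MonoidalCategory W]
  {C : Type u₂} [Category.{v₂} C] [MonoidalCategory C]
  {M : Type u₃} [Category.{v₃} M] [MonoidalLeftAction C M]

open Functor.LaxMonoidal Functor.OplaxMonoidal Functor.Monoidal MonoidalLeftAction

/-- Restriction of an action along a strong monoidal functor `T`: `X ▸ d = T X ⊙ₗ d`. -/
@[reducible]
def restrictAction (T : W ⥤ C) [T.Monoidal] : MonoidalLeftAction W M where
  actionObj X d := T.obj X ⊙ₗ d
  actionHomLeft f d := T.map f ⊵ₗ d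
  actionHomRight X _ _ f := T.obj X ⊴ₗ f
  actionHom f g := T.map f ⊙ₗₘ g
  actionAssocIso X Y d :=
    { hom := δ T X Y ⊵ₗ d ≫ (αₗ (T.obj X) (T.obj Y) d).hom
      inv := (αₗ (T.obj X) (T.obj Y) d).inv ≫ μ T X Y ⊵ₗ d
      hom_inv_id := by simp [← comp_actionHomLeft]
      inv_hom_id := by simp [← comp_actionHomLeft_assoc] }
  actionUnitIso d :=
    { hom := η T ⊵ₗ d ≫ (λₗ d).hom
      inv := (λₗ d).inv ≫ ε T ⊵ₗ d
      hom_inv_id := by simp [← comp_actionHomLeft]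
      inv_hom_id := by simp [← comp_actionHomLeft_assoc] }
  actionHom_def f g := by simp [actionHom_def]
  actionHom_comp := by simp
  actionAssocIso_hom_naturality {X₁ X₂ X₃ X₄ d₁ d₂} f g h := by
    have h1 := congrArg (· ⊵ₗ d₂) (δ_natural T f g)
    simp only [comp_actionHomLeft] at h1
    rw [actionHom_def', Category.assoc, ← reassoc_of% h1]
    have h2 := actionAssocIso_hom_naturality (T.map f) (T.map g) (𝟙 d₂)
    have h3 := actionAssocIso_hom_naturality (𝟙 (T.obj X₁)) (𝟙 (T.obj X₃)) h
    rw [actionHom_id] at h2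
    rw [h2, action_exchange_assoc]
    simp only [Category.assoc, tensor_actionHomRight, Iso.inv_hom_id_assoc, actionHom_def,
      actionHomRight_comp, actionHomRight_id, Category.comp_id]
    simp only [← actionHomRight_comp, ← action_exchange]
    simp only [actionHomRight_comp, Category.assoc]
  actionUnitIso_hom_naturality f := by
    have h := actionUnitIso_hom_naturality (C := C) f
    rw [Category.assoc, h, action_exchange_assoc]
  whiskerLeft_actionHomLeft X Y Y' f d := by
    have h := congrArg (· ⊵ₗ d) (δ_natural_right T X f)
    simp only [comp_actionHomLeft, whiskerLeft_actionHomLeft] at h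
    simp only [Category.assoc]
    rw [reassoc_of% h, ← comp_actionHomLeft]
    simp
  whiskerRight_actionHomLeft Y f d := by
    have h := congrArg (· ⊵ₗ d) (δ_natural_left T f Y)
    simp only [comp_actionHomLeft, whiskerRight_actionHomLeft] at h
    simp only [Category.assoc]
    rw [reassoc_of% h, ← comp_actionHomLeft]
    simp
  associator_actionHom X Y Z d := by
    have h := congrArg (· ⊵ₗ d) (oplax_associativity T X Y Z)
    simp only [comp_actionHomLeft] at h
    have h2 := h =≫ ((αₗ (T.obj X) (T.obj Y ⊗ T.obj Z) d).hom ≫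
      T.obj X ⊴ₗ (αₗ (T.obj Y) (T.obj Z) d).hom)
    simp only [Category.assoc, associator_actionHom, whiskerRight_actionHomLeft,
      whiskerLeft_actionHomLeft, Iso.inv_hom_id_assoc] at h2
    simp only [Category.assoc, actionHomRight_comp]
    rw [← h2]
  leftUnitor_actionHom X d := by
    have h := congrArg (· ⊵ₗ d) (left_unitality_hom T X)
    simp only [comp_actionHomLeft, whiskerRight_actionHomLeft, leftUnitor_actionHom,
      Category.assoc, Iso.inv_hom_id_assoc] at h
    rw [← h]
    simp only [Category.assoc]
  rightUnitor_actionHom X d := by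
    have h := congrArg (· ⊵ₗ d) (right_unitality_hom T X)
    simp only [comp_actionHomLeft, whiskerLeft_actionHomLeft, rightUnitor_actionHom,
      Category.assoc, Iso.inv_hom_id_assoc] at h
    rw [← h]
    simp only [Category.assoc, actionHomRight_comp]

end Restriction

section ActionFunctor

variable {V : Type u₁} [Category.{v₁} V] [MonoidalCategory V]
  {C : Type u₂} [Category.{v₂} C] [MonoidalCategory C]
  {M : Type u₃} [Category.{v₃} M] [MonoidalLeftAction C M]

open Functor.LaxMonoidal Functor.OplaxMonoidal Functor.Monoidal MonoidalLeftAction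

section Swap

lemma associator_hom_act (X Y Z : C) (d : M) : (α_ X Y Z).hom ⊵ₗ d =
    (αₗ (X ⊗ Y) Z d).hom ≫ (αₗ X Y (Z ⊙ₗ d)).hom ≫ X ⊴ₗ (αₗ Y Z d).inv ≫
      (αₗ X (Y ⊗ Z) d).inv := by
  rw [← reassoc_of% associator_actionHom X Y Z d]
  simp

lemma associator_inv_act (X Y Z : C) (d : M) : (α_ X Y Z).inv ⊵ₗ d =
    (αₗ X (Y ⊗ Z) d).hom ≫ X ⊴ₗ (αₗ Y Z d).hom ≫ (αₗ X Y (Z ⊙ₗ d)).inv ≫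
      (αₗ (X ⊗ Y) Z d).inv := by
  rw [← cancel_epi ((α_ X Y Z).hom ⊵ₗ d), hom_inv_actionHomLeft, associator_hom_act]
  simp

/-- For a half-braiding `A ⊗ X ≅ X ⊗ A` on `A`, the isomorphism `X ▷ (A ▷ d) ≅ A ▷ (X ▷ d)`
induced by its inverse. -/
def swapIso {A : C} (b : HalfBraiding A) (X : C) (d : M) :
    X ⊙ₗ (A ⊙ₗ d) ≅ A ⊙ₗ (X ⊙ₗ d) where
  hom := (αₗ X A d).inv ≫ (b.β X).inv ⊵ₗ d ≫ (αₗ A X d).hom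
  inv := (αₗ A X d).inv ≫ (b.β X).hom ⊵ₗ d ≫ (αₗ X A d).hom

lemma swapIso_hom {A : C} (b : HalfBraiding A) (X : C) (d : M) : (swapIso b X d).hom =
    (αₗ X A d).inv ≫ (b.β X).inv ⊵ₗ d ≫ (αₗ A X d).hom := rfl

lemma swapIso_nat_left {A A' : C} {b : HalfBraiding A} {b' : HalfBraiding A'} (f : A ⟶ A')
    (X : C) (hf : f ▷ X ≫ (b'.β X).hom = (b.β X).hom ≫ X ◁ f) (d : M) :
    X ⊴ₗ (f ⊵ₗ d) ≫ (swapIso b' X d).hom = (swapIso b X d).hom ≫ f ⊵ₗ (X ⊙ₗ d) := by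
  have h : X ◁ f ≫ (b'.β X).inv = (b.β X).inv ≫ f ▷ X := by
    rw [Iso.comp_inv_eq, Category.assoc, hf, Iso.inv_hom_id_assoc]
  have h' := congrArg (· ⊵ₗ d) h
  simp only [comp_actionHomLeft, whiskerLeft_actionHomLeft, Category.assoc] at h'
  simp only [swapIso_hom, actionHomLeft_action, Category.assoc, Iso.hom_inv_id_assoc]
  rw [← reassoc_of% h', Iso.inv_hom_id_assoc]

lemma swapIso_nat_mid {A : C} (b : HalfBraiding A) {X X' : C} (f : X ⟶ X') (d : M) :
    f ⊵ₗ (A ⊙ₗ d) ≫ (swapIso b X' d).hom = (swapIso b X d).hom ≫ A ⊴ₗ (f ⊵ₗ d) := by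
  have h : f ▷ A ≫ (b.β X').inv = (b.β X).inv ≫ A ◁ f := by
    rw [Iso.comp_inv_eq, Category.assoc, b.naturality, Iso.inv_hom_id_assoc]
  have h' := congrArg (· ⊵ₗ d) h
  simp only [comp_actionHomLeft, whiskerLeft_actionHomLeft] at h'
  simp only [swapIso_hom, actionHomLeft_action, Category.assoc, Iso.hom_inv_id_assoc]
  rw [reassoc_of% h', Iso.inv_hom_id, Category.comp_id]

lemma swapIso_nat_right {A : C} (b : HalfBraiding A) (X : C) {d d' : M} (f : d ⟶ d') :
    X ⊴ₗ (A ⊴ₗ f) ≫ (swapIso b X d').hom = (swapIso b X d).hom ≫ A ⊴ₗ (X ⊴ₗ f) := by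
  have h := action_exchange (b.β X).inv f
  simp only [tensor_actionHomRight, Category.assoc] at h
  have h' := (αₗ X A d).inv ≫= h =≫ (αₗ A X d').hom
  simpa [swapIso_hom] using h'

lemma swapIso_tensor_left {A A' : C} (b : HalfBraiding A) (b' : HalfBraiding A')
    (b'' : HalfBraiding (A ⊗ A')) (X : C)
    (h : (b''.β X).hom = (α_ _ _ _).hom ≫ A ◁ (b'.β X).hom ≫ (α_ _ _ _).inv ≫
      (b.β X).hom ▷ A' ≫ (α_ _ _ _).hom) (d : M) :
    (swapIso b'' X d).hom ≫ (αₗ A A' (X ⊙ₗ d)).hom =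
      X ⊴ₗ (αₗ A A' d).hom ≫ (swapIso b X (A' ⊙ₗ d)).hom ≫ A ⊴ₗ (swapIso b' X d).hom := by
  have h' : (b''.β X).inv = (α_ _ _ _).inv ≫ (b.β X).inv ▷ A' ≫ (α_ _ _ _).hom ≫
      A ◁ (b'.β X).inv ≫ (α_ _ _ _).inv := by
    rw [← cancel_epi (b''.β X).hom, Iso.hom_inv_id, h]
    simp
  rw [swapIso_hom, h']
  simp only [swapIso_hom, comp_actionHomLeft, whiskerLeft_actionHomLeft,
    whiskerRight_actionHomLeft, associator_hom_act, associator_inv_act, Category.assoc,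
    actionHomRight_comp, Iso.inv_hom_id_assoc, Iso.inv_hom_id, Category.comp_id]

lemma swapIso_unit_left (b : HalfBraiding (𝟙_ C)) (X : C)
    (h : (b.β X).hom = (λ_ X).hom ≫ (ρ_ X).inv) (d : M) :
    (swapIso b X d).hom ≫ (λₗ (X ⊙ₗ d)).hom = X ⊴ₗ (λₗ d).hom := by
  have h' : (b.β X).inv = (ρ_ X).hom ≫ (λ_ X).inv := by
    rw [← cancel_epi (b.β X).hom, Iso.hom_inv_id, h]
    simp
  have h2 := leftUnitor_actionHom X d
  have h3 := rightUnitor_actionHom X d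
  rw [swapIso_hom, h', Category.assoc, Category.assoc, ← h2, comp_actionHomLeft, Category.assoc,
    ← comp_actionHomLeft, Iso.inv_hom_id, id_actionHomLeft, Category.comp_id, h3,
    Iso.inv_hom_id_assoc]

lemma swapIso_tensor_mid {A : C} (b : HalfBraiding A) (X X' : C) (d : M) :
    (swapIso b (X ⊗ X') d).hom ≫ A ⊴ₗ (αₗ X X' d).hom =
      (αₗ X X' (A ⊙ₗ d)).hom ≫ X ⊴ₗ (swapIso b X' d).hom ≫ (swapIso b X (X' ⊙ₗ d)).hom := by
  have h : (b.β (X ⊗ X')).inv = (α_ _ _ _).hom ≫ X ◁ (b.β X').inv ≫ (α_ _ _ _).inv ≫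
      (b.β X).inv ▷ X' ≫ (α_ _ _ _).hom := by
    rw [← cancel_epi (b.β (X ⊗ X')).hom, Iso.hom_inv_id, b.monoidal]
    simp
  rw [swapIso_hom, h]
  simp only [swapIso_hom, comp_actionHomLeft, whiskerLeft_actionHomLeft,
    whiskerRight_actionHomLeft, associator_hom_act, associator_inv_act, Category.assoc,
    actionHomRight_comp, Iso.inv_hom_id_assoc, Iso.inv_hom_id, Category.comp_id,
    actionHomRight_inv_hom]

lemma swapIso_unit_mid {A : C} (b : HalfBraiding A) (d : M) :
    (swapIso b (𝟙_ C) d).hom ≫ A ⊴ₗ (λₗ d).hom = (λₗ (A ⊙ₗ d)).hom := by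
  have h : (b.β (𝟙_ C)).inv = (λ_ A).hom ≫ (ρ_ A).inv := by
    have h0 : (b.β (𝟙_ C)).hom ≫ (λ_ A).hom = (ρ_ A).hom := by
      have h1 := b.naturality (λ_ (𝟙_ C)).hom
      have h2 : 𝟙_ C ◁ (b.β (𝟙_ C)).hom ≫ (α_ _ _ _).inv ≫ (λ_ (𝟙_ C)).hom ▷ A =
          (λ_ (A ⊗ 𝟙_ C)).hom ≫ (b.β (𝟙_ C)).hom := by
        rw [← leftUnitor_naturality, leftUnitor_tensor_hom]
      rw [b.monoidal, Category.assoc, Category.assoc, Category.assoc, Category.assoc, h2,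
        leftUnitor_tensor_hom, Category.assoc, Iso.hom_inv_id_assoc, ← Category.assoc,
        ← Category.assoc, cancel_mono, Category.assoc, ← comp_whiskerRight, Iso.eq_inv_comp,
        triangle] at h1
      exact ((whiskerRight_iff _ _).1 h1).symm
    rw [← cancel_epi (b.β (𝟙_ C)).hom, Iso.hom_inv_id, reassoc_of% h0, Iso.hom_inv_id]
  have h2 := leftUnitor_actionHom A d
  have h3 := rightUnitor_actionHom A d
  rw [swapIso_hom, h, Category.assoc, Category.assoc, ← h3, comp_actionHomLeft, Category.assoc,
    ← comp_actionHomLeft, Iso.inv_hom_id, id_actionHomLeft, Category.comp_id, h2,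
    Iso.inv_hom_id_assoc]

lemma swapIso_tensor_left' {A₀ A A' : C} (b₀ : HalfBraiding A₀) (b : HalfBraiding A)
    (b' : HalfBraiding A') (b'' : HalfBraiding (A ⊗ A')) (X : C)
    (h : (b''.β X).hom = (α_ _ _ _).hom ≫ A ◁ (b'.β X).hom ≫ (α_ _ _ _).inv ≫
      (b.β X).hom ▷ A' ≫ (α_ _ _ _).hom) (f : A₀ ⟶ A ⊗ A')
    (hf : f ▷ X ≫ (b''.β X).hom = (b₀.β X).hom ≫ X ◁ f) (d : M) :
    (swapIso b₀ X d).hom ≫ f ⊵ₗ (X ⊙ₗ d) ≫ (αₗ A A' (X ⊙ₗ d)).hom =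
      X ⊴ₗ (f ⊵ₗ d ≫ (αₗ A A' d).hom) ≫ (swapIso b X (A' ⊙ₗ d)).hom ≫
        A ⊴ₗ (swapIso b' X d).hom := by
  rw [← Category.assoc, ← swapIso_nat_left f X hf d, Category.assoc,
    swapIso_tensor_left b b' b'' X h d, actionHomRight_comp, Category.assoc]

lemma swapIso_unit_left' {A₀ : C} (b₀ : HalfBraiding A₀) (b : HalfBraiding (𝟙_ C)) (X : C)
    (h : (b.β X).hom = (λ_ X).hom ≫ (ρ_ X).inv) (f : A₀ ⟶ 𝟙_ C)
    (hf : f ▷ X ≫ (b.β X).hom = (b₀.β X).hom ≫ X ◁ f) (d : M) :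
    (swapIso b₀ X d).hom ≫ f ⊵ₗ (X ⊙ₗ d) ≫ (λₗ (X ⊙ₗ d)).hom =
      X ⊴ₗ (f ⊵ₗ d ≫ (λₗ d).hom) := by
  rw [← Category.assoc, ← swapIso_nat_left f X hf d, Category.assoc,
    swapIso_unit_left b X h d, actionHomRight_comp]

lemma swapIso_tensor_mid_inv {A : C} (b : HalfBraiding A) (X X' : C) (d : M) :
    (αₗ X X' (A ⊙ₗ d)).inv ≫ (swapIso b (X ⊗ X') d).hom =
      (X ⊴ₗ (swapIso b X' d).hom ≫ (swapIso b X (X' ⊙ₗ d)).hom) ≫ A ⊴ₗ (αₗ X X' d).inv := by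
  rw [Iso.inv_comp_eq, Category.assoc, ← reassoc_of% swapIso_tensor_mid b X X' d,
    actionHomRight_hom_inv, Category.comp_id]

lemma swapIso_unit_mid_inv {A : C} (b : HalfBraiding A) (d : M) :
    (λₗ (A ⊙ₗ d)).inv ≫ (swapIso b (𝟙_ C) d).hom = 𝟙 _ ≫ A ⊴ₗ (λₗ d).inv := by
  rw [Iso.inv_comp_eq, ← swapIso_unit_mid b d, Category.id_comp, Category.assoc,
    actionHomRight_hom_inv, Category.comp_id]

end Swap

/-- The category `V`, regarded as acting through `G : V ⥤ Center C`. -/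
def Via (_ : V ⥤ Center C) : Type u₁ := V

variable (G : V ⥤ Center C)

instance : Category.{v₁} (Via G) := inferInstanceAs (Category.{v₁} V)
instance : MonoidalCategory (Via G) := inferInstanceAs (MonoidalCategory V)
instance [RightRigidCategory V] : RightRigidCategory (Via G) :=
  inferInstanceAs (RightRigidCategory V)

/-- The functor `G`, with its source regarded as `Via G`. -/
def Via.functor : Via G ⥤ Center C := G

variable [G.Monoidal]

instance : (Via.functor G).Monoidal := inferInstanceAs G.Monoidal

/-- The action `X ▸ d = G X ▷ d` of `V` on a `C`-module category. -/
instance viaAction : MonoidalLeftAction (Via G) M :=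
  restrictAction (Via.functor G ⋙ Center.forget C)

lemma via_assoc_hom (Y Y' : Via G) (d : M) : (αₗ Y Y' d).hom =
    (δ (Via.functor G) Y Y').f ⊵ₗ d ≫
      (αₗ ((Via.functor G).obj Y).1 ((Via.functor G).obj Y').1 d).hom := by
  have h : δ (Via.functor G ⋙ Center.forget C) Y Y' = (δ (Via.functor G) Y Y').f :=
    Category.comp_id _
  exact congrArg (· ⊵ₗ d ≫ (αₗ ((Via.functor G).obj Y).1 ((Via.functor G).obj Y').1 d).hom) h

lemma via_unit_hom (d : M) : (λₗ[Via G] d).hom =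
    (η (Via.functor G)).f ⊵ₗ d ≫ (λₗ[C] d).hom := by
  have h : η (Via.functor G ⋙ Center.forget C) = (η (Via.functor G)).f :=
    Category.comp_id _
  exact congrArg (· ⊵ₗ d ≫ (λₗ[C] d).hom) h

/-- The `V`-module functor `ρ(X) = X ▷ -`. -/
def rhoObj (X : C) : ModEnd (Via G) M where
  functor := actionLeft M X
  linear := leftLinearOfIso _ (fun Y d => swapIso ((Via.functor G).obj Y).2 X d)
    (fun f d => swapIso_nat_left ((Via.functor G).map f).f X
      (((Via.functor G).map f).comm X) d)
    (fun Y d d' f => swapIso_nat_right _ X f)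
    (fun Y Y' d =>
      (congrArg (_ ≫ ·) (via_assoc_hom G Y Y' (X ⊙ₗ d))).trans
        ((swapIso_tensor_left' ((Via.functor G).obj (Y ⊗ Y')).2 ((Via.functor G).obj Y).2
          ((Via.functor G).obj Y').2 ((Via.functor G).obj Y ⊗ (Via.functor G).obj Y').2 X
          (by simp) (δ (Via.functor G) Y Y').f ((δ (Via.functor G) Y Y').comm X) d).trans
          (congrArg (fun t => X ⊴ₗ t ≫ _) (via_assoc_hom G Y Y' d)).symm))
    (fun d =>
      (congrArg (_ ≫ ·) (via_unit_hom G (X ⊙ₗ d))).trans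
        ((swapIso_unit_left' ((Via.functor G).obj (𝟙_ _)).2 (𝟙_ (Center C)).2 X rfl
          (η (Via.functor G)).f ((η (Via.functor G)).comm X) d).trans
          (congrArg (fun t => X ⊴ₗ t) (via_unit_hom G d)).symm))

variable (M) in
/-- The action functor `ρ : C ⥤ End_V(M)`. -/
def rho : C ⥤ ModEnd (Via G) M where
  obj X := rhoObj G X
  map f := ⟨(curriedAction C M).map f, fun Y d => swapIso_nat_mid _ f d⟩
  map_id X := by ext; simp [rhoObj]
  map_comp f g := by ext; simp [rhoObj]

@[simp] lemma rho_obj_obj (X : C) (d : M) : ((rho M G).obj X).functor.obj d = X ⊙ₗ d := rfl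
@[simp] lemma rho_obj_map (X : C) {d d' : M} (f : d ⟶ d') :
    ((rho M G).obj X).functor.map f = X ⊴ₗ f := rfl
@[simp] lemma rho_map_app {X X' : C} (f : X ⟶ X') (d : M) :
    ((rho M G).map f).nat.app d = f ⊵ₗ d := rfl

lemma δₗ_rho (X : C) (Y : Via G) (d : M) :
    Functor.OplaxLeftLinear.δₗ ((rho M G).obj X).functor Y d =
      (swapIso ((Via.functor G).obj Y).2 X d).hom := rfl

/-- The isomorphism `Id ≅ ρ(𝟙)`. -/
def rhoεIso : 𝟙_ (ModEnd (Via G) M) ≅ (rho M G).obj (𝟙_ C) :=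
  ModEnd.isoMk (actionUnitNatIso C M).symm
    (fun Y d => swapIso_unit_mid_inv ((Via.functor G).obj Y).2 d)

/-- The isomorphism `ρ(X) ∘ ρ(Y) ≅ ρ(X ⊗ Y)`. -/
def rhoμIso (X Y : C) :
    (rho M G).obj X ⊗ (rho M G).obj Y ≅ (rho M G).obj (X ⊗ Y) :=
  ModEnd.isoMk (NatIso.ofComponents (fun d => (αₗ X Y d).symm) (by intros; simp))
    (fun Z d => swapIso_tensor_mid_inv ((Via.functor G).obj Z).2 X Y d)

@[simp] lemma rhoεIso_hom_app (d : M) : (rhoεIso G).hom.nat.app d = (λₗ[C] d).inv := rfl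

@[simp] lemma rhoμIso_hom_app (X Y : C) (d : M) :
    (rhoμIso G X Y).hom.nat.app d = (αₗ X Y d).inv := rfl

/-- `ρ` is a strong monoidal functor. -/
instance : (rho M G).Monoidal :=
  Functor.CoreMonoidal.toMonoidal
    { εIso := rhoεIso G
      μIso := rhoμIso G
      μIso_hom_natural_left f X' := by
        ext d
        simp
      μIso_hom_natural_right X' f := by
        ext d
        simp
      associativity X Y Z := by
        ext d
        simp [associator_hom_act]
      left_unitality X := by
        ext d
        simp
      right_unitality X := by
        ext d
        simp }

end ActionFunctor

section RelativeEnd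

variable {W : Type u₁} [Category.{v₁} W] [MonoidalCategory W] [RightRigidCategory W]
  {M : Type u₂} [Category.{v₂} M] [MonoidalLeftAction W M]

open Functor.OplaxLeftLinear MonoidalLeftAction

/-- `ev_V ▷ id : (V* ⊗ V) ▷ d ⟶ d`, for the dual `V*` with evaluation `V* ⊗ V ⟶ 𝟙`. -/
def evAct (V : W) (d : M) : (Vᘁ ⊗ V) ⊙ₗ d ⟶ d := ε_ V Vᘁ ⊵ₗ d ≫ (λₗ d).hom

/-- `coev_V ▷ id : d ⟶ (V ⊗ V*) ▷ d`. -/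
def coevAct (V : W) (d : M) : d ⟶ (V ⊗ Vᘁ) ⊙ₗ d := (λₗ d).inv ≫ η_ V Vᘁ ⊵ₗ d

lemma evAct_naturality (V : W) {d d' : M} (f : d ⟶ d') :
    (Vᘁ ⊗ V) ⊴ₗ f ≫ evAct V d' = evAct V d ≫ f := by
  rw [evAct, evAct, action_exchange_assoc, Category.assoc, ← actionUnitIso_hom_naturality]

lemma coevAct_naturality (V : W) {d d' : M} (f : d ⟶ d') :
    coevAct V d ≫ (V ⊗ Vᘁ) ⊴ₗ f = f ≫ coevAct V d' := by
  rw [coevAct, coevAct, Category.assoc, ← action_exchange, ← Category.assoc,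
    actionUnitIso_inv_naturality, Category.assoc]

lemma zigzagAct (V : W) (d : M) :
    coevAct V (V ⊙ₗ d) ≫ (αₗ V Vᘁ (V ⊙ₗ d)).hom ≫ V ⊴ₗ ((αₗ Vᘁ V d).inv ≫ evAct V d) =
      𝟙 (V ⊙ₗ d) := by
  have h := congrArg (· ⊵ₗ d) (ExactPairing.evaluation_coevaluation V Vᘁ)
  have h' := (λ_ V).inv ⊵ₗ d ≫= h =≫ (ρ_ V).hom ⊵ₗ d
  simp only [← comp_actionHomLeft, Category.assoc, Iso.inv_hom_id, Category.comp_id,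
    id_actionHomLeft] at h'
  rw [← h']
  have h1 : (λ_ V).inv ⊵ₗ d = (λₗ (V ⊙ₗ d)).inv ≫ (αₗ (𝟙_ W) V d).inv := by
    rw [← cancel_epi ((λ_ V).hom ⊵ₗ d), hom_inv_actionHomLeft, leftUnitor_actionHom]
    simp
  simp only [comp_actionHomLeft, whiskerLeft_actionHomLeft, whiskerRight_actionHomLeft,
    associator_hom_act, rightUnitor_actionHom, h1, evAct, coevAct, Category.assoc,
    Iso.inv_hom_id_assoc, actionHomRight_comp]

/-- Morphisms into `V ▷ d` are determined by their transposes. -/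
lemma act_hom_ext (V : W) {e d : M} (f g : e ⟶ V ⊙ₗ d)
    (h : Vᘁ ⊴ₗ f ≫ (αₗ Vᘁ V d).inv ≫ evAct V d = Vᘁ ⊴ₗ g ≫ (αₗ Vᘁ V d).inv ≫ evAct V d) :
    f = g := by
  have key : ∀ f : e ⟶ V ⊙ₗ d, coevAct V e ≫ (αₗ V Vᘁ e).hom ≫
      V ⊴ₗ (Vᘁ ⊴ₗ f ≫ (αₗ Vᘁ V d).inv ≫ evAct V d) = f := by
    intro f
    have h1 := coevAct_naturality V f
    simp only [tensor_actionHomRight] at h1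
    have h2 := zigzagAct V d
    have h3 := f ≫= h2
    rw [Category.comp_id, ← Category.assoc, ← h1] at h3
    rw [actionHomRight_comp]
    simpa only [Category.assoc, Iso.inv_hom_id_assoc] using h3
  rw [← key f, ← key g, h]

/-- The prebalancing `Hom(P d, F (V ▷ e)) → Hom(P (V* ▷ d), F e)` attached to two module
functors. -/
def gammaMap (P F : ModEnd W M) (V : W) (d e : M) (f : P.functor.obj d ⟶ F.functor.obj (V ⊙ₗ e)) :
    P.functor.obj (Vᘁ ⊙ₗ d) ⟶ F.functor.obj e :=
  δₗ P.functor Vᘁ d ≫ Vᘁ ⊴ₗ (f ≫ δₗ F.functor V e) ≫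
    (αₗ Vᘁ V (F.functor.obj e)).inv ≫ evAct V (F.functor.obj e)

lemma gammaMap_precomp {P P' : ModEnd W M} (t : P ⟶ P') (F : ModEnd W M) (V : W) (d e : M)
    (f : P'.functor.obj d ⟶ F.functor.obj (V ⊙ₗ e)) :
    t.nat.app (Vᘁ ⊙ₗ d) ≫ gammaMap P' F V d e f = gammaMap P F V d e (t.nat.app d ≫ f) := by
  rw [gammaMap, gammaMap, ModEnd.Hom.comm_assoc, Category.assoc, actionHomRight_comp,
    actionHomRight_comp, Category.assoc, actionHomRight_comp]
  simp only [Category.assoc]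

lemma module_iff (P F : ModEnd W M) (z : P.functor ⟶ F.functor) :
    (∀ (V : W) (d : M),
      z.app (V ⊙ₗ d) ≫ δₗ F.functor V d = δₗ P.functor V d ≫ V ⊴ₗ z.app d) ↔
    (∀ (V : W) (d : M), P.functor.map (evAct V d) ≫ z.app d =
      P.functor.map (αₗ Vᘁ V d).hom ≫ gammaMap P F V (V ⊙ₗ d) d (z.app (V ⊙ₗ d))) := by
  have key : ∀ (V : W) (d : M), P.functor.map (evAct V d) ≫ z.app d =
      P.functor.map (αₗ Vᘁ V d).hom ≫ δₗ P.functor Vᘁ (V ⊙ₗ d) ≫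
        Vᘁ ⊴ₗ (δₗ P.functor V d ≫ V ⊴ₗ z.app d) ≫
          (αₗ Vᘁ V (F.functor.obj d)).inv ≫ evAct V (F.functor.obj d) := by
    intro V d
    have h1 := δₗ_associativity P.functor Vᘁ V d
    have h2 := δₗ_naturality_left P.functor (ε_ V Vᘁ) d
    have h3 := δₗ_unitality_hom (C := W) P.functor d
    have h4 := evAct_naturality V (z.app d)
    have h5 : P.functor.map (evAct V d) = δₗ P.functor (Vᘁ ⊗ V) d ≫ evAct V _ := by
      rw [evAct, evAct, Functor.map_comp, ← h3, reassoc_of% h2]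
    rw [actionHomRight_comp, Category.assoc, ← reassoc_of% h1, h5, Category.assoc, ← h4]
    simp
  constructor
  · intro h V d
    rw [key, gammaMap, h]
  · intro h V d
    apply act_hom_ext
    have h1 := (h V d).symm.trans (key V d)
    rw [gammaMap, cancel_epi, cancel_epi] at h1
    exact h1

variable {A : Type u₃} [Category.{v₃} A]

/-- A family of morphisms `π_d : E ⟶ S(d,d)` which is dinatural and satisfies the additional
relation defining the relative end of `S` with respect to
`β^V_{d,e} : S(d, V ▷ e) ⟶ S(V* ▷ d, e)`. -/
structure IsRelWedge (S : Mᵒᵖ ⥤ M ⥤ A)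
    (β : ∀ (V : W) (d e : M), (S.obj (op d)).obj (V ⊙ₗ e) ⟶ (S.obj (op (Vᘁ ⊙ₗ d))).obj e)
    {E : A} (π : ∀ d : M, E ⟶ (S.obj (op d)).obj d) : Prop where
  dinatural : ∀ {d d' : M} (f : d ⟶ d'),
    π d ≫ (S.obj (op d)).map f = π d' ≫ (S.map f.op).app d'
  balanced : ∀ (V : W) (d : M),
    π d ≫ (S.map (evAct V d).op).app d =
      π (V ⊙ₗ d) ≫ β V (V ⊙ₗ d) d ≫ (S.map (αₗ Vᘁ V d).hom.op).app d

lemma IsRelWedge.precomp {S : Mᵒᵖ ⥤ M ⥤ A}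
    {β : ∀ (V : W) (d e : M), (S.obj (op d)).obj (V ⊙ₗ e) ⟶ (S.obj (op (Vᘁ ⊙ₗ d))).obj e}
    {E E' : A} {π : ∀ d : M, E ⟶ (S.obj (op d)).obj d} (h : IsRelWedge S β π) (f : E' ⟶ E) :
    IsRelWedge S β (fun d => f ≫ π d) where
  dinatural g := by simp only [Category.assoc, h.dinatural]
  balanced V d := by simp only [Category.assoc, h.balanced]

/-- A relative end of the pair `(S, β)`: a universal relative wedge. -/
structure RelEnd (S : Mᵒᵖ ⥤ M ⥤ A)
    (β : ∀ (V : W) (d e : M), (S.obj (op d)).obj (V ⊙ₗ e) ⟶ (S.obj (op (Vᘁ ⊙ₗ d))).obj e) where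
  pt : A
  π : ∀ d : M, pt ⟶ (S.obj (op d)).obj d
  isRelWedge : IsRelWedge S β π
  universal : ∀ {E : A} (ξ : ∀ d : M, E ⟶ (S.obj (op d)).obj d), IsRelWedge S β ξ →
    ∃! h : E ⟶ pt, ∀ d, ξ d = h ≫ π d

end RelativeEnd

section InternalHom

variable (C : Type u₂) [Category.{v₂} C] [MonoidalCategory C]
  (M : Type u₃) [Category.{v₃} M] [MonoidalLeftAction C M]

open MonoidalLeftAction

/-- Internal Homs of a `C`-module category: a bifunctor `uhom(-,-)` together with isomorphisms
`Hom(X ▷ d, e) ≃ Hom(X, uhom(d, e))`, natural in the three variables. -/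
structure InternalHom where
  uhom : Mᵒᵖ ⥤ M ⥤ C
  adj : (curriedAction C M).flip ⊣₂ uhom

namespace InternalHom

variable {C M} (H : InternalHom C M)

/-- The internal Hom object `uhom(d, e)`. -/
abbrev obj (d e : M) : C := (H.uhom.obj (op d)).obj e

/-- `uhom(id_d, g)`. -/
abbrev mapRight (d : M) {e e' : M} (g : e ⟶ e') : H.obj d e ⟶ H.obj d e' :=
  (H.uhom.obj (op d)).map g

/-- `uhom(f, id_e)`. -/
abbrev mapLeft {d d' : M} (f : d ⟶ d') (e : M) : H.obj d' e ⟶ H.obj d e :=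
  (H.uhom.map f.op).app e

/-- `ψ : Hom(X ▷ d, e) ≃ Hom(X, uhom(d, e))`; its inverse is `φ`. -/
def psi {X : C} {d e : M} : (X ⊙ₗ d ⟶ e) ≃ (X ⟶ H.obj d e) := H.adj.homEquiv

/-- The evaluation `uhom(d, e) ▷ d ⟶ e`. -/
def ev (d e : M) : H.obj d e ⊙ₗ d ⟶ e := H.psi.symm (𝟙 _)

/-- The coevaluation `X ⟶ uhom(d, X ▷ d)`. -/
def coev (X : C) (d : M) : X ⟶ H.obj d (X ⊙ₗ d) := H.psi (𝟙 _)

/-- The morphism `𝔞⁻¹ : X ⊗ uhom(d, e) ⟶ uhom(d, X ▷ e)`. -/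
def aInv (X : C) (d e : M) : X ⊗ H.obj d e ⟶ H.obj d (X ⊙ₗ e) :=
  H.coev (X ⊗ H.obj d e) d ≫ H.mapRight d ((αₗ X (H.obj d e) d).hom ≫ X ⊴ₗ H.ev d e)

/-- The morphism `𝔟 : uhom(X ▷ d, e) ⊗ X ⟶ uhom(d, e)`. -/
def b (X : C) (d e : M) : H.obj (X ⊙ₗ d) e ⊗ X ⟶ H.obj d e :=
  H.coev (H.obj (X ⊙ₗ d) e ⊗ X) d ≫
    H.mapRight d ((αₗ (H.obj (X ⊙ₗ d) e) X d).hom ≫ H.ev (X ⊙ₗ d) e)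

lemma psi_symm_nat {X X' : C} (f : X ⟶ X') {d e : M} (g : X' ⟶ H.obj d e) :
    H.psi.symm (f ≫ g) = f ⊵ₗ d ≫ H.psi.symm g :=
  H.adj.homEquiv_symm_naturality_two f g

lemma psi_symm_mapRight {X : C} {d e e' : M} (g : X ⟶ H.obj d e) (f : e ⟶ e') :
    H.psi.symm (g ≫ H.mapRight d f) = H.psi.symm g ≫ f :=
  H.adj.homEquiv_symm_naturality_three f g

lemma psi_symm_mapLeft {X : C} {d d' e : M} (f : d ⟶ d') (g : X ⟶ H.obj d' e) :
    H.psi.symm (g ≫ H.mapLeft f e) = X ⊴ₗ f ≫ H.psi.symm g :=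
  H.adj.homEquiv_symm_naturality_one f g

lemma psi_symm_eq {X : C} {d e : M} (g : X ⟶ H.obj d e) :
    H.psi.symm g = g ⊵ₗ d ≫ H.ev d e := by
  rw [ev, ← psi_symm_nat, Category.comp_id]

end InternalHom
end InternalHom
section RhoBar

variable {V : Type u₁} [Category.{v₁} V] [MonoidalCategory V] [RightRigidCategory V]
  {C : Type u₂} [Category.{v₂} C] [MonoidalCategory C]
  {M : Type u₃} [Category.{v₃} M] [MonoidalLeftAction C M]
  {G : V ⥤ Center C} [G.Monoidal] (H : InternalHom C M)

open MonoidalLeftAction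

/-- The bifunctor `uhom(-, F(-))`. -/
def homFunctor (F : ModEnd (Via G) M) : Mᵒᵖ ⥤ M ⥤ C :=
  H.uhom ⋙ (Functor.whiskeringLeft M M C).obj F.functor

/-- The prebalancing `β^V_{d,e} : uhom(d, F(V ▸ e)) ⟶ uhom(V* ▸ d, F(e))`. -/
def betaMap (F : ModEnd (Via G) M) (X : Via G) (d e : M) :
    ((homFunctor H F).obj (op d)).obj (X ⊙ₗ e) ⟶
      ((homFunctor H F).obj (op (Xᘁ ⊙ₗ d))).obj e :=
  H.psi (gammaMap ((rho M G).obj (H.obj d (F.functor.obj (X ⊙ₗ e)))) F X d e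
    (H.ev d (F.functor.obj (X ⊙ₗ e))))

lemma psi_symm_betaMap (F : ModEnd (Via G) M) {Y : C} (X : Via G) (d e : M)
    (g : Y ⟶ H.obj d (F.functor.obj (X ⊙ₗ e))) :
    H.psi.symm (g ≫ betaMap H F X d e) =
      gammaMap ((rho M G).obj Y) F X d e (H.psi.symm g) := by
  have h := gammaMap_precomp ((rho M G).map g) F X d e (H.ev d (F.functor.obj (X ⊙ₗ e)))
  exact (H.psi_symm_nat g _).trans ((congrArg (_ ≫ ·) (H.psi.symm_apply_apply _)).trans
    (h.trans (congrArg (gammaMap ((rho M G).obj Y) F X d e) (H.psi_symm_eq g).symm)))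

lemma isRelWedge_iff (F : ModEnd (Via G) M) {Y : C} (ξ : ∀ d : M, Y ⟶ H.obj d (F.functor.obj d)) :
    IsRelWedge (homFunctor H F) (betaMap H F) ξ ↔
      ∃ z : (rho M G).obj Y ⟶ F, ∀ d, z.nat.app d = H.psi.symm (ξ d) := by
  have hb : ∀ (z : ((rho M G).obj Y).functor ⟶ F.functor) (_ : ∀ d, z.app d = H.psi.symm (ξ d))
      (X : Via G) (d : M),
      (ξ d ≫ ((homFunctor H F).map (evAct X d).op).app d =
        ξ (X ⊙ₗ d) ≫ betaMap H F X (X ⊙ₗ d) d ≫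
          ((homFunctor H F).map (αₗ Xᘁ X d).hom.op).app d) ↔
      (((rho M G).obj Y).functor.map (evAct X d) ≫ z.app d =
        ((rho M G).obj Y).functor.map (αₗ Xᘁ X d).hom ≫
          gammaMap ((rho M G).obj Y) F X (X ⊙ₗ d) d (z.app (X ⊙ₗ d))) := by
    intro z hz X d
    have h3 := psi_symm_betaMap H F X (X ⊙ₗ d) d (ξ (X ⊙ₗ d))
    have h1 := H.psi_symm_mapLeft (evAct X d) (ξ d)
    have h2 := H.psi_symm_mapLeft (αₗ Xᘁ X d).hom (ξ (X ⊙ₗ d) ≫ betaMap H F X (X ⊙ₗ d) d)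
    have h4 : H.psi.symm (ξ (X ⊙ₗ d) ≫ betaMap H F X (X ⊙ₗ d) d ≫
          H.mapLeft (αₗ Xᘁ X d).hom (F.functor.obj d)) = _ :=
      (congrArg H.psi.symm (Category.assoc _ _ _).symm).trans
        (h2.trans (congrArg (_ ≫ ·) h3))
    have h5 : H.psi.symm (ξ d) = z.app d := (hz d).symm
    have h6 : H.psi.symm (ξ (X ⊙ₗ d)) = z.app (X ⊙ₗ d) := (hz _).symm
    refine H.psi.symm.injective.eq_iff.symm.trans (Eq.congr (h1.trans ?_) (h4.trans ?_))
    · exact congrArg (_ ≫ ·) h5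
    · exact congrArg (fun t => _ ≫ gammaMap ((rho M G).obj Y) F X (X ⊙ₗ d) d t) h6
  constructor
  · intro h
    have hnat : ∀ {d d' : M} (f : d ⟶ d'), Y ⊴ₗ f ≫ H.psi.symm (ξ d') =
        H.psi.symm (ξ d) ≫ F.functor.map f := by
      intro d d' f
      rw [← H.psi_symm_mapLeft, ← H.psi_symm_mapRight]
      exact congrArg _ (h.dinatural f).symm
    let z : ((rho M G).obj Y).functor ⟶ F.functor :=
      { app := fun d => H.psi.symm (ξ d)
        naturality := fun d d' f => hnat f }
    exact ⟨⟨z, (module_iff _ F z).2 fun X d => (hb z (fun _ => rfl) X d).1 (h.balanced X d)⟩,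
      fun _ => rfl⟩
  · rintro ⟨z, hz⟩
    refine ⟨fun {d d'} f => ?_, fun X d => (hb z.nat hz X d).2 ((module_iff _ F z.nat).1 z.comm X d)⟩
    have h1 := z.nat.naturality f
    rw [hz, hz] at h1
    apply H.psi.symm.injective
    exact ((H.psi_symm_mapRight (ξ d) (F.functor.map f)).trans h1.symm).trans
      (H.psi_symm_mapLeft f (ξ d')).symm

/-- A choice of relative ends `∮_d (uhom(d, F(d)), β)` for all `V`-module endofunctors `F`. -/
abbrev RelEnds (G : V ⥤ Center C) [G.Monoidal] (H : InternalHom C M) :=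
  ∀ F : ModEnd (Via G) M, RelEnd (homFunctor H F) (betaMap H F)

variable {H} (R : RelEnds G H)

lemma rhoBar_hom_ext (F : ModEnd (Via G) M) {X : C} {h h' : X ⟶ (R F).pt}
    (w : ∀ d, h ≫ (R F).π d = h' ≫ (R F).π d) : h = h' :=
  ((R F).universal (fun d => h ≫ (R F).π d) ((R F).isRelWedge.precomp h)).unique
    (fun _ => rfl) w

/-- The bijection `Nat_V(ρ(X), F) ≃ Hom(X, ρ̄(F))`, `z ↦ h`, where `ψ(z_d) = λ^F_d ∘ h`. -/
def rhoBarEquiv (X : C) (F : ModEnd (Via G) M) :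
    ((rho M G).obj X ⟶ F) ≃ (X ⟶ (R F).pt) where
  toFun z := ((R F).universal (fun d => H.psi (z.nat.app d))
    ((isRelWedge_iff H F _).2 ⟨z, fun _ => (H.psi.symm_apply_apply _).symm⟩)).choose
  invFun h := ((isRelWedge_iff H F (fun d => h ≫ (R F).π d)).1
    ((R F).isRelWedge.precomp h)).choose
  left_inv z := by
    have h1 := ((R F).universal (fun d => H.psi (z.nat.app d))
      ((isRelWedge_iff H F _).2 ⟨z, fun _ => (H.psi.symm_apply_apply _).symm⟩)).choose_spec.1
    refine ModEnd.hom_ext _ _ fun d => ?_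
    refine (((isRelWedge_iff H F _).1 ((R F).isRelWedge.precomp _)).choose_spec d).trans ?_
    exact (congrArg H.psi.symm (h1 d).symm).trans (H.psi.symm_apply_apply _)
  right_inv h := by
    have h1 := ((isRelWedge_iff H F (fun d => h ≫ (R F).π d)).1
      ((R F).isRelWedge.precomp h)).choose_spec
    refine rhoBar_hom_ext R F fun d => ?_
    refine (((R F).universal _ ((isRelWedge_iff H F _).2
      ⟨_, fun _ => (H.psi.symm_apply_apply _).symm⟩)).choose_spec.1 d).symm.trans ?_
    exact (congrArg H.psi (h1 d)).trans (H.psi.apply_symm_apply _)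

lemma rhoBarEquiv_π {X : C} {F : ModEnd (Via G) M} (z : (rho M G).obj X ⟶ F) (d : M) :
    rhoBarEquiv R X F z ≫ (R F).π d = H.psi (z.nat.app d) :=
  (((R F).universal (fun d => H.psi (z.nat.app d))
    ((isRelWedge_iff H F _).2 ⟨z, fun _ => (H.psi.symm_apply_apply _).symm⟩)).choose_spec.1 d).symm

lemma rhoBarEquiv_nat (X' X : C) (F : ModEnd (Via G) M) (f : X' ⟶ X)
    (z : (rho M G).obj X ⟶ F) :
    rhoBarEquiv R X' F ((rho M G).map f ≫ z) = f ≫ rhoBarEquiv R X F z := by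
  refine rhoBar_hom_ext R F fun d => ?_
  rw [rhoBarEquiv_π, Category.assoc, rhoBarEquiv_π]
  apply H.psi.symm.injective
  refine (H.psi.symm_apply_apply _).trans ?_
  exact (congrArg (_ ≫ ·) (H.psi.symm_apply_apply _).symm).trans (H.psi_symm_nat f _).symm

/-- The functor `ρ̄ : End_V(M) ⥤ C`, `ρ̄(F) = ∮_d (uhom(d, F(d)), β)`, right adjoint to `ρ`. -/
def rhoBar : ModEnd (Via G) M ⥤ C :=
  Adjunction.rightAdjointOfEquiv (rhoBarEquiv R) (rhoBarEquiv_nat R)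

/-- The adjunction `ρ ⊣ ρ̄`. -/
def rhoAdj : rho M G ⊣ rhoBar R :=
  Adjunction.adjunctionOfEquivRight (rhoBarEquiv R) (rhoBarEquiv_nat R)

lemma rhoBar_obj (F : ModEnd (Via G) M) : (rhoBar R).obj F = (R F).pt := rfl

/-- On morphisms, `ρ̄` is the map induced on relative ends. -/
lemma rhoBar_map_π {F F' : ModEnd (Via G) M} (t : F ⟶ F') (d : M) :
    (rhoBar R).map t ≫ (R F').π d = (R F).π d ≫ H.mapRight d (t.nat.app d) := by
  have h0 := (rhoBarEquiv R _ F).apply_symm_apply (𝟙 _)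
  have h1 := rhoBarEquiv_π R ((rhoBarEquiv R (R F).pt F).symm (𝟙 _)) d
  rw [h0, Category.id_comp] at h1
  have h2 := rhoBarEquiv_π R ((rhoBarEquiv R (R F).pt F).symm (𝟙 _) ≫ t) d
  refine h2.trans ?_
  rw [h1]
  apply H.psi.symm.injective
  refine (H.psi.symm_apply_apply _).trans (Eq.trans ?_ (H.psi_symm_mapRight _ _).symm)
  exact congrArg (· ≫ t.nat.app d) (H.psi.symm_apply_apply _).symm

/-- The lax monoidal structure on the right adjoint `ρ̄` of the strong monoidal functor `ρ`. -/
instance : (rhoBar R).LaxMonoidal := (rhoAdj R).rightAdjointLaxMonoidal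

open Functor.LaxMonoidal Functor.OplaxMonoidal

/-- The morphism `l⁻¹ : X ⊗ ρ̄(F) ⟶ ρ̄(ρ(X) ∘ F)`, adjoint to
`ρ(X ⊗ ρ̄(F)) ≅ ρ(X) ∘ ρ(ρ̄(F)) ⟶ ρ(X) ∘ F`. -/
def lInv (X : C) (F : ModEnd (Via G) M) :
    X ⊗ (rhoBar R).obj F ⟶ (rhoBar R).obj ((rho M G).obj X ⊗ F) :=
  (rhoAdj R).homEquiv _ _
    (δ (rho M G) X ((rhoBar R).obj F) ≫ (rho M G).obj X ◁ (rhoAdj R).counit.app F)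

/-- The morphism `r⁻¹ : ρ̄(F) ⊗ X ⟶ ρ̄(F ∘ ρ(X))`, adjoint to
`ρ(ρ̄(F) ⊗ X) ≅ ρ(ρ̄(F)) ∘ ρ(X) ⟶ F ∘ ρ(X)`. -/
def rInv (F : ModEnd (Via G) M) (X : C) :
    (rhoBar R).obj F ⊗ X ⟶ (rhoBar R).obj (F ⊗ (rho M G).obj X) :=
  (rhoAdj R).homEquiv _ _
    (δ (rho M G) ((rhoBar R).obj F) X ≫ (rhoAdj R).counit.app F ▷ (rho M G).obj X)

/-- The compatibility of a half-braiding on `ρ̄(Id)` with the dinatural maps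
`π_d : ρ̄(Id) ⟶ uhom(d, d)`. -/
def IsPiCompatible (σ : HalfBraiding ((rhoBar R).obj (𝟙_ (ModEnd (Via G) M)))) : Prop :=
  ∀ (X : C) (d : M),
    (R (𝟙_ _)).π (X ⊙ₗ d) ▷ X ≫ H.b X d (X ⊙ₗ d) =
      (σ.β X).hom ≫ X ◁ (R (𝟙_ _)).π d ≫ H.aInv X d d

/-- The object `(ρ̄(Id), σ)` of the Drinfeld center. -/
def centralObj (σ : HalfBraiding ((rhoBar R).obj (𝟙_ (ModEnd (Via G) M)))) : Center C :=
  ⟨_, σ⟩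

/-- The multiplication `μ_{Id,Id}` of `ρ̄(Id)`. -/
def algMul : (rhoBar R).obj (𝟙_ (ModEnd (Via G) M)) ⊗ (rhoBar R).obj (𝟙_ (ModEnd (Via G) M)) ⟶
    (rhoBar R).obj (𝟙_ (ModEnd (Via G) M)) :=
  μ (rhoBar R) _ _ ≫ (rhoBar R).map (λ_ _).hom

/-- The unit `ε` of `ρ̄(Id)`. -/
def algUnit : 𝟙_ C ⟶ (rhoBar R).obj (𝟙_ (ModEnd (Via G) M)) := ε (rhoBar R)

end RhoBar


section LinearCenter

variable {C : Type u₂} [Category.{v₂} C] [MonoidalCategory C] [Preadditive C]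
  [MonoidalPreadditive C]

lemma neg_whisker {X Y : C} (f : X ⟶ Y) (U : C) : (-f) ▷ U = -(f ▷ U) :=
  (tensorRight U).map_neg

lemma whisker_neg {X Y : C} (f : X ⟶ Y) (U : C) : U ◁ (-f) = -(U ◁ f) :=
  (tensorLeft U).map_neg

instance (X Y : Center C) : Zero (X ⟶ Y) := ⟨⟨0, fun U => by simp⟩⟩
instance (X Y : Center C) : Add (X ⟶ Y) := ⟨fun f g => ⟨f.f + g.f, fun U => by
  simp [MonoidalPreadditive.add_whiskerRight, MonoidalPreadditive.whiskerLeft_add, f.comm,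
    g.comm]⟩⟩
instance (X Y : Center C) : Neg (X ⟶ Y) := ⟨fun f => ⟨-f.f, fun U => by
  rw [neg_whisker, whisker_neg, Preadditive.neg_comp, Preadditive.comp_neg, f.comm]⟩⟩

@[simp] lemma center_zero_f (X Y : Center C) : (0 : X ⟶ Y).f = 0 := rfl
@[simp] lemma center_add_f {X Y : Center C} (f g : X ⟶ Y) : (f + g).f = f.f + g.f := rfl
@[simp] lemma center_neg_f {X Y : Center C} (f : X ⟶ Y) : (-f).f = -f.f := rfl

/-- The Drinfeld center of a preadditive monoidal category is preadditive. -/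
instance centerPreadditive : Preadditive (Center C) where
  homGroup _ _ :=
    { add_assoc _ _ _ := Center.ext _ _ (add_assoc _ _ _)
      zero_add _ := Center.ext _ _ (zero_add _)
      add_zero _ := Center.ext _ _ (add_zero _)
      neg_add_cancel _ := Center.ext _ _ (neg_add_cancel _)
      add_comm _ _ := Center.ext _ _ (add_comm _ _)
      nsmul := nsmulRec
      zsmul := zsmulRec }
  add_comp _ _ _ _ _ _ := Center.ext _ _ (Preadditive.add_comp _ _ _ _ _ _)
  comp_add _ _ _ _ _ _ := Center.ext _ _ (Preadditive.comp_add _ _ _ _ _ _)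

variable (k : Type w) [Field k] [Linear k C] [MonoidalLinear k C]

instance (X Y : Center C) : SMul k (X ⟶ Y) := ⟨fun a f => ⟨a • f.f, fun U => by
  simp [f.comm]⟩⟩

/-- The Drinfeld center of a linear monoidal category is linear. -/
instance centerLinear : Linear k (Center C) where
  homModule _ _ :=
    { one_smul _ := Center.ext _ _ (one_smul _ _)
      mul_smul _ _ _ := Center.ext _ _ (mul_smul _ _ _)
      smul_zero _ := Center.ext _ _ (smul_zero _)
      smul_add _ _ _ := Center.ext _ _ (smul_add _ _ _)
      add_smul _ _ _ := Center.ext _ _ (add_smul _ _ _)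
      zero_smul _ := Center.ext _ _ (zero_smul _ _) }
  smul_comp _ _ _ _ _ _ := Center.ext _ _ (Linear.smul_comp _ _ _ _ _ _)
  comp_smul _ _ _ _ _ _ := Center.ext _ _ (Linear.comp_smul _ _ _ _ _ _)

end LinearCenter

section RelativeCenter

variable {V : Type u₁} [Category.{v₁} V]
  {C : Type u₂} [Category.{v₂} C] [MonoidalCategory C]

/-- The objects of the relative center: the centralizer of the image of `G` in the Drinfeld
center. -/
def relativeCenter (G : V ⥤ Center C) : ObjectProperty (Center C) :=
  fun A => ∀ Y : V, (β_ A (G.obj Y)).hom ≫ (β_ (G.obj Y) A).hom = 𝟙 (A ⊗ G.obj Y)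

lemma double_braiding_tensor {B : Type u₁} [Category.{v₁} B] [MonoidalCategory B]
    [BraidedCategory B] (X₁ X₂ Z : B) (h₁ : (β_ X₁ Z).hom ≫ (β_ Z X₁).hom = 𝟙 _)
    (h₂ : (β_ X₂ Z).hom ≫ (β_ Z X₂).hom = 𝟙 _) :
    (β_ (X₁ ⊗ X₂) Z).hom ≫ (β_ Z (X₁ ⊗ X₂)).hom = 𝟙 _ := by
  rw [BraidedCategory.braiding_tensor_left_hom, BraidedCategory.braiding_tensor_right_hom]
  simp only [Category.assoc, Iso.hom_inv_id_assoc]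
  rw [← comp_whiskerRight_assoc, h₁, id_whiskerRight, Category.id_comp,
    Iso.inv_hom_id_assoc, ← whiskerLeft_comp_assoc, h₂, whiskerLeft_id, Category.id_comp,
    Iso.hom_inv_id]

/-- The relative center is a monoidal subcategory of the Drinfeld center. -/
instance (G : V ⥤ Center C) : (relativeCenter G).IsMonoidal where
  prop_unit Y := by
    rw [braiding_tensorUnit_left, braiding_tensorUnit_right]
    simp
  prop_tensor X₁ X₂ h₁ h₂ Y := double_braiding_tensor X₁ X₂ (G.obj Y) (h₁ Y) (h₂ Y)

end RelativeCenter

section Hypotheses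

variable (k : Type w) [Field k]

open MonoidalLeftAction

/-- Finite `k`-linear abelian categories: finite-dimensional morphism spaces, objects of finite
length, enough projectives, and finitely many isomorphism classes of simple objects. -/
class IsFiniteCategory (C : Type u₁) [Category.{v₁} C] [Abelian C] [Linear k C] : Prop where
  finite_hom : ∀ X Y : C, Module.Finite k (X ⟶ Y)
  noetherian : ∀ X : C, IsNoetherianObject X
  artinian : ∀ X : C, IsArtinianObject X
  enoughProjectives : EnoughProjectives C
  finite_simples : ∃ (n : ℕ) (S : Fin n → C), ∀ X : C, Simple X → ∃ i, Nonempty (X ≅ S i)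

/-- A rigid monoidal `k`-linear abelian category with bilinear tensor product is a (finite) tensor
category if it is finite and its unit object is simple. -/
class IsTensorCategory (C : Type u₁) [Category.{v₁} C] [Abelian C] [Linear k C]
    [MonoidalCategory C] [MonoidalPreadditive C] [MonoidalLinear k C] [RigidCategory C] : Prop
    extends IsFiniteCategory k C where
  simple_unit : Simple (𝟙_ C)

/-- A `C`-module category: a finite `k`-linear abelian category with an action of `C` which is
`k`-bilinear and exact in each variable. -/
class IsModuleCategory (C : Type u₁) [Category.{v₁} C] [Abelian C] [Linear k C]
    [MonoidalCategory C] (M : Type u₂) [Category.{v₂} M] [Abelian M] [Linear k M]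
    [MonoidalLeftAction C M] : Prop extends IsFiniteCategory k M where
  additive_left : ∀ X : C, (actionLeft M X).Additive
  additive_right : ∀ d : M, (actionRight C d).Additive
  linear_left : ∀ X : C, (actionLeft M X).Linear k
  linear_right : ∀ d : M, (actionRight C d).Linear k
  lex_left : ∀ X : C, PreservesFiniteLimits (actionLeft M X)
  rex_left : ∀ X : C, PreservesFiniteColimits (actionLeft M X)
  lex_right : ∀ d : M, PreservesFiniteLimits (actionRight C d)
  rex_right : ∀ d : M, PreservesFiniteColimits (actionRight C d)

/-- Exactness: `P ▷ d` is projective for every projective `P`. -/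
def IsExactModule (C : Type u₁) [Category.{v₁} C] [MonoidalCategory C] (M : Type u₂)
    [Category.{v₂} M] [MonoidalLeftAction C M] : Prop :=
  ∀ P : C, Projective P → ∀ d : M, Projective (P ⊙ₗ d)

/-- The action of `C` on a direct sum `M₁ ⊕ M₂` of module categories, whose underlying category is
the product. -/
instance prodAction (C : Type u₁) [Category.{v₁} C] [MonoidalCategory C]
    (M₁ : Type u₂) [Category.{v₂} M₁] [MonoidalLeftAction C M₁]
    (M₂ : Type u₃) [Category.{v₃} M₂] [MonoidalLeftAction C M₂] :
    MonoidalLeftAction C (M₁ × M₂) where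
  actionObj X d := (X ⊙ₗ d.1, X ⊙ₗ d.2)
  actionHomLeft f d := (f ⊵ₗ d.1, f ⊵ₗ d.2)
  actionHomRight X _ _ f := (X ⊴ₗ f.1, X ⊴ₗ f.2)
  actionHom f g := (f ⊙ₗₘ g.1, f ⊙ₗₘ g.2)
  actionAssocIso X Y d := (αₗ X Y d.1).prod (αₗ X Y d.2)
  actionUnitIso d := (λₗ d.1).prod (λₗ d.2)
  actionHom_def f g := by simp [actionHom_def]
  actionAssocIso_hom_naturality f g h :=
    Prod.ext (actionAssocIso_hom_naturality f g h.1) (actionAssocIso_hom_naturality f g h.2)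

/-- Indecomposability: `M` is non-zero and not equivalent, as a `C`-module category, to a direct
sum of two non-zero `C`-module categories. -/
def IsIndecomposable (C : Type u₁) [Category.{v₁} C] [Abelian C] [Linear k C]
    [MonoidalCategory C] (M : Type u₂) [Category.{v₂} M] [MonoidalLeftAction C M] : Prop :=
  (∃ d : M, ¬ IsZero d) ∧
    ∀ (M₁ M₂ : Type u₂) [Category.{v₂} M₁] [Abelian M₁] [Linear k M₁] [MonoidalLeftAction C M₁]
      [Category.{v₂} M₂] [Abelian M₂] [Linear k M₂] [MonoidalLeftAction C M₂],
      IsModuleCategory k C M₁ → IsModuleCategory k C M₂ →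
      (∃ e : M ≌ M₁ × M₂, Nonempty (e.functor.LeftLinear C)) →
        (∀ d : M₁, IsZero d) ∨ (∀ d : M₂, IsZero d)

end Hypotheses
end RelativeCenter

/-! The object `A = ρ̄(Id)` acts on `M` through the counit `ρ(A) ⟶ Id`, and this action detects
morphisms. By the adjunction a morphism `Y ⟶ A` is a module transformation `ρ(Y) ⟶ Id`; since `l⁻¹`
is invertible, a morphism `Y ⟶ X ⊗ A` is a module transformation `ρ(Y) ⟶ ρ(X)`. Identities between
morphisms into `A` or `X ⊗ A` may thus be checked by letting `A` act (`rhoBar_unit_hom_ext`,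
`tensor_rhoBar_hom_ext`). In these terms `σ_X` is the unique morphism for which moving `A` past `X`
and then acting on `d` is the same as acting on `X ▷ d` (`ActCompatible`), and this is the transpose
of the compatibility with `π` (`isPiCompatible_iff`). The half-braiding axioms and the algebra
structure in the center reduce to naturality of the action; commutativity is the compatibility for
`X = A`. The counit is a `V`-module transformation, which says that the inverse half-braiding of
`G(Y)` at `A` satisfies the condition that characterizes `σ_{G(Y)}`; so `A` lies in the relative
center.

Invertibility of `l⁻¹` and `r⁻¹` is the projection formula for the right adjoint of a strong
monoidal functor at objects with duals (`isIso_projection_left`, `isIso_projection_right`).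

Internal Homs and relative ends both represent functors `X ↦ Hom(T X, F)` on a finite category that
are left exact with finite-dimensional values. `exists_universal_element` represents such a functor:
among the elements killed by no nonzero morphism, one of maximal size is universal, the size being
bounded with the help of a projective separator.

For connectedness, a morphism from the unit to `(A, σ)` in the center gives a `C`-module
endomorphism of `Id_M` that determines it. These endomorphisms form a finite-dimensional algebra.
Exactness of `M` excludes elements of square zero (`eq_zero_of_square_zero`), indecomposability
excludes idempotents (`eq_zero_or_eq_one_of_idempotent`), and over an algebraically closed field
only scalars remain (`exists_eq_algebraMap_of_aeval`). -/

namespace RelativeCenter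

attribute [local instance] Abelian.hasFiniteBiproducts

open scoped ZeroObject

/-! ### Projective separators in finite categories -/

section Generator

variable {k : Type w} [Field k]
  {C : Type u₁} [Category.{v₁} C] [Abelian C] [Linear k C]

variable (k C) in
/-- A finite category has a projective object `P` such that morphisms out of `P` separate
morphisms. -/
lemma exists_projective_separator [IsFiniteCategory k C] :
    ∃ P : C, Projective P ∧ ∀ {X Y : C} (f : X ⟶ Y), (∀ h : P ⟶ X, h ≫ f = 0) → f = 0 := by
  obtain ⟨n, S, hS⟩ := IsFiniteCategory.finite_simples (k := k) (C := C)
  have := IsFiniteCategory.enoughProjectives (k := k) (C := C)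
  have hP : Projective (⨁ fun i => Projective.over (S i)) :=
    ⟨fun f e _ => ⟨biproduct.desc fun i => Projective.factorThru
      (biproduct.ι (fun i => Projective.over (S i)) i ≫ f) e,
      biproduct.hom_ext' _ _ fun i => by simp⟩⟩
  refine ⟨⨁ fun i => Projective.over (S i), hP, fun {X Y} f hf => ?_⟩
  -- The image of a nonzero `f` contains a simple object, isomorphic to some `S i`, onto which the
  -- direct sum maps. Projectivity lifts this to a morphism into `X` whose composite with `f` is
  -- nonzero.
  by_contra hne
  have := IsFiniteCategory.artinian (k := k) (image f)
  have hI : ¬ IsZero (image f) := fun h => hne (by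
    rw [← image.fac f, h.eq_of_src (image.ι f) 0, comp_zero])
  obtain ⟨T, hT⟩ := exists_simple_subobject hI
  obtain ⟨i, ⟨e⟩⟩ := hS (T : C) hT
  let q : (⨁ fun i => Projective.over (S i)) ⟶ (T : C) :=
    biproduct.π _ i ≫ Projective.π (S i) ≫ e.inv
  have hq : Epi q := by
    have : Epi (biproduct.π (fun i => Projective.over (S i)) i) := inferInstance
    exact epi_comp _ _
  have h := hf (Projective.factorThru (q ≫ T.arrow) (factorThruImage f))
  replace h : q ≫ T.arrow ≫ image.ι f = 0 := by
    have h0 := Projective.factorThru_comp (q ≫ T.arrow) (factorThruImage f) =≫ image.ι f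
    rwa [Category.assoc, image.fac, h, Category.assoc, eq_comm] at h0
  have h1 := zero_of_comp_mono _ (zero_of_epi_comp q h)
  have h2 : 𝟙 (T : C) = 0 := zero_of_comp_mono T.arrow (by rw [h1, comp_zero])
  exact id_nonzero _ h2

variable (k) in
/-- A separator `P` generates: every object is a quotient of a finite power of `P`. -/
lemma exists_epi_of_separator [IsFiniteCategory k C] {P : C}
    (hP : ∀ {X Y : C} (f : X ⟶ Y), (∀ h : P ⟶ X, h ≫ f = 0) → f = 0) (X : C) :
    ∃ (n : ℕ) (p : (⨁ fun _ : Fin n => P) ⟶ X), Epi p := by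
  have := IsFiniteCategory.finite_hom (k := k) P X
  let b := Module.finBasis k (P ⟶ X)
  refine ⟨_, biproduct.desc fun i => b i, Preadditive.epi_of_cancel_zero _ fun f hf => hP f ?_⟩
  have h : (Linear.rightComp k P f : (P ⟶ X) →ₗ[k] _) = 0 := b.ext fun i => by
    have h1 := biproduct.ι (fun _ => P) i ≫= hf
    simpa using h1
  exact fun g => LinearMap.congr_fun h g

variable (k) in
/-- Under an additive functor preserving epimorphisms, the morphisms out of the image of a separator
still detect zero morphisms. -/
lemma eq_zero_of_separator [IsFiniteCategory k C] {P : C}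
    (hP : ∀ {X Y : C} (f : X ⟶ Y), (∀ h : P ⟶ X, h ≫ f = 0) → f = 0)
    {D : Type u₂} [Category.{v₂} D] [Preadditive D] (T : C ⥤ D) [T.Additive]
    [T.PreservesEpimorphisms] {X : C} {Z : D} (f : T.obj X ⟶ Z)
    (hf : ∀ h : P ⟶ X, T.map h ≫ f = 0) : f = 0 := by
  obtain ⟨n, p, hp⟩ := exists_epi_of_separator k hP X
  -- Splitting `p` into its coordinates makes `T p` a sum of terms passing through `T P`, where `hf`
  -- applies.
  have h1 : T.map p = ∑ i, T.map (biproduct.π (fun _ : Fin n => P) i) ≫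
      T.map (biproduct.ι (fun _ : Fin n => P) i ≫ p) := by
    conv_lhs => rw [← Category.id_comp p, ← biproduct.total, Preadditive.sum_comp, Functor.map_sum]
    simp only [Category.assoc, Functor.map_comp]
  refine (cancel_epi (T.map p)).1 ?_
  rw [h1, Preadditive.sum_comp, comp_zero]
  exact Finset.sum_eq_zero fun i _ => by rw [Category.assoc, hf, comp_zero]

end Generator

/-! ### Representability by a maximal faithful element -/

section Representability

variable {k : Type w} [Field k]
  {C : Type u₁} [Category.{v₁} C] [Abelian C] [Linear k C]
  {E : Type u₂} [Category.{v₂} E] [Preadditive E] [Linear k E]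
  (T : C ⥤ E) [T.Additive]  (F : E)

/-- A morphism `x : T X ⟶ F` is faithful if no nonzero morphism into `X` is killed by it. -/
def IsFaithfulElement {X : C} (x : T.obj X ⟶ F) : Prop :=
  ∀ ⦃Z : C⦄ (h : Z ⟶ X), T.map h ≫ x = 0 → h = 0

variable {T F}

/-- Every `x : T X ⟶ F` comes from a faithful element of a quotient of `X`. -/
lemma exists_faithful_quotient
    (hepi : ∀ {X Y : C} (p : X ⟶ Y) [Epi p] (f : T.obj Y ⟶ F), T.map p ≫ f = 0 → f = 0)
    (hdesc : ∀ {X Y : C} (p : X ⟶ Y) [Epi p] (x : T.obj X ⟶ F),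
      T.map (kernel.ι p) ≫ x = 0 → ∃ y, T.map p ≫ y = x)
    {X : C} [IsNoetherianObject X] (x : T.obj X ⟶ F) :
    ∃ (Q : C) (p : X ⟶ Q) (y : T.obj Q ⟶ F),
      T.map p ≫ y = x ∧ IsFaithfulElement T F y := by
  -- `K` is a maximal subobject killed by `x`. It is the largest one: the sum of `K` and the image
  -- of a killed morphism `g` is again killed, hence equals `K`.
  obtain ⟨K, hK, hmax⟩ := (wellFounded_gt (α := Subobject X)).has_min
    {K | T.map K.arrow ≫ x = 0} ⟨⊥, by simp [Subobject.bot_arrow]⟩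
  have key : ∀ {Z : C} (g : Z ⟶ X), T.map g ≫ x = 0 → g ≫ cokernel.π K.arrow = 0 := by
    intro Z g hg
    let t := biprod.desc K.arrow g
    have ht : T.map t ≫ x = 0 := by
      have : t = biprod.fst ≫ K.arrow + biprod.snd ≫ g := biprod.desc_eq
      have hK' : T.map K.arrow ≫ x = 0 := hK
      rw [this, T.map_add, Preadditive.add_comp, T.map_comp, T.map_comp, Category.assoc,
        Category.assoc, hK', hg]
      simp
    have hL : T.map (Subobject.mk (image.ι t)).arrow ≫ x = 0 := by
      have h0 : T.map (image.ι t) ≫ x = 0 := by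
        apply hepi (factorThruImage t)
        rw [← Category.assoc, ← T.map_comp, image.fac, ht]
      rw [← Subobject.underlyingIso_hom_comp_eq_mk, T.map_comp, Category.assoc, h0, comp_zero]
    have hle : K ≤ Subobject.mk (image.ι t) :=
      Subobject.le_mk_of_comm (biprod.inl ≫ factorThruImage t) (by simp [t])
    have heq : K = Subobject.mk (image.ι t) := by
      by_contra hne
      exact hmax _ hL (lt_of_le_of_ne hle hne)
    have hfac : Subobject.Factors K g := by
      rw [heq]
      exact (Subobject.mk_factors_iff _ _).2 ⟨biprod.inr ≫ factorThruImage t, by simp [t]⟩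
    rw [← Subobject.factorThru_arrow K g hfac, Category.assoc, cokernel.condition, comp_zero]
  obtain ⟨y, hy⟩ := hdesc (cokernel.π K.arrow) x (by
    have h := (Abelian.monoIsKernelOfCokernel _ (cokernelIsCokernel K.arrow)).fac
      (KernelFork.ofι _ (kernel.condition (cokernel.π K.arrow))) WalkingParallelPair.zero
    have hK' : T.map K.arrow ≫ x = 0 := hK
    dsimp at h
    rw [← h, T.map_comp, Category.assoc, hK', comp_zero])
  refine ⟨_, _, y, hy, fun Z h hh => ?_⟩
  -- After pulling back along the epimorphism `X ⟶ X / K`, the morphism `h` lifts to a morphism into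
  -- `X` killed by `x`, which therefore dies in the quotient. The projection `pullback.fst` is an
  -- epimorphism, so `h` vanishes.
  have h1 : pullback.fst h (cokernel.π K.arrow) ≫ h = 0 := by
    rw [pullback.condition]
    apply key
    rw [← hy, ← Category.assoc, ← T.map_comp, ← pullback.condition, T.map_comp, Category.assoc,
      hh, comp_zero]
  exact zero_of_epi_comp _ h1

/-- Representability of a left exact functor `X ↦ Hom(T X, F)` with finite-dimensional values on
a finite category. -/
theorem exists_universal_element [IsFiniteCategory k C] [T.Linear k]
    (hepi : ∀ {X Y : C} (p : X ⟶ Y) [Epi p] (f : T.obj Y ⟶ F), T.map p ≫ f = 0 → f = 0)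
    (hdesc : ∀ {X Y : C} (p : X ⟶ Y) [Epi p] (x : T.obj X ⟶ F),
      T.map (kernel.ι p) ≫ x = 0 → ∃ y, T.map p ≫ y = x)
    (hfin : ∀ X : C, Module.Finite k (T.obj X ⟶ F)) :
    ∃ (A : C) (u : T.obj A ⟶ F), ∀ {X : C} (x : T.obj X ⟶ F), ∃! h : X ⟶ A, T.map h ≫ u = x := by
  obtain ⟨P, hP, hsep⟩ := exists_projective_separator k C
  have := fun X : C => IsFiniteCategory.noetherian (k := k) X
  have := fun X Y : C => IsFiniteCategory.finite_hom (k := k) X Y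
  -- The size of a faithful element is measured by the dimension of `Hom(P, X)`, which embeds into
  -- `Hom(T P, F)`. The bound is uniform, so a faithful element of maximal size exists.
  have hbound : ∀ (X : C) (x : T.obj X ⟶ F), IsFaithfulElement T F x →
      Module.finrank k (P ⟶ X) ≤ Module.finrank k (T.obj P ⟶ F) := by
    intro X x hx
    let φ : (P ⟶ X) →ₗ[k] (T.obj P ⟶ F) := Linear.rightComp k _ x ∘ₗ T.mapLinearMap k
    refine LinearMap.finrank_le_finrank_of_injective (f := φ) ?_
    refine (injective_iff_map_eq_zero _).2 fun h hh => hx h hh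
  let s : Set ℕ := {n | ∃ (X : C) (x : T.obj X ⟶ F), IsFaithfulElement T F x ∧
    Module.finrank k (P ⟶ X) = n}
  have hs : s.Nonempty := by
    obtain ⟨Q, p, y, -, hy⟩ := exists_faithful_quotient hepi hdesc (0 : T.obj (0 : C) ⟶ F)
    exact ⟨_, Q, y, hy, rfl⟩
  have hs' : BddAbove s := ⟨Module.finrank k (T.obj P ⟶ F), by
    rintro _ ⟨X, x, hx, rfl⟩
    exact hbound X x hx⟩
  obtain ⟨A, u, hu, hA⟩ := Nat.sSup_mem hs hs'
  refine ⟨A, u, fun {X} x => ?_⟩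
  -- Merge `u` and `x` in a faithful quotient `Q` of `A ⊞ X`. The map `A ⟶ Q` is a monomorphism
  -- because `u` is faithful, and an isomorphism because `A` has maximal size. Carrying `X ⟶ Q` back
  -- to `A` gives the required morphism.
  obtain ⟨Q, p, y, hpy, hy⟩ := exists_faithful_quotient hepi hdesc
    (T.map biprod.fst ≫ u + T.map biprod.snd ≫ x : T.obj (A ⊞ X) ⟶ F)
  have h1 : T.map (biprod.inl ≫ p) ≫ y = u := by
    rw [T.map_comp, Category.assoc, hpy, Preadditive.comp_add, ← T.map_comp_assoc,
      ← T.map_comp_assoc]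
    simp
  have h2 : T.map (biprod.inr ≫ p) ≫ y = x := by
    rw [T.map_comp, Category.assoc, hpy, Preadditive.comp_add, ← T.map_comp_assoc,
      ← T.map_comp_assoc]
    simp
  have hmono : Mono (biprod.inl ≫ p) := Preadditive.mono_of_cancel_zero _ fun g hg => hu g (by
    rw [← h1, ← Category.assoc, ← T.map_comp, hg]; simp)
  have hle : Module.finrank k (P ⟶ Q) ≤ Module.finrank k (P ⟶ A) := by
    rw [hA]
    exact le_csSup hs' ⟨Q, y, hy, rfl⟩
  have hinj : Function.Injective (Linear.rightComp k P (biprod.inl ≫ p)) :=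
    fun f g h => (cancel_mono _).1 h
  have hsurj : Function.Surjective (Linear.rightComp k P (biprod.inl ≫ p)) :=
    (LinearMap.injective_iff_surjective_of_finrank_eq_finrank (le_antisymm
      (LinearMap.finrank_le_finrank_of_injective hinj) hle)).1 hinj
  -- Every morphism from the separator to `Q` factors through `A`, so whatever kills `A` kills `Q`.
  have hepi' : Epi (biprod.inl ≫ p) := Preadditive.epi_of_cancel_zero _ fun g hg =>
    hsep g fun h => by
      obtain ⟨h', rfl⟩ := hsurj h
      exact (Category.assoc _ _ _).trans (by rw [hg, comp_zero])
  have : IsIso (biprod.inl ≫ p) := isIso_of_mono_of_epi _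
  refine ⟨(biprod.inr ≫ p) ≫ inv (biprod.inl ≫ p), ?_, fun g hg => ?_⟩
  · change T.map _ ≫ u = x
    rw [← h1, ← Category.assoc, ← T.map_comp, Category.assoc, IsIso.inv_hom_id, Category.comp_id,
      h2]
  · rw [← sub_eq_zero]
    apply hu
    rw [T.map_sub, Preadditive.sub_comp, hg, sub_eq_zero, ← h1, ← Category.assoc, ← T.map_comp,
      Category.assoc, IsIso.inv_hom_id, Category.comp_id, h2]

end Representability

end RelativeCenter

namespace RelativeCenter

open MonoidalLeftAction Functor.OplaxLeftLinear

/-! ### Existence of internal Homs -/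

section ParametrizedRightAdjoint

variable {C₁ : Type u₁} [Category.{v₁} C₁] {C₂ : Type u₂} [Category.{v₂} C₂]
  {C₃ : Type u₃} [Category.{v₃} C₃] (F : C₁ ⥤ C₂ ⥤ C₃) [∀ X, (F.obj X).IsLeftAdjoint]

/-- The bifunctor formed by the right adjoints of a family of left adjoints. -/
def parametrizedRightAdjoint : C₁ᵒᵖ ⥤ C₃ ⥤ C₂ where
  obj X := (F.obj X.unop).rightAdjoint
  map {X Y} f := conjugateEquiv (Adjunction.ofIsLeftAdjoint (F.obj X.unop))
    (Adjunction.ofIsLeftAdjoint (F.obj Y.unop)) (F.map f.unop)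
  map_id X := by simp
  map_comp f g := by simp [conjugateEquiv_comp]

/-- The adjunction with a parameter formed by a family of adjunctions. -/
def parametrizedAdjunction : F ⊣₂ parametrizedRightAdjoint F :=
  .mk' (fun X => Adjunction.ofIsLeftAdjoint (F.obj X)) fun {X₁ Y₁} f {X₂ X₃} g => by
    have h := unit_conjugateEquiv (Adjunction.ofIsLeftAdjoint (F.obj Y₁))
      (Adjunction.ofIsLeftAdjoint (F.obj X₁)) (F.map f) X₂
    refine (Adjunction.homEquiv_unit _ _ _ _).trans
      (Eq.trans ?_ (congrArg (· ≫ _) (Adjunction.homEquiv_unit _ _ _ _).symm))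
    change _ ≫ (F.obj X₁).rightAdjoint.map _ = (_ ≫ (F.obj Y₁).rightAdjoint.map g) ≫
      (conjugateEquiv _ _ (F.map f)).app X₃
    rw [Functor.map_comp, ← reassoc_of% h]
    exact ((Category.assoc _ _ _).trans (congrArg (_ ≫ ·) (NatTrans.naturality _ g))).symm

end ParametrizedRightAdjoint

section InternalHomExistence

/-- In an abelian category an epimorphism is the cokernel of its kernel, and a right exact functor
preserves this cokernel. This supplies the hypothesis `hdesc` of `exists_universal_element`. -/
lemma exists_map_comp_eq_of_kernel {C : Type u₁} [Category.{v₁} C] [Abelian C]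
    {D : Type u₂} [Category.{v₂} D] [Preadditive D] (T : C ⥤ D) [T.Additive]
    [PreservesFiniteColimits T] {X Y : C} (p : X ⟶ Y) [Epi p] {Z : D} (x : T.obj X ⟶ Z)
    (h : T.map (kernel.ι p) ≫ x = 0) : ∃ y, T.map p ≫ y = x := by
  have hc := CokernelCofork.mapIsColimit _
    (Abelian.epiIsCokernelOfKernel _ (kernelIsKernel p)) T
  exact ⟨_, hc.fac (CokernelCofork.ofπ x h) WalkingParallelPair.one⟩

variable (k : Type w) [Field k]
  (C : Type u₂) [Category.{v₂} C] [Abelian C] [Linear k C] [MonoidalCategory C]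
  (M : Type u₃) [Category.{v₃} M] [Abelian M] [Linear k M] [MonoidalLeftAction C M]

/-- Internal Homs of a module category over a finite category exist. -/
theorem nonempty_internalHom [IsFiniteCategory k C] [IsModuleCategory k C M] :
    Nonempty (InternalHom C M) := by
  have hadj : ∀ d : M, ((curriedAction C M).flip.obj d).IsLeftAdjoint := by
    intro d
    have := IsModuleCategory.additive_right k (C := C) d
    have := IsModuleCategory.linear_right (k := k) (C := C) d
    have := IsModuleCategory.rex_right k (C := C) d
    -- The object representing `X ↦ Hom(X ▷ d, e)` is the internal Hom from `d` to `e`, and the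
    -- universal element is its evaluation.
    have h := fun e : M => exists_universal_element (k := k) (T := actionRight C d) (F := e)
      (fun p _ f hf => (cancel_epi ((actionRight C d).map p)).1 (hf.trans comp_zero.symm))
      (fun p _ x hx => exists_map_comp_eq_of_kernel _ p x hx)
      (fun X => IsFiniteCategory.finite_hom _ _)
    choose A u hu using h
    let E : ∀ (X : C) (e : M), ((actionRight C d).obj X ⟶ e) ≃ (X ⟶ A e) := fun X e =>
      { toFun := fun x => (hu e x).choose
        invFun := fun f => (actionRight C d).map f ≫ u e
        left_inv := fun x => (hu e x).choose_spec.1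
        right_inv := fun f => ((hu e _).choose_spec.2 f rfl).symm }
    refine (Adjunction.adjunctionOfEquivRight E fun X' X Y f g => ?_).isLeftAdjoint
    apply (E X' Y).symm.injective
    rw [Equiv.symm_apply_apply]
    change _ = (actionRight C d).map (f ≫ E X Y g) ≫ u Y
    rw [Functor.map_comp, Category.assoc]
    exact congrArg (_ ≫ ·) ((E X Y).symm_apply_apply g).symm
  exact ⟨⟨_, parametrizedAdjunction _⟩⟩

end InternalHomExistence

/-! ### Linear structure on module endofunctors -/

section LinearModEnd

variable {W : Type u₁} [Category.{v₁} W] [MonoidalCategory W]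
  {M : Type u₂} [Category.{v₂} M] [Preadditive M] [MonoidalLeftAction W M]

namespace ModEnd

section

variable [∀ X : W, (actionLeft M X).Additive]

lemma actionHomRight_zero (X : W) (d e : M) : X ⊴ₗ (0 : d ⟶ e) = 0 :=
  (actionLeft M X).map_zero _ _

lemma actionHomRight_add (X : W) {d e : M} (f g : d ⟶ e) :
    X ⊴ₗ (f + g) = X ⊴ₗ f + X ⊴ₗ g :=
  (actionLeft M X).map_add

lemma actionHomRight_neg (X : W) {d e : M} (f : d ⟶ e) : X ⊴ₗ (-f) = -X ⊴ₗ f :=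
  (actionLeft M X).map_neg

instance (F F' : ModEnd W M) : Zero (F ⟶ F') :=
  ⟨⟨0, fun X d => by simp [actionHomRight_zero]⟩⟩

instance (F F' : ModEnd W M) : Add (F ⟶ F') :=
  ⟨fun f g => ⟨f.nat + g.nat, fun X d => by
    simp [actionHomRight_add, f.comm, g.comm]⟩⟩

instance (F F' : ModEnd W M) : Neg (F ⟶ F') :=
  ⟨fun f => ⟨-f.nat, fun X d => by simp [actionHomRight_neg, f.comm]⟩⟩

@[simp] lemma zero_nat (F F' : ModEnd W M) : Hom.nat (0 : F ⟶ F') = 0 := rfl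

@[simp] lemma add_nat {F F' : ModEnd W M} (f g : F ⟶ F') : (f + g).nat = f.nat + g.nat := rfl

@[simp] lemma neg_nat {F F' : ModEnd W M} (f : F ⟶ F') : (-f).nat = -f.nat := rfl

/-- Module endofunctors of a preadditive category form a preadditive category. -/
instance : Preadditive (ModEnd W M) where
  homGroup _ _ :=
    { add_assoc _ _ _ := by ext; simp [add_assoc]
      zero_add _ := by ext; simp
      add_zero _ := by ext; simp
      neg_add_cancel _ := by ext; simp
      add_comm _ _ := by ext; simp [add_comm]
      nsmul := nsmulRec
      zsmul := zsmulRec }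
  add_comp _ _ _ _ _ _ := by ext; simp
  comp_add _ _ _ _ _ _ := by ext; simp

end

variable (k : Type w) [Field k] [Linear k M] [∀ X : W, (actionLeft M X).Linear k]

lemma actionHomRight_smul (X : W) (a : k) {d e : M} (f : d ⟶ e) :
    X ⊴ₗ (a • f) = a • X ⊴ₗ f :=
  Functor.Linear.map_smul (F := actionLeft M X) f a

instance (F F' : ModEnd W M) : SMul k (F ⟶ F') :=
  ⟨fun a f => ⟨a • f.nat, fun X d => by
    simp [actionHomRight_smul, f.comm]⟩⟩

@[simp] lemma smul_nat {F F' : ModEnd W M} (a : k) (f : F ⟶ F') : (a • f).nat = a • f.nat := rfl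

variable [∀ X : W, (actionLeft M X).Additive]

/-- Module endofunctors of a linear category form a linear category. -/
instance : Linear k (ModEnd W M) where
  homModule _ _ :=
    { one_smul _ := by ext; simp
      mul_smul _ _ _ := by ext; simp [mul_smul]
      smul_zero _ := by ext; simp
      smul_add _ _ _ := by ext; simp
      add_smul _ _ _ := by ext; simp [add_smul]
      zero_smul _ := by ext; simp }
  smul_comp _ _ _ _ _ _ := by ext; simp
  comp_smul _ _ _ _ _ _ := by ext; simp

end ModEnd

end LinearModEnd

/-! ### Existence of relative ends -/

section RelEndExistence

variable (k : Type w) [Field k] {V : Type u₁} [Category.{v₁} V] [MonoidalCategory V]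
  [RightRigidCategory V]
  {C : Type u₂} [Category.{v₂} C] [Abelian C] [Linear k C] [MonoidalCategory C]
  {M : Type u₃} [Category.{v₃} M] [Abelian M] [Linear k M] [MonoidalLeftAction C M]
  (G : V ⥤ Center C) [G.Monoidal]

/-- Relative ends of `uhom(-, F(-))` exist. -/
theorem nonempty_relEnds [IsFiniteCategory k C] [IsModuleCategory k C M] (H : InternalHom C M) :
    Nonempty (RelEnds G H) := by
  have hadd := fun X : C => IsModuleCategory.additive_left k (M := M) X
  have hlin := fun X : C => IsModuleCategory.linear_left (k := k) (M := M) X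
  have hadd' := fun d : M => IsModuleCategory.additive_right k (C := C) d
  have hlin' := fun d : M => IsModuleCategory.linear_right (k := k) (C := C) d
  have hrex := fun d : M => IsModuleCategory.rex_right k (C := C) d
  have hrex' := fun X : C => IsModuleCategory.rex_left k (M := M) X
  have : IsFiniteCategory k M := IsModuleCategory.toIsFiniteCategory C
  have : ∀ X : Via G, (actionLeft M X).Additive := fun X =>
    inferInstanceAs (actionLeft M ((Via.functor G).obj X).1).Additive
  have : ∀ X : Via G, (actionLeft M X).Linear k := fun X =>
    inferInstanceAs ((actionLeft M ((Via.functor G).obj X).1).Linear k)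
  have : (rho M G).Additive := ⟨fun {X Y f g} => by
    ext d
    exact (actionRight C d).map_add⟩
  have : (rho M G).Linear k := ⟨fun {X Y} f a => by
    ext d
    exact Functor.Linear.map_smul (F := actionRight C d) f a⟩
  have hep : ∀ {X Y : C} (p : X ⟶ Y) [Epi p] (d : M), Epi (p ⊵ₗ d) := fun p _ d =>
    inferInstanceAs (Epi ((actionRight C d).map p))
  obtain ⟨D, -, hD⟩ := exists_projective_separator k M
  -- By `isRelWedge_iff` a relative wedge with vertex `X` is a module transformation `ρ(X) ⟶ F`. A
  -- relative end therefore represents `X ↦ Hom(ρ(X), F)`.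
  have h := fun F : ModEnd (Via G) M => exists_universal_element (k := k) (T := rho M G) (F := F)
    (fun p _ f hf => by
      ext d
      have h1 : p ⊵ₗ d ≫ f.nat.app d = 0 := congrArg (fun t => t.nat.app d) hf
      exact (cancel_epi (p ⊵ₗ d)).1 (h1.trans comp_zero.symm))
    (fun {X Y} p _ x hx => by
      -- The transformation descends component by component since `- ▷ d` is right exact. Naturality
      -- and the module condition for the result follow by cancelling the epimorphisms `p ▷ d`.
      have h1 : ∀ d, ∃ y : Y ⊙ₗ d ⟶ F.functor.obj d, p ⊵ₗ d ≫ y = x.nat.app d := fun d =>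
        exists_map_comp_eq_of_kernel (actionRight C d) p (x.nat.app d)
          (congrArg (fun t => t.nat.app d) hx)
      choose y hy using h1
      let y' : ((rho M G).obj Y).functor ⟶ F.functor :=
        { app := y
          naturality := fun d d' f => by
            have h2 := x.nat.naturality f
            refine (cancel_epi (p ⊵ₗ d)).1 ?_
            change p ⊵ₗ d ≫ Y ⊴ₗ f ≫ y d' = p ⊵ₗ d ≫ y d ≫ F.functor.map f
            rw [← action_exchange_assoc, hy, ← Category.assoc, hy]
            exact h2 }
      refine ⟨⟨y', fun Z d => ?_⟩, by ext d; exact hy d⟩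
      refine (cancel_epi (p ⊵ₗ (Z ⊙ₗ d))).1 ?_
      have h2 := x.comm Z d
      have h3 := ((rho M G).map p).comm_assoc Z d (Z ⊴ₗ y d)
      have h4 : Z ⊴ₗ x.nat.app d = Z ⊴ₗ (p ⊵ₗ d) ≫ Z ⊴ₗ y d :=
        (congrArg (Z ⊴ₗ ·) (hy d).symm).trans (actionHomRight_comp _ _ _)
      exact (Category.assoc _ _ _).symm.trans ((congrArg (· ≫ δₗ F.functor Z d) (hy (Z ⊙ₗ d))).trans
        (h2.trans ((congrArg (_ ≫ ·) h4).trans h3.symm))))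
    (fun X => by
      -- A natural transformation out of the right exact functor `X ▷ -` is determined by its
      -- component at the separator `D`.
      let φ : ((rho M G).obj X ⟶ F) →ₗ[k] (X ⊙ₗ D ⟶ F.functor.obj D) :=
        { toFun := fun z => z.nat.app D
          map_add' := fun _ _ => rfl
          map_smul' := fun _ _ => rfl }
      have := IsFiniteCategory.finite_hom (k := k) (X ⊙ₗ D) (F.functor.obj D)
      refine Module.Finite.of_injective φ ((injective_iff_map_eq_zero φ).2 fun z hz => ?_)
      ext d
      refine eq_zero_of_separator k hD (actionLeft M X) (z.nat.app d) fun h => ?_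
      have h3 : X ⊴ₗ h ≫ z.nat.app d = z.nat.app D ≫ F.functor.map h := z.nat.naturality h
      have hz' : z.nat.app D = 0 := hz
      exact h3.trans ((congrArg (· ≫ _) hz').trans zero_comp))
  choose A u hu using h
  refine ⟨fun F => ?_⟩
  have hw : ∀ {X : C} (h : X ⟶ A F), ∀ d,
      ((rho M G).map h ≫ u F).nat.app d = H.psi.symm (h ≫ H.psi ((u F).nat.app d)) := fun h d =>
    (congrArg (_ ≫ ·) (H.psi.symm_apply_apply _).symm).trans (H.psi_symm_nat h _).symm
  exact
    { pt := A F
      π := fun d => H.psi ((u F).nat.app d)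
      isRelWedge := (isRelWedge_iff H F _).2 ⟨u F, fun d => (H.psi.symm_apply_apply _).symm⟩
      universal := fun {E} ξ hξ => by
        obtain ⟨z, hz⟩ := (isRelWedge_iff H F ξ).1 hξ
        obtain ⟨h, hh, huniq⟩ := hu F z
        refine ⟨h, fun d => ?_, fun h' hh' => huniq h' ?_⟩
        · apply H.psi.symm.injective
          exact (hz d).symm.trans ((congrArg (fun t => t.nat.app d) hh.symm).trans (hw h d))
        · ext d
          exact (hw h' d).trans ((congrArg H.psi.symm (hh' d).symm).trans (hz d).symm) }

end RelEndExistence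

end RelativeCenter

namespace RelativeCenter

/-! ### The projection formula -/

section ProjectionFormula

variable {C : Type u₁} [Category.{v₁} C] [MonoidalCategory C]
  {E : Type u₂} [Category.{v₂} E] [MonoidalCategory E]

open Functor.LaxMonoidal Functor.OplaxMonoidal Functor.Monoidal

/-- Strong monoidal functors preserve exact pairings. -/
@[reducible]
def exactPairingMap (L : C ⥤ E) [L.Monoidal] (X Y : C) [ExactPairing X Y] :
    ExactPairing (L.obj X) (L.obj Y) where
  coevaluation' := ε L ≫ L.map (η_ X Y) ≫ δ L X Y
  evaluation' := μ L Y X ≫ L.map (ε_ X Y) ≫ η L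
  coevaluation_evaluation' := by
    have h := L.congr_map (ExactPairing.coevaluation_evaluation X Y)
    simp only [Functor.map_comp, map_whiskerLeft, map_whiskerRight, map_associator_inv,
      map_rightUnitor, map_leftUnitor_inv, Category.assoc, μ_δ_assoc] at h
    rw [cancel_epi] at h
    have h1 := L.obj Y ◁ ε L ≫= h =≫ (δ L (𝟙_ C) Y ≫ η L ▷ L.obj Y)
    simp only [Category.assoc, μ_δ_assoc] at h1
    simp only [MonoidalCategory.whiskerLeft_comp, comp_whiskerRight, Category.assoc]
    simpa only [whiskerLeft_ε_η_assoc, whiskerRight_ε_η, Category.comp_id] using h1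
  evaluation_coevaluation' := by
    have h := L.congr_map (ExactPairing.evaluation_coevaluation X Y)
    simp only [Functor.map_comp, map_whiskerLeft, map_whiskerRight, map_associator,
      map_leftUnitor, map_rightUnitor_inv, Category.assoc, μ_δ_assoc] at h
    rw [cancel_epi] at h
    have h1 := ε L ▷ L.obj X ≫= h =≫ (δ L X (𝟙_ C) ≫ L.obj X ◁ η L)
    simp only [Category.assoc, μ_δ_assoc] at h1
    simp only [MonoidalCategory.whiskerLeft_comp, comp_whiskerRight, Category.assoc]
    simpa only [whiskerRight_ε_η_assoc, whiskerLeft_ε_η, Category.comp_id] using h1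

variable {L : C ⥤ E} [L.Monoidal] {R : E ⥤ C} (adj : L ⊣ R)

/-- The projection formula `X ⊗ R F ≅ R (L X ⊗ F)` for objects `X` with a right dual. -/
theorem isIso_projection_left (X Y : C) [ExactPairing X Y] (F : E) :
    IsIso (adj.homEquiv (X ⊗ R.obj F) (L.obj X ⊗ F)
      (δ L X (R.obj F) ≫ L.obj X ◁ adj.counit.app F)) := by
  let := exactPairingMap L X Y
  rw [isIso_iff_yoneda_map_bijective]
  intro T
  let e : (L.obj (Y ⊗ T) ⟶ F) ≃ (L.obj Y ⊗ L.obj T ⟶ F) :=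
    (μIso L Y T).symm.homFromEquiv
  -- The chain is `Hom(T, X ⊗ R F) ≃ Hom(Y ⊗ T, R F) ≃ Hom(L (Y ⊗ T), F) ≃ Hom(L Y ⊗ L T, F) ≃ Hom(L
  -- T, L X ⊗ F) ≃ Hom(T, R (L X ⊗ F))`. What remains is that it is composition with the projection
  -- morphism, which the Yoneda lemma then makes invertible.
  let Φ : (T ⟶ X ⊗ R.obj F) ≃ (T ⟶ R.obj (L.obj X ⊗ F)) :=
    (tensorLeftHomEquiv T X Y (R.obj F)).symm.trans <|
      (adj.homEquiv _ _).symm.trans <| e.trans <|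
      (tensorLeftHomEquiv (L.obj T) (L.obj X) (L.obj Y) F).trans (adj.homEquiv _ _)
  convert Φ.bijective using 2 with h
  obtain ⟨g, rfl⟩ := (tensorLeftHomEquiv T X Y (R.obj F)).surjective h
  apply (adj.homEquiv _ _).symm.injective
  rw [Adjunction.homEquiv_naturality_left_symm, Equiv.symm_apply_apply]
  simp only [Φ, Equiv.trans_apply, Equiv.symm_apply_apply, e]
  have hη : η_ (L.obj X) (L.obj Y) = ε L ≫ L.map (η_ X Y) ≫ δ L X Y := rfl
  simp [tensorLeftHomEquiv, hη, Adjunction.homEquiv_counit]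

/-- The projection formula `R F ⊗ X ≅ R (F ⊗ L X)` for objects `X` with a left dual. -/
theorem isIso_projection_right (X Y : C) [ExactPairing Y X] (F : E) :
    IsIso (adj.homEquiv (R.obj F ⊗ X) (F ⊗ L.obj X)
      (δ L (R.obj F) X ≫ adj.counit.app F ▷ L.obj X)) := by
  let := exactPairingMap L Y X
  rw [isIso_iff_yoneda_map_bijective]
  intro T
  let e : (L.obj (T ⊗ Y) ⟶ F) ≃ (L.obj T ⊗ L.obj Y ⟶ F) :=
    (μIso L T Y).symm.homFromEquiv
  -- The mirror image of the previous chain, with `X` moved across by its dual on the other side.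
  let Φ : (T ⟶ R.obj F ⊗ X) ≃ (T ⟶ R.obj (F ⊗ L.obj X)) :=
    (tensorRightHomEquiv T Y X (R.obj F)).symm.trans <|
      (adj.homEquiv _ _).symm.trans <| e.trans <|
      (tensorRightHomEquiv (L.obj T) (L.obj Y) (L.obj X) F).trans (adj.homEquiv _ _)
  convert Φ.bijective using 2 with h
  obtain ⟨g, rfl⟩ := (tensorRightHomEquiv T Y X (R.obj F)).surjective h
  apply (adj.homEquiv _ _).symm.injective
  rw [Adjunction.homEquiv_naturality_left_symm, Equiv.symm_apply_apply]
  simp only [Φ, Equiv.trans_apply, Equiv.symm_apply_apply, e]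
  have hη : η_ (L.obj Y) (L.obj X) = ε L ≫ L.map (η_ Y X) ≫ δ L Y X := rfl
  simp [tensorRightHomEquiv, hη, Adjunction.homEquiv_counit]

end ProjectionFormula

end RelativeCenter

namespace RelativeCenter

/-! ### Transposes of the structure maps of internal Homs -/

section InternalHomActions

open MonoidalLeftAction

variable {C : Type u₂} [Category.{v₂} C] [MonoidalCategory C]
  {M : Type u₃} [Category.{v₃} M] [MonoidalLeftAction C M]

namespace InternalHom

variable (H : InternalHom C M)

/-- The coevaluation is `ψ` of an identity, so `ψ⁻¹` leaves only the morphism inserted by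
`mapRight`. This recovers the description of `𝔞⁻¹` as `ψ(id ▷ ev)`. -/
lemma psi_symm_aInv (X : C) (d e : M) :
    H.psi.symm (H.aInv X d e) = (αₗ X (H.obj d e) d).hom ≫ X ⊴ₗ H.ev d e := by
  rw [aInv, psi_symm_mapRight, coev, Equiv.symm_apply_apply]
  exact Category.id_comp _

lemma psi_symm_b (X : C) (d e : M) :
    H.psi.symm (H.b X d e) =
      (αₗ (H.obj (X ⊙ₗ d) e) X d).hom ≫ H.ev (X ⊙ₗ d) e := by
  rw [b, psi_symm_mapRight, coev, Equiv.symm_apply_apply]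
  exact Category.id_comp _

lemma psi_symm_whiskerLeft_aInv (X : C) {Y : C} {d e : M} (f : Y ⟶ H.obj d e) :
    H.psi.symm (X ◁ f ≫ H.aInv X d e) = (αₗ X Y d).hom ≫ X ⊴ₗ H.psi.symm f := by
  rw [psi_symm_nat, psi_symm_aInv, psi_symm_eq, whiskerLeft_actionHomLeft, actionHomRight_comp]
  simp only [Category.assoc, Iso.inv_hom_id_assoc]

lemma psi_symm_whiskerRight_b (X : C) {Y : C} {d e : M} (f : Y ⟶ H.obj (X ⊙ₗ d) e) :
    H.psi.symm (f ▷ X ≫ H.b X d e) = (αₗ Y X d).hom ≫ H.psi.symm f := by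
  rw [psi_symm_nat, psi_symm_b, psi_symm_eq, whiskerRight_actionHomLeft]
  simp only [Category.assoc, Iso.inv_hom_id_assoc]

end InternalHom

end InternalHomActions

/-! ### The half-braiding and the commutative algebra structure on `ρ̄(Id)` -/

section CentralAlgebra

open MonoidalLeftAction Functor.LaxMonoidal Functor.OplaxMonoidal Functor.OplaxLeftLinear

variable {V : Type u₁} [Category.{v₁} V] [MonoidalCategory V] [RightRigidCategory V]
  {C : Type u₂} [Category.{v₂} C] [MonoidalCategory C]
  {M : Type u₃} [Category.{v₃} M] [MonoidalLeftAction C M]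
  {G : V ⥤ Center C} [G.Monoidal] {H : InternalHom C M} (R : RelEnds G H)

/-- The action `ρ̄(Id) ▷ d ⟶ d` given by the counit of the adjunction `ρ ⊣ ρ̄`. -/
def counitApp (d : M) : (rhoBar R).obj (𝟙_ _) ⊙ₗ d ⟶ d :=
  ((rhoAdj R).counit.app (𝟙_ _)).nat.app d

lemma counitApp_naturality {d d' : M} (f : d ⟶ d') :
    (rhoBar R).obj (𝟙_ _) ⊴ₗ f ≫ counitApp R d' = counitApp R d ≫ f :=
  ((rhoAdj R).counit.app (𝟙_ _)).nat.naturality f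

/-- This is the `V`-module condition on the counit: the structure map of `Id` is the identity, and
that of `ρ(A)` comes from the inverse half-braiding of `G(Y)`. It is what places `A` in the relative
center. -/
lemma counitApp_comm (Y : Via G) (d : M) :
    counitApp R (Y ⊙ₗ d) =
      (swapIso ((Via.functor G).obj Y).2 ((rhoBar R).obj (𝟙_ _)) d).hom ≫ Y ⊴ₗ counitApp R d :=
  (Category.comp_id _).symm.trans (((rhoAdj R).counit.app (𝟙_ _)).comm Y d)

/-- The counit corresponds to the identity of `ρ̄(Id)`, whose wedge is `π` itself. Conditions on `π`
thereby become conditions on the action of `A`. -/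
lemma psi_symm_π (d : M) : H.psi.symm ((R (𝟙_ _)).π d) = counitApp R d := by
  have h1 := rhoBarEquiv_π R ((rhoBarEquiv R (R (𝟙_ _)).pt (𝟙_ _)).symm (𝟙 _)) d
  rw [Equiv.apply_symm_apply, Category.id_comp] at h1
  rw [h1]
  exact H.psi.symm_apply_apply _

lemma homEquiv_act_counitApp {X : C} (z : (rho M G).obj X ⟶ 𝟙_ _) (d : M) :
    (rhoAdj R).homEquiv X (𝟙_ _) z ⊵ₗ d ≫ counitApp R d = z.nat.app d := by
  have h := (rhoAdj R).homEquiv_counit X (𝟙_ _) ((rhoAdj R).homEquiv X (𝟙_ _) z)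
  rw [Equiv.symm_apply_apply] at h
  exact (congrArg (fun t => t.nat.app d) h).symm

/-- Both sides are morphisms into a value of `ρ̄`, so they may be compared through their transposes,
which are module transformations and are compared at each object of `M`. -/
lemma comp_lInv_eq_iff {X Y : C} (f : Y ⟶ X ⊗ (rhoBar R).obj (𝟙_ _))
    (z : (rho M G).obj Y ⟶ (rho M G).obj X ⊗ 𝟙_ _) :
    f ≫ lInv R X (𝟙_ _) = (rhoAdj R).homEquiv _ _ z ↔
      ∀ d : M, f ⊵ₗ d ≫ (αₗ X ((rhoBar R).obj (𝟙_ _)) d).hom ≫ X ⊴ₗ counitApp R d =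
        z.nat.app d := by
  rw [lInv, ← Adjunction.homEquiv_naturality_left, (Equiv.injective _).eq_iff]
  exact ⟨fun h d => congrArg (fun t => t.nat.app d) h, fun h => ModEnd.hom_ext _ _ h⟩

/-- Morphisms into `X ⊗ ρ̄(Id)` are determined by their action on `M`. -/
lemma tensor_rhoBar_hom_ext {X Y : C} [IsIso (lInv R X (𝟙_ _))]
    {f g : Y ⟶ X ⊗ (rhoBar R).obj (𝟙_ _)}
    (h : ∀ d : M, f ⊵ₗ d ≫ (αₗ X ((rhoBar R).obj (𝟙_ _)) d).hom ≫ X ⊴ₗ counitApp R d =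
      g ⊵ₗ d ≫ (αₗ X ((rhoBar R).obj (𝟙_ _)) d).hom ≫ X ⊴ₗ counitApp R d) : f = g := by
  rw [← cancel_mono (lInv R X (𝟙_ _))]
  obtain ⟨z, hz⟩ := ((rhoAdj R).homEquiv _ _).surjective (g ≫ lInv R X (𝟙_ _))
  have hz' := (comp_lInv_eq_iff R g z).1 hz.symm
  rw [← hz]
  exact (comp_lInv_eq_iff R f z).2 fun d => (h d).trans (hz' d)

/-- Morphisms into `ρ̄(Id)` are determined by their action on `M`. -/
lemma rhoBar_unit_hom_ext {Y : C} {f g : Y ⟶ (rhoBar R).obj (𝟙_ _)}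
    (h : ∀ d : M, f ⊵ₗ d ≫ counitApp R d = g ⊵ₗ d ≫ counitApp R d) : f = g := by
  apply ((rhoAdj R).homEquiv _ _).symm.injective
  rw [Adjunction.homEquiv_counit, Adjunction.homEquiv_counit]
  exact ModEnd.hom_ext _ _ h

/-- The condition on `f : ρ̄(Id) ⊗ X ⟶ X ⊗ ρ̄(Id)` to intertwine the two ways of letting `ρ̄(Id)`
act. -/
def ActCompatible (X : C)
    (f : (rhoBar R).obj (𝟙_ _) ⊗ X ⟶ X ⊗ (rhoBar R).obj (𝟙_ (ModEnd (Via G) M))) : Prop :=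
  ∀ d : M, f ⊵ₗ d ≫ (αₗ X ((rhoBar R).obj (𝟙_ _)) d).hom ≫ X ⊴ₗ counitApp R d =
    (αₗ ((rhoBar R).obj (𝟙_ _)) X d).hom ≫ counitApp R (X ⊙ₗ d)

/-- The equation `l⁻¹ ∘ f = ρ̄(c_X) ∘ r⁻¹` is transposed along `ρ ⊣ ρ̄`. As `c_X` has identity
components, only the two actions of `A` are left to compare. -/
lemma actCompatible_iff_comp_lInv {X : C}
    (f : (rhoBar R).obj (𝟙_ _) ⊗ X ⟶ X ⊗ (rhoBar R).obj (𝟙_ (ModEnd (Via G) M))) :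
    f ≫ lInv R X (𝟙_ _) = rInv R (𝟙_ _) X ≫ (rhoBar R).map
      ((λ_ ((rho M G).obj X)).hom ≫ (ρ_ ((rho M G).obj X)).inv) ↔ ActCompatible R X f := by
  rw [rInv, ← Adjunction.homEquiv_naturality_right, comp_lInv_eq_iff]
  refine forall_congr' fun d => ?_
  have h : ((δ (rho M G) ((rhoBar R).obj (𝟙_ _)) X ≫
      (rhoAdj R).counit.app (𝟙_ _) ▷ (rho M G).obj X) ≫
      (λ_ ((rho M G).obj X)).hom ≫ (ρ_ ((rho M G).obj X)).inv).nat.app d =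
      (αₗ ((rhoBar R).obj (𝟙_ _)) X d).hom ≫ counitApp R (X ⊙ₗ d) := by
    refine (congrArg (_ ≫ ·) (Category.comp_id _)).trans (Category.comp_id _)
  rw [h]

/-- Under `ψ⁻¹` the side containing `𝔟` becomes the action of `A` on `X ▷ d`, and the side
containing `𝔞⁻¹` becomes `σ_X` followed by the action of `A` on `d`. -/
lemma isPiCompatible_iff (σ : HalfBraiding ((rhoBar R).obj (𝟙_ (ModEnd (Via G) M)))) :
    IsPiCompatible R σ ↔ ∀ X : C, ActCompatible R X (σ.β X).hom := by
  refine forall_congr' fun X => forall_congr' fun d => ?_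
  have h1 : H.psi.symm ((R (𝟙_ _)).π (X ⊙ₗ d) ▷ X ≫ H.b X d (X ⊙ₗ d)) =
      (αₗ ((rhoBar R).obj (𝟙_ _)) X d).hom ≫ counitApp R (X ⊙ₗ d) :=
    (H.psi_symm_whiskerRight_b X ((R (𝟙_ _)).π (X ⊙ₗ d))).trans
      (congrArg (_ ≫ ·) (psi_symm_π R (X ⊙ₗ d)))
  have h2 : H.psi.symm ((σ.β X).hom ≫ X ◁ (R (𝟙_ _)).π d ≫ H.aInv X d d) =
      (σ.β X).hom ⊵ₗ d ≫ (αₗ X ((rhoBar R).obj (𝟙_ _)) d).hom ≫ X ⊴ₗ counitApp R d :=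
    (H.psi_symm_nat _ _).trans (congrArg (_ ≫ ·)
      ((H.psi_symm_whiskerLeft_aInv X ((R (𝟙_ _)).π d)).trans
        (congrArg (fun t => _ ≫ X ⊴ₗ t) (psi_symm_π R d))))
  exact H.psi.symm.injective.eq_iff.symm.trans ((Eq.congr h1 h2).trans eq_comm)

/-- The lax structure of a right adjoint makes the multiplication the transpose of two copies of the
counit. Hence a product acts by acting twice. -/
lemma algMul_act (d : M) : algMul R ⊵ₗ d ≫ counitApp R d =
    (αₗ ((rhoBar R).obj (𝟙_ _)) ((rhoBar R).obj (𝟙_ _)) d).hom ≫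
      counitApp R ((rhoBar R).obj (𝟙_ _) ⊙ₗ d) ≫ counitApp R d := by
  have h : algMul R = (rhoAdj R).homEquiv _ _ ((δ (rho M G) _ _ ≫
      ((rhoAdj R).counit.app (𝟙_ _) ⊗ₘ (rhoAdj R).counit.app (𝟙_ _))) ≫ (λ_ (𝟙_ _)).hom) :=
    ((rhoAdj R).homEquiv_naturality_right _ _).symm
  rw [h, homEquiv_act_counitApp]
  exact (Category.comp_id _).trans rfl

lemma algUnit_act (d : M) : algUnit R ⊵ₗ d ≫ counitApp R d = (λₗ[C] d).hom :=
  homEquiv_act_counitApp R (η (rho M G)) d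

/-- The algebra axioms are verified on the action: the unit acts as the identity, products act
successively, and the action is natural. -/
lemma algUnit_algMul : algUnit R ▷ (rhoBar R).obj (𝟙_ _) ≫ algMul R = (λ_ _).hom := by
  refine rhoBar_unit_hom_ext R fun d => ?_
  have h1 := algMul_act R d
  have h2 := algUnit_act R ((rhoBar R).obj (𝟙_ _) ⊙ₗ d)
  simp only [comp_actionHomLeft, whiskerRight_actionHomLeft, Category.assoc]
  rw [h1, Iso.inv_hom_id_assoc, reassoc_of% h2, leftUnitor_actionHom, Category.assoc]

lemma algMul_algUnit : (rhoBar R).obj (𝟙_ _) ◁ algUnit R ≫ algMul R = (ρ_ _).hom := by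
  refine rhoBar_unit_hom_ext R fun d => ?_
  have h1 := algMul_act R d
  have h2 := congrArg ((rhoBar R).obj (𝟙_ _) ⊴ₗ ·) (algUnit_act R d)
  have h3 := counitApp_naturality R (counitApp R d)
  simp only [actionHomRight_comp] at h2
  simp only [comp_actionHomLeft, whiskerLeft_actionHomLeft, Category.assoc]
  rw [h1, Iso.inv_hom_id_assoc, ← h3, reassoc_of% h2, rightUnitor_actionHom, Category.assoc]

lemma algMul_assoc : algMul R ▷ (rhoBar R).obj (𝟙_ _) ≫ algMul R =
    (α_ _ _ _).hom ≫ (rhoBar R).obj (𝟙_ _) ◁ algMul R ≫ algMul R := by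
  refine rhoBar_unit_hom_ext R fun d => ?_
  have h1 := algMul_act R d
  have h2 := congrArg ((rhoBar R).obj (𝟙_ _) ⊴ₗ ·) h1
  have h3 := counitApp_naturality R (counitApp R d)
  have h4 := algMul_act R ((rhoBar R).obj (𝟙_ _) ⊙ₗ d)
  have h5 := counitApp_naturality R (counitApp R ((rhoBar R).obj (𝟙_ _) ⊙ₗ d))
  simp only [actionHomRight_comp] at h2
  simp only [comp_actionHomLeft, whiskerLeft_actionHomLeft, whiskerRight_actionHomLeft,
    associator_hom_act, Category.assoc]
  rw [h1, Iso.inv_hom_id_assoc, Iso.inv_hom_id_assoc, reassoc_of% h4, ← h3, reassoc_of% h2,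
    actionHomRight_inv_hom_assoc, h3, reassoc_of% h5]

/-- By naturality, acting twice on `d` is the action on `A ▷ d` followed by that on `d`, and equally
`A ▷ act_d` followed by that on `d`. Compatibility for `X = A` says that precomposing with `σ_A`
turns the second first step into the first one, so the multiplication absorbs `σ_A`. -/
lemma halfBraiding_algMul {σ : HalfBraiding ((rhoBar R).obj (𝟙_ (ModEnd (Via G) M)))}
    (hσ : ∀ X : C, ActCompatible R X (σ.β X).hom) :
    (σ.β ((rhoBar R).obj (𝟙_ _))).hom ≫ algMul R = algMul R := by
  refine rhoBar_unit_hom_ext R fun d => ?_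
  have h1 := algMul_act R d
  have h2 := hσ ((rhoBar R).obj (𝟙_ _)) d
  have h3 := counitApp_naturality R (counitApp R d)
  simp only [comp_actionHomLeft, Category.assoc]
  rw [h1, ← h3, reassoc_of% h2, h3]

/-- `A` is moved past `X ⊗ Y` in two stages, using compatibility of `f` at `Y ▷ d` and of `g` at
`d`. Combined with uniqueness this yields the monoidality of the half-braiding. -/
lemma ActCompatible.tensor {X Y : C}
    {f : (rhoBar R).obj (𝟙_ _) ⊗ X ⟶ X ⊗ (rhoBar R).obj (𝟙_ (ModEnd (Via G) M))}
    {g : (rhoBar R).obj (𝟙_ _) ⊗ Y ⟶ Y ⊗ (rhoBar R).obj (𝟙_ (ModEnd (Via G) M))}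
    (hf : ActCompatible R X f) (hg : ActCompatible R Y g) :
    ActCompatible R (X ⊗ Y) ((α_ _ _ _).inv ≫ f ▷ Y ≫ (α_ _ _ _).hom ≫ X ◁ g ≫
      (α_ _ _ _).inv) := by
  intro d
  have h1 := hf (Y ⊙ₗ d)
  have h2 := congrArg (X ⊴ₗ ·) (hg d)
  have h3 := counitApp_naturality R (αₗ X Y d).hom
  simp only [actionHomRight_comp] at h2
  simp only [comp_actionHomLeft, associator_inv_act, associator_hom_act, whiskerLeft_actionHomLeft,
    whiskerRight_actionHomLeft, tensor_actionHomRight, Category.assoc, Iso.inv_hom_id_assoc]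
  rw [reassoc_of% h2, actionHomRight_inv_hom_assoc, reassoc_of% h1, Iso.inv_hom_id_assoc,
    reassoc_of% h3, Iso.hom_inv_id, Category.comp_id]

variable [∀ X : C, IsIso (lInv R X (𝟙_ (ModEnd (Via G) M)))]

/-- The condition prescribes how the morphism acts on `M`, and this action detects morphisms into `X
⊗ A`. -/
lemma ActCompatible.unique {X : C}
    {f g : (rhoBar R).obj (𝟙_ _) ⊗ X ⟶ X ⊗ (rhoBar R).obj (𝟙_ (ModEnd (Via G) M))}
    (hf : ActCompatible R X f) (hg : ActCompatible R X g) : f = g :=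
  tensor_rhoBar_hom_ext R fun d => (hf d).trans (hg d).symm

/-- Both composites act as the action of `A` on `X ▷ d` followed by `t ▷ d`, by naturality of the
action. -/
lemma ActCompatible.naturality {X Y : C} (t : X ⟶ Y)
    {f : (rhoBar R).obj (𝟙_ _) ⊗ X ⟶ X ⊗ (rhoBar R).obj (𝟙_ (ModEnd (Via G) M))}
    {g : (rhoBar R).obj (𝟙_ _) ⊗ Y ⟶ Y ⊗ (rhoBar R).obj (𝟙_ (ModEnd (Via G) M))}
    (hf : ActCompatible R X f) (hg : ActCompatible R Y g) :
    (rhoBar R).obj (𝟙_ _) ◁ t ≫ g = f ≫ t ▷ (rhoBar R).obj (𝟙_ _) := by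
  refine tensor_rhoBar_hom_ext R fun d => ?_
  have h1 := hf d
  have h2 := hg d
  have h3 := counitApp_naturality R (t ⊵ₗ d)
  simp only [comp_actionHomLeft, whiskerLeft_actionHomLeft, whiskerRight_actionHomLeft,
    Category.assoc, Iso.inv_hom_id_assoc]
  rw [h2, Iso.inv_hom_id_assoc, h3, ← reassoc_of% h1, action_exchange]

section

variable {R} {σ : HalfBraiding ((rhoBar R).obj (𝟙_ (ModEnd (Via G) M)))}

lemma HalfBraiding.eq_of_actCompatible (hσ : ∀ X : C, ActCompatible R X (σ.β X).hom)
    {σ' : HalfBraiding ((rhoBar R).obj (𝟙_ (ModEnd (Via G) M)))}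
    (hσ' : ∀ X : C, ActCompatible R X (σ'.β X).hom) : σ' = σ := by
  have h : σ'.β = σ.β := funext fun X => Iso.ext ((hσ' X).unique R (hσ X))
  cases σ
  cases σ'
  cases h
  rfl

/-- `counitApp_comm` says that the inverse half-braiding of `G(Y)` at `A` is compatible with the
action. Uniqueness identifies it with `σ_{G(Y)}`, so the double braiding is trivial. -/
lemma relativeCenter_centralObj (hσ : ∀ X : C, ActCompatible R X (σ.β X).hom) :
    relativeCenter G (centralObj R σ) := by
  intro Y
  have h : (σ.β (G.obj Y).1).hom = ((G.obj Y).2.β ((rhoBar R).obj (𝟙_ _))).inv := by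
    refine (hσ _).unique R fun d => ?_
    have h1 : counitApp R ((G.obj Y).1 ⊙ₗ d) = ((αₗ ((rhoBar R).obj (𝟙_ _)) (G.obj Y).1 d).inv ≫
        ((G.obj Y).2.β ((rhoBar R).obj (𝟙_ _))).inv ⊵ₗ d ≫
          (αₗ (G.obj Y).1 ((rhoBar R).obj (𝟙_ _)) d).hom) ≫
        (G.obj Y).1 ⊴ₗ counitApp R d := counitApp_comm R (G := G) Y d
    simp only [h1, Category.assoc, Iso.hom_inv_id_assoc]
  apply Center.ext
  change (σ.β (G.obj Y).1).hom ≫ ((G.obj Y).2.β ((rhoBar R).obj (𝟙_ _))).hom = 𝟙 _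
  rw [h, Iso.inv_hom_id]

/-- The multiplication is thereby a morphism of the center. Both sides let `A` act twice on `U ▷ d`.
-/
lemma algMul_halfBraiding (hσ : ∀ X : C, ActCompatible R X (σ.β X).hom) (U : C) :
    algMul R ▷ U ≫ (σ.β U).hom = ((α_ _ _ _).hom ≫ (rhoBar R).obj (𝟙_ _) ◁ (σ.β U).hom ≫
      (α_ _ _ _).inv ≫ (σ.β U).hom ▷ (rhoBar R).obj (𝟙_ _) ≫ (α_ _ _ _).hom) ≫
        U ◁ algMul R := by
  refine tensor_rhoBar_hom_ext R fun d => ?_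
  have h1 := algMul_act R (U ⊙ₗ d)
  have h2 := congrArg (U ⊴ₗ ·) (algMul_act R d)
  have h3 := hσ U d
  have h4 := congrArg ((rhoBar R).obj (𝟙_ _) ⊴ₗ ·) h3
  have h5 := hσ U ((rhoBar R).obj (𝟙_ _) ⊙ₗ d)
  have h6 := counitApp_naturality R (U ⊴ₗ counitApp R d)
  have h7 := counitApp_naturality R (counitApp R (U ⊙ₗ d))
  simp only [actionHomRight_comp] at h2 h4
  simp only [comp_actionHomLeft, whiskerLeft_actionHomLeft, whiskerRight_actionHomLeft,
    associator_hom_act, associator_inv_act, Category.assoc, Iso.inv_hom_id_assoc]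
  rw [h2, h3, Iso.inv_hom_id_assoc, h1, actionHomRight_inv_hom_assoc, reassoc_of% h5,
    Iso.inv_hom_id_assoc, ← h6, reassoc_of% h4, actionHomRight_inv_hom_assoc, h7]

lemma algUnit_halfBraiding (hσ : ∀ X : C, ActCompatible R X (σ.β X).hom) (U : C) :
    algUnit R ▷ U ≫ (σ.β U).hom = ((λ_ U).hom ≫ (ρ_ U).inv) ≫ U ◁ algUnit R := by
  refine tensor_rhoBar_hom_ext R fun d => ?_
  have h1 := algUnit_act R (U ⊙ₗ d)
  have h2 := congrArg (U ⊴ₗ ·) (algUnit_act R d)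
  have h3 := hσ U d
  have h4 := leftUnitor_actionHom U d
  have h5 := rightUnitor_actionHom U d
  simp only [actionHomRight_comp] at h2
  simp only [comp_actionHomLeft, whiskerLeft_actionHomLeft, whiskerRight_actionHomLeft,
    Category.assoc, Iso.inv_hom_id_assoc]
  rw [h2, h3, Iso.inv_hom_id_assoc, h1, ← h5, inv_hom_actionHomLeft, Category.comp_id, h4]

/-- The multiplication of `ρ̄(Id)` as a morphism of the Drinfeld center. -/
def centralMul (hσ : ∀ X : C, ActCompatible R X (σ.β X).hom) :
    centralObj R σ ⊗ centralObj R σ ⟶ centralObj R σ :=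
  ⟨algMul R, fun U => (algMul_halfBraiding hσ U).trans (congrArg (· ≫ _) (by
    rw [Center.tensor_β]; rfl))⟩

/-- The unit of `ρ̄(Id)` as a morphism of the Drinfeld center. -/
def centralUnit (hσ : ∀ X : C, ActCompatible R X (σ.β X).hom) :
    𝟙_ (Center C) ⟶ centralObj R σ :=
  ⟨algUnit R, algUnit_halfBraiding hσ⟩

/-- The algebra structure of `ρ̄(Id)` in the relative center. -/
@[reducible]
def centralMonObj [BraidedCategory V] (hσ : ∀ X : C, ActCompatible R X (σ.β X).hom) :
    MonObj (⟨centralObj R σ, relativeCenter_centralObj hσ⟩ :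
      (relativeCenter G).FullSubcategory) where
  one := ObjectProperty.homMk (centralUnit hσ)
  mul := ObjectProperty.homMk (centralMul hσ)
  one_mul := ObjectProperty.hom_ext _ (Center.ext _ _ (algUnit_algMul R))
  mul_one := ObjectProperty.hom_ext _ (Center.ext _ _ (algMul_algUnit R))
  mul_assoc := ObjectProperty.hom_ext _ (Center.ext _ _ (algMul_assoc R))

lemma isCommMonObj_centralObj [BraidedCategory V]
    (hσ : ∀ X : C, ActCompatible R X (σ.β X).hom) :
    letI := centralMonObj hσ
    IsCommMonObj (⟨centralObj R σ, relativeCenter_centralObj hσ⟩ :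
      (relativeCenter G).FullSubcategory) :=
  letI := centralMonObj hσ
  ⟨ObjectProperty.hom_ext _ (Center.ext _ _ (halfBraiding_algMul R hσ))⟩

end

variable [∀ X : C, IsIso (rInv R (𝟙_ (ModEnd (Via G) M)) X)]

/-- The isomorphism `σ_X = l ∘ ρ̄(c_X) ∘ r⁻¹ : ρ̄(Id) ⊗ X ≅ X ⊗ ρ̄(Id)`. -/
def centralIso (X : C) :
    (rhoBar R).obj (𝟙_ (ModEnd (Via G) M)) ⊗ X ≅ X ⊗ (rhoBar R).obj (𝟙_ _) :=
  asIso (rInv R (𝟙_ _) X) ≪≫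
    (rhoBar R).mapIso (λ_ ((rho M G).obj X) ≪≫ (ρ_ ((rho M G).obj X)).symm) ≪≫
    (asIso (lInv R X (𝟙_ _))).symm

lemma centralIso_comp_lInv (X : C) : (centralIso R X).hom ≫ lInv R X (𝟙_ _) =
    rInv R (𝟙_ _) X ≫ (rhoBar R).map
      ((λ_ ((rho M G).obj X)).hom ≫ (ρ_ ((rho M G).obj X)).inv) := by
  simp [centralIso]

lemma actCompatible_centralIso (X : C) : ActCompatible R X (centralIso R X).hom :=
  (actCompatible_iff_comp_lInv R _).1 (centralIso_comp_lInv R X)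

/-- The half-braiding of `ρ̄(Id)`. -/
def centralHalfBraiding : HalfBraiding ((rhoBar R).obj (𝟙_ (ModEnd (Via G) M))) where
  β X := centralIso R X
  monoidal X Y := (actCompatible_centralIso R (X ⊗ Y)).unique R
    ((actCompatible_centralIso R X).tensor R (actCompatible_centralIso R Y))
  naturality t :=
    (actCompatible_centralIso R _).naturality R t (actCompatible_centralIso R _)

end CentralAlgebra

end RelativeCenter

namespace RelativeCenter

open MonoidalLeftAction

/-! ### A criterion for an integral element to be a scalar -/

section

open Polynomial

/-- An integral element `z` of a `k`-algebra, `k` algebraically closed, is a scalar if the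
polynomials in `z` contain no nonzero element of square zero and no nontrivial idempotent. -/
lemma exists_eq_algebraMap_of_aeval {k : Type w} [Field k] [IsAlgClosed k] {A : Type v₁} [Ring A]
    [Nontrivial A] [Algebra k A] {z : A} (hz : IsIntegral k z)
    (hnil : ∀ p : k[X], aeval z p * aeval z p = 0 → aeval z p = 0)
    (hidem : ∀ p : k[X], aeval z p * aeval z p = aeval z p → aeval z p = 0 ∨ aeval z p = 1) :
    ∃ c : k, z = algebraMap k A c := by
  -- Split a linear factor off the minimal polynomial; the cofactor `q` has smaller degree and does
  -- not kill `z`. Whether `c` is also a root of `q` decides which hypothesis is used.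
  obtain ⟨c, hc⟩ := IsAlgClosed.exists_root (minpoly k z) (minpoly.degree_pos hz).ne'
  obtain ⟨q, hq⟩ := dvd_iff_isRoot.2 hc
  have hm : aeval z ((X - C c) * q) = 0 := hq ▸ minpoly.aeval k z
  have hq0 : q ≠ 0 := fun h => minpoly.ne_zero hz (by rw [hq, h, mul_zero])
  have hqz : aeval z q ≠ 0 := fun h => by
    have h1 := minpoly.degree_le_of_ne_zero k z hq0 h
    rw [hq, degree_mul, degree_X_sub_C, degree_eq_natDegree hq0] at h1
    norm_cast at h1
    omega
  refine ⟨c, ?_⟩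
  by_cases hdvd : (X - C c) ∣ q
  · obtain ⟨r, hr⟩ := hdvd
    -- For a multiple root, `q ^ 2` is a multiple of the minimal polynomial.
    refine absurd (hnil q ?_) hqz
    have h1 : q * q = ((X - C c) * q) * r := by
      nth_rewrite 1 [hr]
      ring
    rw [← map_mul, h1, map_mul, hm, zero_mul]
  · obtain ⟨a, b, hab⟩ := ((irreducible_X_sub_C c).coprime_iff_not_dvd).2 hdvd
    -- By the Bézout relation, `b * q` is idempotent modulo the minimal polynomial. If it vanishes
    -- at `z`, then so does `q`; if it is `1` at `z`, then `X - C c` vanishes at `z`.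
    have h1 : aeval z (b * q) * aeval z (b * q) = aeval z (b * q) := by
      have h2 : b * q = b * q * (b * q) + (X - C c) * q * (a * b) := by
        calc b * q = b * q * (a * (X - C c) + b * q) := by rw [hab, mul_one]
          _ = _ := by ring
      conv_rhs => rw [h2, map_add, map_mul _ ((X - C c) * q), hm, zero_mul, add_zero, map_mul]
    rcases hidem _ h1 with h2 | h2
    · refine absurd ?_ hqz
      have h3 : q = (X - C c) * q * a + q * (b * q) := by
        calc q = q * (a * (X - C c) + b * q) := by rw [hab, mul_one]
          _ = _ := by ring
      rw [h3, map_add, map_mul, hm, zero_mul, map_mul, h2, mul_zero, add_zero]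
    · have h3 : aeval z (X - C c) = 0 := by
        have h4 : (X - C c) * (b * q) = (X - C c) * q * b := by ring
        rw [← mul_one (aeval z (X - C c)), ← h2, ← map_mul, h4, map_mul, hm, zero_mul]
      simpa [sub_eq_zero] using h3

end

/-! ### Module endomorphisms of the identity functor -/

section ModuleCenter

variable (k : Type w) [Field k]
  (C : Type u₂) [Category.{v₂} C] [Abelian C] [Linear k C] [MonoidalCategory C]
  {M : Type u₃} [Category.{v₃} M] [Abelian M] [Linear k M] [MonoidalLeftAction C M]

/-- An endomorphism of the identity functor is a module transformation. -/
def IsModuleCentral (z : CatCenter M) : Prop :=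
  ∀ (X : C) (d : M), z.app (X ⊙ₗ d) = X ⊴ₗ z.app d

variable (M) in
/-- The algebra of module endomorphisms of the identity functor. -/
def moduleCenter [IsModuleCategory k C M] : Subalgebra k (CatCenter M) where
  carrier := {z | IsModuleCentral C z}
  mul_mem' {a b} ha hb X d := by
    rw [CatCenter.mul_app, CatCenter.mul_app, actionHomRight_comp, ha, hb]
  add_mem' {a b} ha hb X d := by
    have := IsModuleCategory.additive_left k (M := M) X
    rw [CatCenter.app_add, CatCenter.app_add, ha, hb]
    exact ((actionLeft M X).map_add).symm
  algebraMap_mem' c X d := by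
    have := IsModuleCategory.linear_left (k := k) (M := M) X
    have h : ∀ e : M, (algebraMap k (CatCenter M) c).app e = c • 𝟙 e := fun e => rfl
    rw [h, h]
    exact (((Functor.Linear.map_smul (F := actionLeft M X) (𝟙 d) c)).trans
      (congrArg (c • ·) ((actionLeft M X).map_id d))).symm

variable (M) in
/-- The center of a finite category is finite-dimensional. -/
lemma finite_catCenter [IsFiniteCategory k M] : Module.Finite k (CatCenter M) := by
  obtain ⟨D, -, hD⟩ := exists_projective_separator k M
  have := IsFiniteCategory.finite_hom (k := k) D D
  let φ : CatCenter M →ₗ[k] (D ⟶ D) :=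
    { toFun := fun z => z.app D
      map_add' := fun _ _ => rfl
      map_smul' := fun _ _ => rfl }
  refine Module.Finite.of_injective φ ((injective_iff_map_eq_zero φ).2 fun z hz => ?_)
  refine CatCenter.ext _ _ fun d => hD _ fun h => ?_
  have hz' : z.app D = 0 := hz
  rw [z.naturality, hz', zero_comp]

variable {C}

/-- On an exact module category, a module endomorphism of the identity functor with square zero
is zero. -/
lemma eq_zero_of_square_zero [IsFiniteCategory k C] [IsModuleCategory k C M]
    (hexact : IsExactModule C M) {z : CatCenter M} (hz : IsModuleCentral C z)
    (h : z * z = 0) : z = 0 := by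
  have hsq : ∀ d, z.app d ≫ z.app d = 0 := fun d => by
    rw [← CatCenter.mul_app, h]
    rfl
  obtain ⟨P, hP, p, hp⟩ : ∃ (P : C) (_ : Projective P) (p : P ⟶ 𝟙_ C), Epi p := by
    have := IsFiniteCategory.enoughProjectives (k := k) (C := C)
    exact ⟨_, inferInstance, Projective.π (𝟙_ C), inferInstance⟩
  have hadd := IsModuleCategory.additive_left k (M := M) P
  have hrex := IsModuleCategory.rex_left k (M := M) P
  refine CatCenter.ext _ _ fun d => ?_
  have hrex' := IsModuleCategory.rex_right k (C := C) d
  have hpd : Epi (p ⊵ₗ d) := inferInstanceAs (Epi ((actionRight C d).map p))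
  -- It suffices to show that `P ▷ z_d` vanishes.
  suffices hPz : z.app (P ⊙ₗ d) = 0 by
    have h1 : p ⊵ₗ d ≫ z.app (𝟙_ C ⊙ₗ d) = 0 := by rw [z.naturality, hPz, zero_comp]
    have h2 : z.app (𝟙_ C ⊙ₗ d) = 0 := zero_of_epi_comp _ h1
    have h3 := z.naturality (λₗ[C] d).hom
    rw [h2, zero_comp] at h3
    exact zero_of_epi_comp _ h3
  -- `z` vanishes on both `K` and `d / K`: on `K` by naturality, and on `d / K` because `z ^ 2 = 0`
  -- makes `z_d` land in `K`.
  let K := kernel (z.app d)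
  let ι : K ⟶ d := kernel.ι (z.app d)
  let q : d ⟶ cokernel ι := cokernel.π ι
  have hK : z.app K = 0 := by
    rw [← cancel_mono ι, ← z.naturality, kernel.condition, zero_comp]
  have hQ : z.app (cokernel ι) = 0 := by
    rw [← cancel_epi q, z.naturality, comp_zero]
    obtain ⟨t, ht⟩ : ∃ t, t ≫ ι = z.app d := ⟨kernel.lift _ _ (hsq d), kernel.lift_ι _ _ _⟩
    rw [← ht, Category.assoc, cokernel.condition, comp_zero]
  -- Exactness makes `P ▷ (d / K)` projective, so `P ▷ d` splits into `P ▷ K` and `P ▷ (d / K)`. By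
  -- centrality `z` vanishes on both pieces, hence on `P ▷ d`.
  have hPQ := hexact P hP (cokernel ι)
  have hPq : Epi (P ⊴ₗ q) := inferInstanceAs (Epi ((actionLeft M P).map q))
  let s := Projective.factorThru (𝟙 (P ⊙ₗ cokernel ι)) (P ⊴ₗ q)
  have hs : s ≫ P ⊴ₗ q = 𝟙 _ := Projective.factorThru_comp _ _
  have hlex := IsModuleCategory.lex_left k (M := M) P
  have hq := Abelian.monoIsKernelOfCokernel _ (cokernelIsCokernel ι)
  -- The complementary projection factors through the kernel of `P ▷ q`, which is `P ▷ K` because `P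
  -- ▷ -` is left exact.
  obtain ⟨t, ht⟩ : ∃ t, t ≫ P ⊴ₗ ι = 𝟙 _ - P ⊴ₗ q ≫ s := by
    have h0 : (𝟙 (P ⊙ₗ d) - P ⊴ₗ q ≫ s) ≫ (actionLeft M P).map q = 0 := by
      change (𝟙 (P ⊙ₗ d) - P ⊴ₗ q ≫ s) ≫ P ⊴ₗ q = 0
      rw [Preadditive.sub_comp, Category.assoc, hs, Category.id_comp, Category.comp_id, sub_self]
    exact ⟨_, (KernelFork.mapIsLimit _ hq (actionLeft M P)).fac (KernelFork.ofι _ h0)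
      WalkingParallelPair.zero⟩
  have h1 : z.app (P ⊙ₗ d) = t ≫ P ⊴ₗ ι ≫ z.app (P ⊙ₗ d) + P ⊴ₗ q ≫ s ≫ z.app (P ⊙ₗ d) := by
    rw [← Category.assoc, ht, Preadditive.sub_comp, Category.id_comp, Category.assoc,
      sub_add_cancel]
  have hz0 : ∀ e : M, z.app e = 0 → z.app (P ⊙ₗ e) = 0 := fun e he => by
    rw [hz, he]
    exact (actionLeft M P).map_zero _ _
  rw [h1, z.naturality s, z.naturality (P ⊴ₗ ι), hz0 _ hK, hz0 _ hQ]
  simp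

end ModuleCenter

end RelativeCenter

namespace RelativeCenter

open MonoidalLeftAction ObjectProperty
open scoped ZeroObject

/-! ### The module subcategory cut out by a central idempotent -/

section FullSubcategoryAction

variable {C : Type u₂} [Category.{v₂} C] [MonoidalCategory C]
  {M : Type u₃} [Category.{v₃} M] [MonoidalLeftAction C M]

/-- The action on a full subcategory which is stable under the action. -/
@[reducible]
def fullSubcategoryAction (P : ObjectProperty M) (hP : ∀ (X : C) (d : M), P d → P (X ⊙ₗ d)) :
    MonoidalLeftAction C P.FullSubcategory where
  actionObj X d := ⟨X ⊙ₗ d.obj, hP X d.obj d.property⟩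
  actionHomLeft f d := homMk (f ⊵ₗ d.obj)
  actionHomRight X _ _ f := homMk (X ⊴ₗ f.hom)
  actionHom f g := homMk (f ⊙ₗₘ g.hom)
  actionAssocIso X Y d := P.isoMk (αₗ X Y d.obj)
  actionUnitIso d := P.isoMk (λₗ d.obj)
  actionHom_def f g := by ext; exact actionHom_def f g.hom
  actionHomRight_id X d := by ext; exact actionHomRight_id X d.obj
  id_actionHomLeft X d := by ext; exact id_actionHomLeft X d.obj
  actionHom_comp f₁ f₂ g₁ g₂ := by ext; exact actionHom_comp f₁ f₂ g₁.hom g₂.hom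
  actionAssocIso_hom_naturality f g h := by
    ext; exact actionAssocIso_hom_naturality f g h.hom
  actionUnitIso_hom_naturality f := by ext; exact actionUnitIso_hom_naturality f.hom
  whiskerLeft_actionHomLeft X _ _ f d := by ext; exact whiskerLeft_actionHomLeft X f d.obj
  whiskerRight_actionHomLeft X f d := by ext; exact whiskerRight_actionHomLeft X f d.obj
  associator_actionHom X Y Z d := by ext; exact associator_actionHom X Y Z d.obj
  leftUnitor_actionHom X d := by ext; exact leftUnitor_actionHom X d.obj
  rightUnitor_actionHom X d := by ext; exact rightUnitor_actionHom X d.obj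

end FullSubcategoryAction

section Summand

variable {M : Type u₃} [Category.{v₃} M]

/-- The objects on which a given endomorphism of the identity functor is the identity. -/
def fixedBy (z : CatCenter M) : ObjectProperty M := fun d => z.app d = 𝟙 d

lemma fixedBy.app {z : CatCenter M} (d : (fixedBy z).FullSubcategory) : z.app d.obj = 𝟙 d.obj :=
  d.property

/-- Naturality carries the equation `z = 1` along monomorphisms, epimorphisms and (co)limit cones.
These closure properties give the full subcategory its abelian structure and make its inclusion
exact. -/
instance (z : CatCenter M) : (fixedBy z).IsClosedUnderSubobjects where
  prop_of_mono {X Y} f _ hY := by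
    have hY' : z.app Y = 𝟙 Y := hY
    change z.app X = 𝟙 X
    rw [← cancel_mono f, ← z.naturality, hY', Category.comp_id, Category.id_comp]

instance (z : CatCenter M) : (fixedBy z).IsClosedUnderQuotients where
  prop_of_epi {X Y} f _ hX := by
    have hX' : z.app X = 𝟙 X := hX
    change z.app Y = 𝟙 Y
    rw [← cancel_epi f, z.naturality, hX', Category.comp_id, Category.id_comp]

instance (z : CatCenter M) (J : Type u₁) [Category.{v₁} J] :
    (fixedBy z).IsClosedUnderLimitsOfShape J where
  limitsOfShape_le := by
    rintro X ⟨h⟩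
    refine h.isLimit.hom_ext fun j => ?_
    have h1 : z.app (h.diag.obj j) = 𝟙 _ := h.prop_diag_obj j
    have h2 := z.naturality (h.π.app j)
    rw [h1] at h2
    exact h2.symm.trans ((Category.comp_id _).trans (Category.id_comp _).symm)

instance (z : CatCenter M) (J : Type u₁) [Category.{v₁} J] :
    (fixedBy z).IsClosedUnderColimitsOfShape J where
  colimitsOfShape_le := by
    rintro X ⟨h⟩
    refine h.isColimit.hom_ext fun j => ?_
    have h1 : z.app (h.diag.obj j) = 𝟙 _ := h.prop_diag_obj j
    have h2 := z.naturality (h.ι.app j)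
    rw [h1] at h2
    exact h2.trans ((Category.id_comp _).trans (Category.comp_id _).symm)

instance (z : CatCenter M) : (fixedBy z).IsClosedUnderFiniteProducts where
  isClosedUnderLimitsOfShape _ _ := inferInstance

instance [HasZeroObject M] (z : CatCenter M) : (fixedBy z).ContainsZero where
  exists_zero := by
    obtain ⟨Z, hZ⟩ := HasZeroObject.zero (C := M)
    exact ⟨Z, hZ, hZ.eq_of_src _ _⟩

end Summand

section FiniteSummand

variable {k : Type w} [Field k] {M : Type u₃} [Category.{v₃} M] [Abelian M] [Linear k M]

instance (z : CatCenter M) : Abelian (fixedBy z).FullSubcategory := inferInstance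

instance (z : CatCenter M) : PreservesFiniteLimits (fixedBy z).ι :=
  ⟨fun _ _ _ => inferInstance⟩

instance (z : CatCenter M) : PreservesFiniteColimits (fixedBy z).ι :=
  ⟨fun _ _ _ => inferInstance⟩

lemma fixedBy.isZero {z : CatCenter M} {d : (fixedBy z).FullSubcategory} (hd : IsZero d) :
    IsZero d.obj :=
  (IsZero.iff_id_eq_zero _).2 (congrArg InducedCategory.Hom.hom ((IsZero.iff_id_eq_zero _).1 hd))

/-- The idempotent `z_d` splits in an abelian category, and naturality along `i` shows that `z` is
the identity on its image. -/
lemma exists_splitting {z : CatCenter M} (hz : z * z = z) (d : M) :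
    ∃ (e : (fixedBy z).FullSubcategory) (i : e.obj ⟶ d) (s : d ⟶ e.obj),
      i ≫ s = 𝟙 e.obj ∧ s ≫ i = z.app d := by
  obtain ⟨Y, i, s, h1, h2⟩ := IsIdempotentComplete.idempotents_split d (z.app d)
    (by rw [← CatCenter.mul_app, hz])
  refine ⟨⟨Y, ?_⟩, i, s, h1, h2⟩
  change z.app Y = 𝟙 Y
  have h3 := z.naturality i
  calc z.app Y = z.app Y ≫ i ≫ s := by rw [h1, Category.comp_id]
    _ = i ≫ (s ≫ i) ≫ s := by rw [← Category.assoc, ← h3, h2, Category.assoc]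
    _ = 𝟙 Y := by rw [Category.assoc, h1, Category.comp_id, h1]

/-- The order embedding of the subobjects of an object of a full subcategory into the subobjects in
the ambient category. -/
def subobjectEmbedding (P : ObjectProperty M) [P.ι.PreservesMonomorphisms]
    (X : P.FullSubcategory) : Subobject X ↪o Subobject X.obj :=
  OrderEmbedding.ofMapLEIff (fun s => Subobject.mk (P.ι.map s.arrow)) fun s t => by
    constructor
    · intro h
      let f := Subobject.ofMkLEMk _ _ h
      have hf : f ≫ P.ι.map t.arrow = P.ι.map s.arrow := Subobject.ofMkLEMk_comp h
      exact Subobject.le_of_comm (homMk f) (by ext; exact hf)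
    · intro h
      exact Subobject.mk_le_mk_of_comm (P.ι.map (Subobject.ofLE s t h))
        (by rw [← Functor.map_comp, Subobject.ofLE_arrow])

lemma isFiniteCategory_fixedBy [IsFiniteCategory k M] {z : CatCenter M} (hz : z * z = z) :
    IsFiniteCategory k (fixedBy z).FullSubcategory where
  finite_hom X Y := by
    have : Module.Finite k ((fixedBy z).ι.obj X ⟶ (fixedBy z).ι.obj Y) :=
      IsFiniteCategory.finite_hom X.obj Y.obj
    exact Module.Finite.of_injective ((fixedBy z).ι.mapLinearMap k) (fixedBy z).ι.map_injective
  noetherian X := by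
    have := IsFiniteCategory.noetherian (k := k) X.obj
    exact (ObjectProperty.is_iff _ _).2 (subobjectEmbedding (fixedBy z) X).wellFoundedGT
  artinian X := by
    have := IsFiniteCategory.artinian (k := k) X.obj
    exact (ObjectProperty.is_iff _ _).2 (subobjectEmbedding (fixedBy z) X).wellFoundedLT
  enoughProjectives := by
    have := IsFiniteCategory.enoughProjectives (k := k) (C := M)
    refine ⟨fun X => ?_⟩
    -- The `z`-summand of a projective object over `X` still maps onto `X`, since `z` is the
    -- identity on `X`.
    obtain ⟨e, i, s, h1, h2⟩ := exists_splitting hz (Projective.over X.obj)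
    have hproj : Projective e.obj := Retract.projective ⟨i, s, h1⟩
    have hepi : Epi (s ≫ i ≫ Projective.π X.obj) := by
      rw [← Category.assoc, h2, ← z.naturality, fixedBy.app X, Category.comp_id]
      infer_instance
    have hepi' : Epi (i ≫ Projective.π X.obj) := epi_of_epi s _
    exact ⟨{
      p := e
      projective := ⟨fun f g _ => by
        have : Epi ((fixedBy z).ι.map g) := inferInstance
        exact ⟨homMk (Projective.factorThru f.hom ((fixedBy z).ι.map g)), by
          ext; exact Projective.factorThru_comp _ _⟩⟩
      f := homMk (i ≫ Projective.π X.obj)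
      epi := (fixedBy z).ι.epi_of_epi_map hepi' }⟩
  finite_simples := by
    obtain ⟨n, S, hS⟩ := IsFiniteCategory.finite_simples (k := k) (C := M)
    classical
    refine ⟨n, fun i => if h : ∃ Y : (fixedBy z).FullSubcategory, Nonempty (Y.obj ≅ S i) then
      h.choose else 0, fun X hX => ?_⟩
    have hX' : Simple X.obj := by
      refine ⟨fun {Y} f hf => ?_⟩
      let Y' : (fixedBy z).FullSubcategory := ⟨Y, (fixedBy z).prop_of_mono f X.property⟩
      let f' : Y' ⟶ X := homMk f
      have : Mono f' := (fixedBy z).ι.mono_of_mono_map hf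
      have h1 := Simple.mono_isIso_iff_nonzero f'
      rw [← isIso_hom_iff] at h1
      refine h1.trans (not_congr ⟨fun h => congrArg InducedCategory.Hom.hom h,
        fun h => ObjectProperty.hom_ext _ h⟩)
    obtain ⟨i, ⟨e⟩⟩ := hS X.obj hX'
    have h : ∃ Y : (fixedBy z).FullSubcategory, Nonempty (Y.obj ≅ S i) := ⟨X, ⟨e⟩⟩
    refine ⟨i, ⟨?_⟩⟩
    simp only [dif_pos h]
    exact (fixedBy z).isoMk (e ≪≫ h.choose_spec.some.symm)

end FiniteSummand

section ModuleSummand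

variable {C : Type u₂} [Category.{v₂} C] [MonoidalCategory C]
  {M : Type u₃} [Category.{v₃} M] [MonoidalLeftAction C M]

lemma IsModuleCentral.fixedBy_actionObj {z : CatCenter M} (hc : IsModuleCentral C z) (X : C)
    (d : M) (hd : fixedBy z d) : fixedBy z (X ⊙ₗ d) := by
  have hd' : z.app d = 𝟙 d := hd
  change z.app (X ⊙ₗ d) = 𝟙 (X ⊙ₗ d)
  rw [hc X d, hd', actionHomRight_id]

/-- The action on the objects fixed by a module endomorphism of the identity. -/
@[reducible]
def IsModuleCentral.fixedByAction {z : CatCenter M} (hc : IsModuleCentral C z) :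
    MonoidalLeftAction C (fixedBy z).FullSubcategory :=
  fullSubcategoryAction (fixedBy z) hc.fixedBy_actionObj

variable {k : Type w} [Field k] [Abelian C] [Linear k C] [Abelian M] [Linear k M]

/-- The inclusion into `M` preserves and reflects finite limits and colimits and intertwines the
actions, so exactness and linearity are inherited from `M`. -/
lemma isModuleCategory_fixedBy [IsModuleCategory k C M] {z : CatCenter M} (hz : z * z = z)
    (hc : IsModuleCentral C z) :
    letI := hc.fixedByAction
    IsModuleCategory k C (fixedBy z).FullSubcategory := by
  let := hc.fixedByAction
  have hM : IsFiniteCategory k M := IsModuleCategory.toIsFiniteCategory C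
  have lex_left := IsModuleCategory.lex_left (k := k) (C := C) (M := M)
  have rex_left := IsModuleCategory.rex_left (k := k) (C := C) (M := M)
  have lex_right := IsModuleCategory.lex_right (k := k) (C := C) (M := M)
  have rex_right := IsModuleCategory.rex_right (k := k) (C := C) (M := M)
  have additive_left := IsModuleCategory.additive_left (k := k) (C := C) (M := M)
  have additive_right := IsModuleCategory.additive_right (k := k) (C := C) (M := M)
  have linear_left := IsModuleCategory.linear_left (k := k) (C := C) (M := M)
  have linear_right := IsModuleCategory.linear_right (k := k) (C := C) (M := M)
  exact {
    isFiniteCategory_fixedBy hz with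
    additive_left := fun X => ⟨by
      intro d e f g; ext; exact (actionLeft M X).map_add⟩
    additive_right := fun d => ⟨by
      intro X Y f g; ext; exact (actionRight C d.obj).map_add⟩
    linear_left := fun X => ⟨by
      intro d e f c; ext; exact (actionLeft M X).map_smul c f.hom⟩
    linear_right := fun d => ⟨by
      intro X Y f c; ext; exact (actionRight C d.obj).map_smul c f⟩
    lex_left := fun X => ⟨fun J _ _ => by
      have : PreservesLimitsOfShape J (actionLeft (fixedBy z).FullSubcategory X ⋙ (fixedBy z).ι) :=
        inferInstanceAs (PreservesLimitsOfShape J ((fixedBy z).ι ⋙ actionLeft M X))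
      exact preservesLimitsOfShape_of_reflects_of_preserves _ (fixedBy z).ι⟩
    rex_left := fun X => ⟨fun J _ _ => by
      have : PreservesColimitsOfShape J
          (actionLeft (fixedBy z).FullSubcategory X ⋙ (fixedBy z).ι) :=
        inferInstanceAs (PreservesColimitsOfShape J ((fixedBy z).ι ⋙ actionLeft M X))
      exact preservesColimitsOfShape_of_reflects_of_preserves _ (fixedBy z).ι⟩
    lex_right := fun d => ⟨fun J _ _ => by
      have : PreservesLimitsOfShape J (actionRight C d ⋙ (fixedBy z).ι) :=
        inferInstanceAs (PreservesLimitsOfShape J (actionRight C d.obj))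
      exact preservesLimitsOfShape_of_reflects_of_preserves _ (fixedBy z).ι⟩
    rex_right := fun d => ⟨fun J _ _ => by
      have : PreservesColimitsOfShape J (actionRight C d ⋙ (fixedBy z).ι) :=
        inferInstanceAs (PreservesColimitsOfShape J (actionRight C d.obj))
      exact preservesColimitsOfShape_of_reflects_of_preserves _ (fixedBy z).ι⟩ }

end ModuleSummand

end RelativeCenter

namespace RelativeCenter

open MonoidalLeftAction ObjectProperty

/-! ### Splitting a module category along complementary idempotents -/

section SummandFunctor

variable {M : Type u₃} [Category.{v₃} M] [Abelian M] {z : CatCenter M} (hz : z * z = z)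

/-- The image of an idempotent endomorphism of the identity functor. -/
def summand (d : M) : (fixedBy z).FullSubcategory := (exists_splitting hz d).choose

/-- The inclusion of the image of an idempotent. -/
def summandInl (d : M) : (summand hz d).obj ⟶ d := (exists_splitting hz d).choose_spec.choose

/-- The projection onto the image of an idempotent. -/
def summandFst (d : M) : d ⟶ (summand hz d).obj :=
  (exists_splitting hz d).choose_spec.choose_spec.choose

@[simp]
lemma summandInl_fst (d : M) : summandInl hz d ≫ summandFst hz d = 𝟙 _ :=
  (exists_splitting hz d).choose_spec.choose_spec.choose_spec.1

lemma summandFst_inl (d : M) : summandFst hz d ≫ summandInl hz d = z.app d :=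
  (exists_splitting hz d).choose_spec.choose_spec.choose_spec.2

@[simp]
lemma summandInl_fst_assoc {d e : M} (f : (summand hz d).obj ⟶ e) :
    summandInl hz d ≫ summandFst hz d ≫ f = f := by
  rw [← Category.assoc, summandInl_fst, Category.id_comp]

lemma summandFst_inl_assoc {d e : M} (f : d ⟶ e) :
    summandFst hz d ≫ summandInl hz d ≫ f = z.app d ≫ f := by
  rw [← Category.assoc, summandFst_inl]

@[simp]
lemma app_summandFst (d : M) : z.app d ≫ summandFst hz d = summandFst hz d := by
  rw [← summandFst_inl hz, Category.assoc, summandInl_fst, Category.comp_id]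

@[simp]
lemma summandInl_app (d : M) : summandInl hz d ≫ z.app d = summandInl hz d := by
  rw [← summandFst_inl hz, summandInl_fst_assoc]

/-- The projection of the category onto the image of an idempotent. -/
def summandFunctor : M ⥤ (fixedBy z).FullSubcategory where
  obj := summand hz
  map {d d'} f := homMk (summandInl hz d ≫ f ≫ summandFst hz d')
  map_id d := by ext; simp
  map_comp f g := by
    ext
    change _ = (summandInl hz _ ≫ f ≫ summandFst hz _) ≫ summandInl hz _ ≫ g ≫ summandFst hz _
    simp only [homMk_hom, Category.assoc]
    rw [summandFst_inl_assoc, ← z.naturality_assoc g, app_summandFst]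

variable {C : Type u₂} [Category.{v₂} C] [MonoidalCategory C] [MonoidalLeftAction C M]
  (hc : IsModuleCentral C z)

lemma IsModuleCentral.app_actionHomRight_fst (hc : IsModuleCentral C z) (X : C) (d : M) :
    z.app (X ⊙ₗ d) ≫ X ⊴ₗ summandFst hz d = X ⊴ₗ summandFst hz d := by
  rw [hc, ← actionHomRight_comp, app_summandFst]

/-- The projection onto the image of an idempotent commutes with the action. -/
def summandActionIso (X : C) (d : M) :
    (summand hz (X ⊙ₗ d)).obj ≅ X ⊙ₗ (summand hz d).obj where
  hom := summandInl hz _ ≫ X ⊴ₗ summandFst hz d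
  inv := X ⊴ₗ summandInl hz d ≫ summandFst hz _
  hom_inv_id := by
    rw [Category.assoc, ← actionHomRight_comp_assoc, summandFst_inl, ← hc, app_summandFst,
      summandInl_fst]
  inv_hom_id := by
    rw [Category.assoc, summandFst_inl_assoc, hc.app_actionHomRight_fst hz,
      ← actionHomRight_comp, summandInl_fst, actionHomRight_id]

/-- The projection onto the image of an idempotent is a module functor. -/
@[reducible]
def summandFunctorLinear :
    letI := hc.fixedByAction
    (summandFunctor hz).LeftLinear C :=
  letI := hc.fixedByAction
  leftLinearOfIso (summandFunctor hz) (fun X d => (fixedBy z).isoMk (summandActionIso hz hc X d))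
    (fun f d => by
      ext
      change (summandInl hz _ ≫ f ⊵ₗ d ≫ summandFst hz _) ≫
        summandInl hz _ ≫ _ ⊴ₗ summandFst hz d =
          (summandInl hz _ ≫ _ ⊴ₗ summandFst hz d) ≫ f ⊵ₗ _
      simp only [Category.assoc]
      rw [summandFst_inl_assoc, hc.app_actionHomRight_fst hz, action_exchange])
    (fun X d d' f => by
      ext
      change (summandInl hz _ ≫ X ⊴ₗ f ≫ summandFst hz _) ≫
        summandInl hz _ ≫ X ⊴ₗ summandFst hz d' =
          (summandInl hz _ ≫ X ⊴ₗ summandFst hz d) ≫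
            X ⊴ₗ (summandInl hz _ ≫ f ≫ summandFst hz _)
      simp only [Category.assoc]
      rw [summandFst_inl_assoc, hc.app_actionHomRight_fst hz, ← actionHomRight_comp,
        ← actionHomRight_comp, summandFst_inl_assoc, ← z.naturality_assoc, app_summandFst])
    (fun X Y d => by
      ext
      change (summandInl hz _ ≫ (X ⊗ Y) ⊴ₗ summandFst hz d) ≫ (αₗ _ _ _).hom =
        (summandInl hz _ ≫ (αₗ X Y d).hom ≫ summandFst hz _) ≫
          (summandInl hz _ ≫ X ⊴ₗ summandFst hz (Y ⊙ₗ d)) ≫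
            X ⊴ₗ (summandInl hz _ ≫ Y ⊴ₗ summandFst hz d)
      simp only [Category.assoc]
      -- Each inclusion following a projection inserts `z`; centrality moves it inside the action,
      -- where the next projection absorbs it.
      rw [summandFst_inl_assoc, ← actionHomRight_comp, summandFst_inl_assoc,
        hc.app_actionHomRight_fst hz, hc X (Y ⊙ₗ d), ← actionHomRight_comp,
        hc.app_actionHomRight_fst hz]
      simp)
    (fun d => by
      ext
      change (summandInl hz _ ≫ 𝟙_ C ⊴ₗ summandFst hz d) ≫ (λₗ _).hom =
        summandInl hz _ ≫ (λₗ d).hom ≫ summandFst hz d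
      simp)

end SummandFunctor

section ProdFunctor

variable {C : Type u₂} [Category.{v₂} C] [MonoidalCategory C]
  {M : Type u₃} [Category.{v₃} M] [MonoidalLeftAction C M]
  {M₁ : Type u₃} [Category.{v₃} M₁] [MonoidalLeftAction C M₁]
  {M₂ : Type u₃} [Category.{v₃} M₂] [MonoidalLeftAction C M₂]

open Functor.OplaxLeftLinear in
/-- Two module functors define a module functor to the product. -/
@[reducible]
def leftLinearProd' (F₁ : M ⥤ M₁) (F₂ : M ⥤ M₂) [F₁.LeftLinear C] [F₂.LeftLinear C] :
    (Functor.prod' F₁ F₂).LeftLinear C :=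
  leftLinearOfIso (Functor.prod' F₁ F₂)
    (fun X d => (Functor.LeftLinear.μₗIso F₁ X d).symm.prod
      (Functor.LeftLinear.μₗIso F₂ X d).symm)
    (fun f d => Prod.ext (δₗ_naturality_left F₁ f d) (δₗ_naturality_left F₂ f d))
    (fun X _ _ f => Prod.ext (δₗ_naturality_right F₁ X f) (δₗ_naturality_right F₂ X f))
    (fun X Y d => Prod.ext (δₗ_associativity F₁ X Y d) (δₗ_associativity F₂ X Y d))
    (fun d => Prod.ext (δₗ_unitality_hom F₁ d) (δₗ_unitality_hom F₂ d))

end ProdFunctor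

section Idempotent

variable {M : Type u₃} [Category.{v₃} M] [Abelian M] {z z' : CatCenter M}
  (hz : z * z = z) (hz' : z' * z' = z')

/-- The image of an idempotent is unique. -/
def summandIso {d : M} {e : (fixedBy z).FullSubcategory} (i : e.obj ⟶ d) (s : d ⟶ e.obj)
    (h₁ : i ≫ s = 𝟙 e.obj) (h₂ : s ≫ i = z.app d) : summand hz d ≅ e :=
  (fixedBy z).isoMk
    { hom := summandInl hz d ≫ s
      inv := i ≫ summandFst hz d
      hom_inv_id := by
        rw [Category.assoc, reassoc_of% h₂, app_summandFst, summandInl_fst]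
      inv_hom_id := by
        rw [Category.assoc, summandFst_inl_assoc, ← h₂, Category.assoc, h₁, Category.comp_id, h₁] }

-- `z'` vanishes on the image of `z` and commutes with `f`, so there are no morphisms between the
-- two summands.
include hz in
lemma summandInl_comp_fst_eq_zero (h : z + z' = 1) {d d' : M} (f : d ⟶ d') :
    summandInl hz d ≫ f ≫ summandFst hz' d' = 0 := by
  have h1 : z.app d + z'.app d = 𝟙 d := by
    rw [← CatCenter.app_add, h]
    rfl
  have h2 : summandInl hz d ≫ z'.app d = 0 := by
    rw [← eq_sub_iff_add_eq'] at h1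
    rw [h1, Preadditive.comp_sub, summandInl_app, Category.comp_id, sub_self]
  rw [← app_summandFst hz', z'.naturality_assoc f, reassoc_of% h2, zero_comp]

/-- The block-diagonal morphism with blocks `a` and `a'` restricts to `a`, the cross term being
zero. This gives fullness of the splitting functor. -/
lemma summandInl_comp_add_comp_fst (h : z + z' = 1) {d d' : M}
    (a : (summand hz d).obj ⟶ (summand hz d').obj)
    (a' : (summand hz' d).obj ⟶ (summand hz' d').obj) :
    summandInl hz d ≫ (summandFst hz d ≫ a ≫ summandInl hz d' +
      summandFst hz' d ≫ a' ≫ summandInl hz' d') ≫ summandFst hz d' = a := by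
  have h0 := summandInl_comp_fst_eq_zero hz hz' h (𝟙 d)
  rw [Category.id_comp] at h0
  simp [reassoc_of% h0]

/-- The projection of the category onto the images of two complementary idempotents. -/
abbrev splittingFunctor : M ⥤ (fixedBy z).FullSubcategory × (fixedBy z').FullSubcategory :=
  Functor.prod' (summandFunctor hz) (summandFunctor hz')

/-- A morphism commutes with both idempotents and is therefore block diagonal. This gives
faithfulness of the splitting functor. -/
lemma eq_sum_of_add_eq_one (h : z + z' = 1) {d d' : M} (f : d ⟶ d') :
    f = summandFst hz d ≫ (summandInl hz d ≫ f ≫ summandFst hz d') ≫ summandInl hz d' +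
      summandFst hz' d ≫ (summandInl hz' d ≫ f ≫ summandFst hz' d') ≫ summandInl hz' d' := by
  have h1 : z.app d' + z'.app d' = 𝟙 d' := by
    rw [← CatCenter.app_add, h]
    rfl
  have h2 : ∀ {w : CatCenter M}, w * w = w → ∀ d, w.app d ≫ w.app d = w.app d := fun hw d => by
    rw [← CatCenter.mul_app, hw]
  simp only [Category.assoc, summandFst_inl, summandFst_inl_assoc, ← CatCenter.naturality]
  rw [h2 hz, h2 hz', ← Preadditive.comp_add, h1, Category.comp_id]

lemma isEquivalence_splittingFunctor (h : z + z' = 1) :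
    (splittingFunctor hz hz').IsEquivalence where
  faithful := ⟨fun {d d'} f g hfg => by
    have h1 := congrArg InducedCategory.Hom.hom (congrArg Prod.fst hfg)
    have h2 := congrArg InducedCategory.Hom.hom (congrArg Prod.snd hfg)
    change summandInl hz d ≫ f ≫ summandFst hz d' = summandInl hz d ≫ g ≫ summandFst hz d' at h1
    change summandInl hz' d ≫ f ≫ summandFst hz' d' =
      summandInl hz' d ≫ g ≫ summandFst hz' d' at h2
    rw [eq_sum_of_add_eq_one hz hz' h f, eq_sum_of_add_eq_one hz hz' h g, h1, h2]⟩
  full := ⟨fun {d d'} a => by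
    have h' : z' + z = 1 := (add_comm _ _).trans h
    have h₂ := summandInl_comp_add_comp_fst hz' hz h' a.2.hom a.1.hom
    rw [add_comm] at h₂
    exact ⟨_, Prod.ext
      (ObjectProperty.hom_ext _ (summandInl_comp_add_comp_fst hz hz' h a.1.hom a.2.hom))
      (ObjectProperty.hom_ext _ h₂)⟩⟩
  -- A preimage is `e₁ ⊞ e₂`. There `z` is the projection onto `e₁`, because it vanishes on `e₂`,
  -- where `z'` is already the identity.
  essSurj := ⟨fun ⟨e₁, e₂⟩ => by
    have happ : ∀ d : M, z.app d + z'.app d = 𝟙 d := fun d => by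
      rw [← CatCenter.app_add, h]
      rfl
    have hz₂ : z.app e₂.obj = 0 := by
      have h1 := happ e₂.obj
      rwa [fixedBy.app e₂, add_eq_right] at h1
    have h₁ : biprod.fst ≫ biprod.inl = z.app (e₁.obj ⊞ e₂.obj) := by
      ext1
      · rw [biprod.inl_fst_assoc, z.naturality, fixedBy.app e₁, Category.id_comp]
      · rw [biprod.inr_fst_assoc, z.naturality, hz₂, zero_comp, zero_comp]
    have h₂ : biprod.snd ≫ biprod.inr = z'.app (e₁.obj ⊞ e₂.obj) := by
      rw [← add_right_inj (biprod.fst ≫ biprod.inl), biprod.total, h₁, happ]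
    exact ⟨e₁.obj ⊞ e₂.obj, ⟨(summandIso hz _ _ biprod.inl_fst h₁).prod
      (summandIso hz' _ _ biprod.inr_snd h₂)⟩⟩⟩

include hz in
lemma eq_zero_of_fixedBy (h : ∀ d : (fixedBy z).FullSubcategory, IsZero d) : z = 0 := by
  refine CatCenter.ext _ _ fun d => ?_
  rw [← summandFst_inl hz, (fixedBy.isZero (h (summand hz d))).eq_of_src (summandInl hz d) 0,
    comp_zero]
  rfl

end Idempotent

/-! ### Module endomorphisms of the identity are scalars -/

section Scalar

variable {k : Type w} [Field k]
  {C : Type u₂} [Category.{v₂} C] [Abelian C] [Linear k C] [MonoidalCategory C]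
  {M : Type u₃} [Category.{v₃} M] [Abelian M] [Linear k M] [MonoidalLeftAction C M]
  [IsModuleCategory k C M]

/-- On an indecomposable module category, the identity functor has no nontrivial idempotent module
endomorphisms. -/
lemma eq_zero_or_eq_one_of_idempotent (hindec : IsIndecomposable k C M) {z : CatCenter M}
    (hc : IsModuleCentral C z) (hz : z * z = z) : z = 0 ∨ z = 1 := by
  have hz' : (1 - z) * (1 - z) = 1 - z := IsIdempotentElem.one_sub hz
  have hc' : IsModuleCentral C (1 - z) :=
    sub_mem (S := Subalgebra k (CatCenter M)) (one_mem (moduleCenter k C M)) hc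
  let := hc.fixedByAction
  let := hc'.fixedByAction
  let := summandFunctorLinear hz hc
  let := summandFunctorLinear hz' hc'
  have := isEquivalence_splittingFunctor hz hz' (add_sub_cancel z 1)
  rcases hindec.2 _ _ (isModuleCategory_fixedBy hz hc) (isModuleCategory_fixedBy hz' hc')
    ⟨(splittingFunctor hz hz').asEquivalence,
      ⟨leftLinearProd' (summandFunctor hz) (summandFunctor hz')⟩⟩ with h | h
  · exact .inl (eq_zero_of_fixedBy hz h)
  · exact .inr (sub_eq_zero.1 (eq_zero_of_fixedBy hz' h)).symm

/-- The module endomorphisms of the identity functor of an exact indecomposable module category are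
the scalars. -/
theorem IsModuleCentral.exists_eq_algebraMap [IsAlgClosed k] [IsFiniteCategory k C]
    (hexact : IsExactModule C M) (hindec : IsIndecomposable k C M) {z : CatCenter M}
    (hz : IsModuleCentral C z) : ∃ c : k, z = algebraMap k (CatCenter M) c := by
  have : IsFiniteCategory k M := IsModuleCategory.toIsFiniteCategory C
  have := finite_catCenter k M
  have : Nontrivial (CatCenter M) := by
    obtain ⟨d, hd⟩ := hindec.1
    refine ⟨1, 0, fun h => hd ((IsZero.iff_id_eq_zero d).2 ?_)⟩
    exact congrArg (fun w : CatCenter M => w.app d) h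
  -- Module endomorphisms form a subalgebra, so it contains every polynomial in `z`.
  have hp : ∀ p, IsModuleCentral C (Polynomial.aeval z p) := fun p =>
    Algebra.adjoin_le (S := moduleCenter k C M) (Set.singleton_subset_iff.2 hz)
      (Polynomial.aeval_mem_adjoin_singleton k z)
  exact exists_eq_algebraMap_of_aeval (IsIntegral.of_finite k z)
    (fun p h => eq_zero_of_square_zero k hexact (hp p) h)
    (fun p h => eq_zero_or_eq_one_of_idempotent hindec (hp p) h)

end Scalar

/-! ### Connectedness of the algebra -/

section Connected

open ObjectProperty

variable {V : Type u₁} [Category.{v₁} V] [MonoidalCategory V] [RightRigidCategory V]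
  {C : Type u₂} [Category.{v₂} C] [MonoidalCategory C]
  {M : Type u₃} [Category.{v₃} M] [MonoidalLeftAction C M]
  {G : V ⥤ Center C} [G.Monoidal] {H : InternalHom C M} (R : RelEnds G H)
  {σ : HalfBraiding ((rhoBar R).obj (𝟙_ (ModEnd (Via G) M)))}

/-- The endomorphism of the identity functor given by a morphism `𝟙 ⟶ ρ̄(Id)`. -/
def toCatCenter (f : 𝟙_ C ⟶ (rhoBar R).obj (𝟙_ (ModEnd (Via G) M))) : CatCenter M where
  app d := (λₗ[C] d).inv ≫ f ⊵ₗ d ≫ counitApp R d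
  naturality d d' g := by
    change g ≫ (λₗ[C] d').inv ≫ f ⊵ₗ d' ≫ counitApp R d' =
      ((λₗ[C] d).inv ≫ f ⊵ₗ d ≫ counitApp R d) ≫ g
    simp only [Category.assoc]
    rw [← counitApp_naturality, ← action_exchange_assoc, ← actionUnitIso_inv_naturality_assoc]

lemma toCatCenter_app (f : 𝟙_ C ⟶ (rhoBar R).obj (𝟙_ (ModEnd (Via G) M))) (d : M) :
    (toCatCenter R f).app d = (λₗ[C] d).inv ≫ f ⊵ₗ d ≫ counitApp R d := rfl

/-- Let both sides of the centrality equation for `f` act on `d`. Compatibility of `σ` turns the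
left side into the endomorphism at `X ▷ d`, while the right side is `X ▷ -` of the endomorphism at
`d`. -/
lemma isModuleCentral_toCatCenter (hσ : ∀ X : C, ActCompatible R X (σ.β X).hom)
    {f : 𝟙_ C ⟶ (rhoBar R).obj (𝟙_ (ModEnd (Via G) M))}
    (hf : ∀ X, f ▷ X ≫ (σ.β X).hom = ((λ_ X).hom ≫ (ρ_ X).inv) ≫ X ◁ f) :
    IsModuleCentral C (toCatCenter R f) := by
  intro X d
  have h2 := congrArg (· ⊵ₗ d ≫ (αₗ X ((rhoBar R).obj (𝟙_ _)) d).hom ≫ X ⊴ₗ counitApp R d) (hf X)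
  have h3 := hσ X d
  have h4 : (ρ_ X).inv ⊵ₗ d ≫ (αₗ X (𝟙_ C) d).hom = X ⊴ₗ (λₗ[C] d).inv := by
    rw [← cancel_mono (X ⊴ₗ (λₗ[C] d).hom), Category.assoc, ← rightUnitor_actionHom,
      ← comp_actionHomLeft, ← actionHomRight_comp]
    simp
  simp only [comp_actionHomLeft, whiskerRight_actionHomLeft, whiskerLeft_actionHomLeft,
    leftUnitor_actionHom, Category.assoc] at h2
  rw [h3, Iso.inv_hom_id_assoc, Iso.inv_hom_id_assoc, cancel_epi, reassoc_of% h4] at h2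
  simp only [toCatCenter_app, actionHomRight_comp]
  rw [h2, Iso.inv_hom_id_assoc]

end Connected

section Finrank

open ObjectProperty

variable {k : Type w} [Field k] [IsAlgClosed k]
  {V : Type u₁} [Category.{v₁} V] [MonoidalCategory V] [RightRigidCategory V]
  {C : Type u₂} [Category.{v₂} C] [Abelian C] [Linear k C] [MonoidalCategory C]
  [MonoidalPreadditive C] [MonoidalLinear k C] [IsFiniteCategory k C]
  {M : Type u₃} [Category.{v₃} M] [Abelian M] [Linear k M] [MonoidalLeftAction C M]
  [IsModuleCategory k C M]
  {G : V ⥤ Center C} [G.Monoidal] {H : InternalHom C M} {R : RelEnds G H}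
  [∀ X : C, IsIso (lInv R X (𝟙_ (ModEnd (Via G) M)))]
  {σ : HalfBraiding ((rhoBar R).obj (𝟙_ (ModEnd (Via G) M)))}

/-- The algebra `ρ̄(Id)` is connected. -/
theorem finrank_unit_hom_centralObj (hexact : IsExactModule C M)
    (hindec : IsIndecomposable k C M) (hσ : ∀ X : C, ActCompatible R X (σ.β X).hom) :
    Module.finrank k (𝟙_ (Center C) ⟶ centralObj R σ) = 1 := by
  have hadd := IsModuleCategory.additive_right (k := k) (C := C) (M := M)
  have hlin := IsModuleCategory.linear_right (k := k) (C := C) (M := M)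
  -- The unit of `A` acts as the identity on a nonzero object of `M`.
  have hne : centralUnit hσ ≠ 0 := by
    intro h0
    obtain ⟨d, hd⟩ := hindec.1
    refine hd ((IsZero.iff_id_eq_zero d).2 ?_)
    have h1 : algUnit R = 0 := congrArg Center.Hom.f h0
    have h2 := algUnit_act R d
    rw [h1, show (0 : 𝟙_ C ⟶ (rhoBar R).obj (𝟙_ _)) ⊵ₗ d = 0 from
      (actionRight C d).map_zero _ _, zero_comp] at h2
    rw [← (λₗ[C] d).inv_hom_id, ← h2, comp_zero]
  refine (finrank_eq_one_iff_of_nonzero' _ hne).2 fun f => ?_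
  -- `f` acts on `M` by a scalar `c`, exactly as `c` times the unit does; the action detects
  -- morphisms into `A`.
  obtain ⟨c, hc⟩ := (isModuleCentral_toCatCenter R hσ f.comm).exists_eq_algebraMap hexact hindec
  refine ⟨c, Center.ext _ _ (rhoBar_unit_hom_ext R fun d => ?_)⟩
  have h1 : (λₗ[C] d).inv ≫ f.f ⊵ₗ d ≫ counitApp R d = c • 𝟙 d :=
    congrArg (fun z : CatCenter M => z.app d) hc
  have h2 : (c • algUnit R) ⊵ₗ d = c • algUnit R ⊵ₗ d :=
    Functor.Linear.map_smul (F := actionRight C d) (algUnit R) c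
  change (c • algUnit R) ⊵ₗ d ≫ counitApp R d = f.f ⊵ₗ d ≫ counitApp R d
  rw [h2, Linear.smul_comp, algUnit_act]
  refine (cancel_epi (λₗ[C] d).inv).1 (Eq.trans ?_ h1.symm)
  rw [Linear.comp_smul, Iso.inv_hom_id]

end Finrank

end RelativeCenter

/-! ### The main theorem -/

theorem mainTheorem4
    {k : Type w} [Field k] [IsAlgClosed k]
    -- the braided tensor category
    {V : Type u₁} [Category.{v₁} V] [Abelian V] [Linear k V] [MonoidalCategory V]
    [MonoidalPreadditive V] [MonoidalLinear k V]
    [RigidCategory V] [BraidedCategory V] [RelativeCenter.IsTensorCategory k V]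
    -- the tensor category
    {C : Type u₂} [Category.{v₂} C] [Abelian C] [Linear k C] [MonoidalCategory C]
    [MonoidalPreadditive C] [MonoidalLinear k C]
    [RigidCategory C] [RelativeCenter.IsTensorCategory k C]
    -- the central structure
    (G : V ⥤ Center C) [G.Braided] [G.Faithful] [PreservesFiniteColimits G]
    -- the exact indecomposable module category
    {M : Type u₃} [Category.{v₃} M] [Abelian M] [Linear k M] [MonoidalLeftAction C M]
    [RelativeCenter.IsModuleCategory k C M]
    (hexact : RelativeCenter.IsExactModule C M)
    (hindec : RelativeCenter.IsIndecomposable k C M) :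
    -- internal Homs and the relative ends defining `ρ̄` exist, and for every choice of them:
    Nonempty (RelativeCenter.InternalHom C M) ∧
    ∀ H : RelativeCenter.InternalHom C M,
      Nonempty (RelativeCenter.RelEnds G H) ∧
      ∀ R : RelativeCenter.RelEnds G H,
        -- `ρ̄` is a functor of bimodule categories
        (∀ (X : C) (F : RelativeCenter.ModEnd (RelativeCenter.Via G) M),
          IsIso (RelativeCenter.lInv R X F)) ∧
        (∀ (F : RelativeCenter.ModEnd (RelativeCenter.Via G) M) (X : C),
          IsIso (RelativeCenter.rInv R F X)) ∧
        ∃ σ : HalfBraiding ((RelativeCenter.rhoBar R).obj (𝟙_ _)),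
          -- `σ` is the half-braiding of the object `Z_C(ρ̄)(Id)`
          (∀ X : C, (σ.β X).hom ≫ RelativeCenter.lInv R X (𝟙_ _) =
            RelativeCenter.rInv R (𝟙_ _) X ≫ (RelativeCenter.rhoBar R).map
              ((λ_ ((RelativeCenter.rho M G).obj X)).hom ≫
                (ρ_ ((RelativeCenter.rho M G).obj X)).inv)) ∧
          -- the compatibility with the dinatural maps, which determines `σ`
          RelativeCenter.IsPiCompatible R σ ∧
          (∀ σ' : HalfBraiding ((RelativeCenter.rhoBar R).obj (𝟙_ _)),
            RelativeCenter.IsPiCompatible R σ' → σ' = σ) ∧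
          -- the object lies in the relative center, where it is a commutative algebra
          (∃ (hσ : RelativeCenter.relativeCenter G (RelativeCenter.centralObj R σ))
            (inst : MonObj (⟨RelativeCenter.centralObj R σ, hσ⟩ :
              (RelativeCenter.relativeCenter G).FullSubcategory)),
            inst.mul.hom.f = RelativeCenter.algMul R ∧
            inst.one.hom.f = RelativeCenter.algUnit R ∧
            IsCommMonObj (⟨RelativeCenter.centralObj R σ, hσ⟩ :
              (RelativeCenter.relativeCenter G).FullSubcategory)) ∧
          -- the algebra is connected
          Module.finrank k (𝟙_ (Center C) ⟶ RelativeCenter.centralObj R σ) = 1 := by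
  have hM : RelativeCenter.IsFiniteCategory k M :=
    RelativeCenter.IsModuleCategory.toIsFiniteCategory C
  refine ⟨RelativeCenter.nonempty_internalHom k C M, fun H =>
    ⟨RelativeCenter.nonempty_relEnds k G H, fun R => ?_⟩⟩
  have hl (X : C) (F : RelativeCenter.ModEnd (RelativeCenter.Via G) M) :
      IsIso (RelativeCenter.lInv R X F) :=
    -- A left factor `X` is moved across by its right dual, and in `r⁻¹` a right factor by its left
    -- dual; rigidity provides both.
    RelativeCenter.isIso_projection_left (RelativeCenter.rhoAdj R) X Xᘁ F
  have hr (F : RelativeCenter.ModEnd (RelativeCenter.Via G) M) (X : C) :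
      IsIso (RelativeCenter.rInv R F X) :=
    RelativeCenter.isIso_projection_right (RelativeCenter.rhoAdj R) X (ᘁX) F
  have hσ := RelativeCenter.actCompatible_centralIso R
  refine ⟨hl, hr, RelativeCenter.centralHalfBraiding R, RelativeCenter.centralIso_comp_lInv R,
    (RelativeCenter.isPiCompatible_iff R _).2 hσ, fun σ' hσ' =>
      RelativeCenter.HalfBraiding.eq_of_actCompatible hσ
        ((RelativeCenter.isPiCompatible_iff R σ').1 hσ'),
    ⟨RelativeCenter.relativeCenter_centralObj hσ, RelativeCenter.centralMonObj hσ, rfl, rfl,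
      RelativeCenter.isCommMonObj_centralObj hσ⟩,
    RelativeCenter.finrank_unit_hom_centralObj hexact hindec hσ⟩
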